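/- \textbf{Setting.} Let $\mathcal H_m=L^2(\mathbb R^m)$ be the Hilbert space of $m$ modes, with $a_j=(x_j+ip_j)/\sqrt2$, $p_j=-i\,\partial/\partial x_j$, and on $\mathcal H_1$ let $|n\rangle=(a^\dagger)^n|0\rangle/\sqrt{n!}$ be the Fock states. For a set $\mathcal M$ of measurements (normalised POVMs $E$ on measurable spaces $\mathcal X$) and a trace-class operator $Z$ put $$\|Z\|_{\mathcal M}=\sup_{E\in\mathcal M}\int_{\mathcal X}\bigl|\operatorname{Tr}[Z\,E(dx)]\bigr|,$$ where the integral denotes the total variation of the complex measure $A\mapsto\operatorname{Tr}[Z\,E(A)]$. For states $\rho,\sigma$ and $p\in[0,1]$ let $\beta_{\mathcal M}(\rho,\sigma;p)=\|p\rho-(1-p)\sigma\|_{\mathcal M}$ and $\beta_1(\rho,\sigma;p)=\|p\rho-(1-p)\sigma\|_1$, where $\|T\|_1=\operatorname{Tr}|T|$. A Gaussian unitary is a product of exponentials $e^{iH}$ with $$H=\sum_j(\alpha_ja_j^\dagger+\alpha_j^*a_j)+\sum_{j,k}(X_{jk}a_j^\dagger a_k+Y_{jk}a_ja_k+Y_{jk}^*a_j^\dagger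 a_k^\dagger),\qquad X=X^\dagger,\quad Y=Y^{\mathsf T}.$$ $\mathrm{GOCC}$ is the set of measurements that can be implemented by sequentially adding ancillary modes in the vacuum, applying Gaussian unitaries, homodyning modes, discarding modes and classically processing the outcomes, where each operation may depend on the previous outcomes. $\mathcal W_+$ is the set of measurements all of whose operators $E(A)$ have a non-negative Wigner distribution. For $\lambda\in[0,1)$ define the single-mode operators $$\omega_\lambda^+=(1-\lambda^2)\sum_{n\ge0}\lambda^{2n}|2n\rangle\langle 2n|,\qquad \omega_\lambda^-=(1-\lambda^2)\sum_{n\ge0}\lambda^{2n}|2n+1\rangle\langle 2n+1|.$$ \textbf{Theorem.} For every $\lambda\in[0,1)$ the operators $\omega_\lambda^+,\omega_\lambda^-$ are density operators with $\omega_\lambda^+\omega_\lambda^-=0$, and $$\tfrac12\|\omega_\lambda^+-\omega_\lambda^-\|_1=1,$$ but $$\tfrac12\|\omega_\lambda^+-\omega_\lambda^-\|_{\mathrm{GOCC}}\le\tfrac12\|\omega_\lambda^+-\omega_\lambda^-\|_{\mathcal W_+}\le 2\left(\frac{1-\lambda}{1+\lambda}\right)^{\frac{1+\lambda^2}{2\lambda}},$$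 where for $\lambda=0$ the right-hand side is understood as its limit $2/e$. Moreover, as $\lambda\to1^-$, $$2\left(\frac{1-\lambda}{1+\lambda}\right)^{\frac{1+\lambda^2}{2\lambda}}=1-\lambda+O\bigl((1-\lambda)^2\bigr).$$ In particular, the schemes $(\omega_\lambda^+,\omega_\lambda^-;\tfrac12)$ exhibit data hiding against $\mathrm{GOCC}$ as $\lambda\to1^-$: one has $\beta_1(\omega_\lambda^+,\omega_\lambda^-;\tfrac12)=1$ for all $\lambda\in[0,1)$, while $\lim_{\lambda\to1^-}\beta_{\mathrm{GOCC}}(\omega_\lambda^+,\omega_\lambda^-;\tfrac12)=0$. -/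

import Mathlib

open MeasureTheory Filter Topology Asymptotics
open scoped SchwartzMap ENNReal InnerProductSpace ComplexConjugate

noncomputable section

namespace CV

/-! ## Continuous-variable systems -/

/-- The Hilbert space `L²(ℝᵐ)` of an `m`-mode continuous-variable system. -/
abbrev L2 (m : ℕ) : Type := Lp ℂ 2 (volume : Measure (Fin m → ℝ))

/-- Schwartz functions on `ℝᵐ`: the common invariant domain of all polynomials in the
canonical operators. -/
abbrev Schw (m : ℕ) : Type := 𝓢(Fin m → ℝ, ℂ)

/-- A Schwartz function regarded as a vector of `L²(ℝᵐ)`. -/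
abbrev Schw.vec {m : ℕ} (f : Schw m) : L2 m := f.toLp 2 volume

/-- The position operator `x_j` on Schwartz functions. -/
def position {m : ℕ} (j : Fin m) : Schw m →L[ℂ] Schw m :=
  SchwartzMap.smulLeftCLM ℂ (fun x : Fin m → ℝ => (x j : ℂ))

theorem position_apply {m : ℕ} (j : Fin m) (f : Schw m) (x : Fin m → ℝ) :
    position j f x = (x j : ℂ) * f x := by
  have h : Function.HasTemperateGrowth (fun x : Fin m → ℝ => (x j : ℂ)) :=
    (Complex.ofRealCLM.comp (ContinuousLinearMap.proj (R := ℝ) (φ := fun _ : Fin m => ℝ)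
      j)).hasTemperateGrowth
  simp [position, SchwartzMap.smulLeftCLM_apply_apply h]

/-- The partial derivative `∂/∂x_j`, i.e. `i p_j`. -/
def partialDeriv {m : ℕ} (j : Fin m) : Schw m →L[ℂ] Schw m :=
  LineDeriv.lineDerivOpCLM ℂ (Schw m) (Pi.single j (1 : ℝ) : Fin m → ℝ)

/-- The annihilation operator `a_j = (x_j + i p_j) / √2`. -/
def annihilation {m : ℕ} (j : Fin m) : Schw m →L[ℂ] Schw m :=
  ((1 / Real.sqrt 2 : ℝ) : ℂ) • (position j + partialDeriv j)

/-- The creation operator `a_j† = (x_j - i p_j) / √2`. -/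
def creation {m : ℕ} (j : Fin m) : Schw m →L[ℂ] Schw m :=
  ((1 / Real.sqrt 2 : ℝ) : ℂ) • (position j - partialDeriv j)

/-! ## Vacuum and Fock states -/

/-- The vacuum wave function `π^{-m/4} exp(-|x|²/2)`. -/
def vacuumFun (m : ℕ) (x : Fin m → ℝ) : ℂ :=
  ((Real.pi ^ (-(m : ℝ) / 4) * Real.exp (-(∑ j, x j ^ 2) / 2) : ℝ) : ℂ)

theorem hasTemperateGrowth_quad (m : ℕ) :
    Function.HasTemperateGrowth (fun x : Fin m → ℝ => -(∑ j, x j ^ 2) / 2) := by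
  have h1 : ∀ j : Fin m, Function.HasTemperateGrowth (fun x : Fin m → ℝ => x j ^ 2) := fun j =>
    ((ContinuousLinearMap.proj (R := ℝ) (φ := fun _ : Fin m => ℝ) j).hasTemperateGrowth).pow 2
  have h2 : Function.HasTemperateGrowth (fun x : Fin m → ℝ => ∑ j, x j ^ 2) :=
    Function.HasTemperateGrowth.sum (fun j _ => h1 j)
  have h3 := (Function.HasTemperateGrowth.const (E := Fin m → ℝ) (-1 / 2 : ℝ)).mul h2
  have h4 : (fun x : Fin m → ℝ => -(∑ j, x j ^ 2) / 2) =
      (fun _ => (-1 / 2 : ℝ)) * (fun x : Fin m → ℝ => ∑ j, x j ^ 2) := by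
    funext x; simp only [Pi.mul_apply]; ring
  rw [h4]; exact h3

theorem norm_sq_le_sum_sq {m : ℕ} (x : Fin m → ℝ) : ‖x‖ ^ 2 ≤ ∑ j, x j ^ 2 := by
  have h0 : 0 ≤ ∑ j, x j ^ 2 := Finset.sum_nonneg fun j _ => sq_nonneg _
  have : ‖x‖ ≤ Real.sqrt (∑ j, x j ^ 2) := by
    rw [pi_norm_le_iff_of_nonneg (Real.sqrt_nonneg _)]
    intro j
    rw [Real.norm_eq_abs]
    exact Real.abs_le_sqrt (Finset.single_le_sum (f := fun j => x j ^ 2)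
      (fun j _ => sq_nonneg _) (Finset.mem_univ j))
  calc ‖x‖ ^ 2 ≤ Real.sqrt (∑ j, x j ^ 2) ^ 2 := by gcongr
    _ = _ := Real.sq_sqrt h0

theorem bounded_pow_mul_gauss (N : ℕ) :
    ∃ C : ℝ, ∀ t : ℝ, 0 ≤ t → (1 + t) ^ N * Real.exp (-t ^ 2 / 2) ≤ C := by
  refine ⟨(N.factorial : ℝ) * Real.exp (3 / 2), fun t ht => ?_⟩
  have h1 : (1 + t) ^ N ≤ N.factorial * Real.exp (1 + t) := by
    have := Real.pow_div_factorial_le_exp (1 + t) (by positivity) N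
    rwa [div_le_iff₀ (by positivity), mul_comm] at this
  calc (1 + t) ^ N * Real.exp (-t ^ 2 / 2)
      ≤ (N.factorial * Real.exp (1 + t)) * Real.exp (-t ^ 2 / 2) := by gcongr
    _ = N.factorial * Real.exp (1 + t + -t ^ 2 / 2) := by rw [mul_assoc, ← Real.exp_add]
    _ ≤ _ := by
      gcongr
      nlinarith [sq_nonneg (t - 1)]

theorem gauss_contDiff (m : ℕ) :
    ContDiff ℝ (⊤ : ℕ∞) (fun x : Fin m → ℝ => Real.exp (-(∑ j, x j ^ 2) / 2)) :=
  (hasTemperateGrowth_quad m).1.exp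

theorem gauss_decay (m k n : ℕ) : ∃ C : ℝ, ∀ x : Fin m → ℝ,
    ‖x‖ ^ k * ‖iteratedFDeriv ℝ n (fun x : Fin m → ℝ => Real.exp (-(∑ j, x j ^ 2) / 2)) x‖
      ≤ C := by
  obtain ⟨K, C, hC, hb⟩ := (hasTemperateGrowth_quad m).norm_iteratedFDeriv_le_uniform n
  obtain ⟨B, hB⟩ := bounded_pow_mul_gauss (k + K * n)
  refine ⟨n.factorial * (1 + C) ^ n * B, fun x => ?_⟩
  have key := norm_iteratedFDeriv_comp_le (𝕜 := ℝ) (g := Real.exp)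
    (f := fun x : Fin m → ℝ => -(∑ j, x j ^ 2) / 2) (n := n) (N := (⊤ : ℕ∞))
    Real.contDiff_exp (hasTemperateGrowth_quad m).1 (by exact_mod_cast le_top) x
    (C := Real.exp (-(∑ j, x j ^ 2) / 2)) (D := (1 + C) * (1 + ‖x‖) ^ K)
    (fun i _ => by
      rw [norm_iteratedFDeriv_eq_norm_iteratedDeriv, iteratedDeriv_eq_iterate,
        Real.iter_deriv_exp, Real.norm_eq_abs, abs_of_pos (Real.exp_pos _)])
    (fun i hi1 hin => by
      have hD : 1 ≤ (1 + C) * (1 + ‖x‖) ^ K := by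
        have : 1 ≤ (1 + ‖x‖) ^ K := one_le_pow₀ (by linarith [norm_nonneg x])
        nlinarith
      calc _ ≤ C * (1 + ‖x‖) ^ K := hb i hin x
        _ ≤ (1 + C) * (1 + ‖x‖) ^ K := by gcongr; linarith
        _ ≤ _ := le_self_pow₀ hD (by omega))
  have hx := norm_nonneg x
  calc ‖x‖ ^ k * ‖iteratedFDeriv ℝ n (fun x : Fin m → ℝ => Real.exp (-(∑ j, x j ^ 2) / 2)) x‖
      ≤ (1 + ‖x‖) ^ k * (n.factorial * Real.exp (-(∑ j, x j ^ 2) / 2) *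
          ((1 + C) * (1 + ‖x‖) ^ K) ^ n) := by
        gcongr
        · linarith
        · exact key
    _ = n.factorial * (1 + C) ^ n *
          ((1 + ‖x‖) ^ (k + K * n) * Real.exp (-(∑ j, x j ^ 2) / 2)) := by
        rw [mul_pow, pow_add, pow_mul]; ring
    _ ≤ n.factorial * (1 + C) ^ n * ((1 + ‖x‖) ^ (k + K * n) * Real.exp (-‖x‖ ^ 2 / 2)) := by
        gcongr
        exact norm_sq_le_sum_sq x
    _ ≤ _ := by
        gcongr
        exact hB _ hx

/-- The Gaussian `exp(-|x|²/2)` as a real Schwartz function. -/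
def gauss (m : ℕ) : 𝓢(Fin m → ℝ, ℝ) where
  toFun x := Real.exp (-(∑ j, x j ^ 2) / 2)
  smooth' := gauss_contDiff m
  decay' := gauss_decay m

/-- The vacuum state `|0⟩` of `m` modes, with wave function `vacuumFun m`. -/
def vacuum (m : ℕ) : Schw m :=
  ((Real.pi ^ (-(m : ℝ) / 4) : ℝ) : ℂ) • (gauss m).postcompCLM Complex.ofRealCLM

theorem vacuum_apply (m : ℕ) (x : Fin m → ℝ) : vacuum m x = vacuumFun m x := by
  have h : gauss m x = Real.exp (-(∑ j, x j ^ 2) / 2) := rfl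
  simp [vacuum, vacuumFun, SchwartzMap.postcompCLM_apply, h]

/-- The single-mode Fock state `|n⟩ = (n!)^{-1/2} (a†)ⁿ |0⟩`. -/
def fock (n : ℕ) : Schw 1 :=
  ((1 / Real.sqrt n.factorial : ℝ) : ℂ) • ((creation (0 : Fin 1)) ^ n) (vacuum 1)

/-! ## Trace norm and trace -/

section Operators

variable {H : Type} [NormedAddCommGroup H] [InnerProductSpace ℂ H] [CompleteSpace H]

/-- A fixed orthonormal basis of `H`, used to define traces. -/
def stdBasis (H : Type) [NormedAddCommGroup H] [InnerProductSpace ℂ H] [CompleteSpace H] :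
    HilbertBasis (exists_hilbertBasis ℂ H).choose ℂ H :=
  (exists_hilbertBasis ℂ H).choose_spec.choose

/-- The trace norm `‖T‖₁ = Tr |T|`, `|T| = √(T†T)`, with value `∞` if `T` is not trace class. -/
def traceNorm (T : H →L[ℂ] H) : ℝ≥0∞ :=
  ∑' i, ENNReal.ofReal (RCLike.re ⟪stdBasis H i, CFC.abs T (stdBasis H i)⟫_ℂ)

/-- The trace of a trace-class operator. -/
def opTrace (T : H →L[ℂ] H) : ℂ :=
  ∑' i, ⟪stdBasis H i, T (stdBasis H i)⟫_ℂ

/-- Density operators: positive operators of trace one (for `ρ ≥ 0` one has `‖ρ‖₁ = Tr ρ`). -/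
def IsDensityOperator (ρ : H →L[ℂ] H) : Prop :=
  ρ.IsPositive ∧ traceNorm ρ = 1

end Operators

/-! ## Measurements and distinguishability norms -/

/-- A normalised positive operator-valued measure on `H` with outcomes in `X`: positive
operators `E A` for measurable `A`, weakly σ-additive, with `E X = 1`. Values on non-measurable
sets play no role. -/
structure POVM (H : Type) [NormedAddCommGroup H] [InnerProductSpace ℂ H] [CompleteSpace H]
    (X : Type) [MeasurableSpace X] where
  toFun : Set X → (H →L[ℂ] H)
  pos : ∀ A, MeasurableSet A → (toFun A).IsPositive
  univ : toFun Set.univ = 1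
  sigma_additive : ∀ A : ℕ → Set X, (∀ n, MeasurableSet (A n)) →
    Pairwise (fun i j => Disjoint (A i) (A j)) →
    ∀ ψ : H, HasSum (fun n => ⟪ψ, toFun (A n) ψ⟫_ℂ) ⟪ψ, toFun (⋃ n, A n) ψ⟫_ℂ

/-- A set of measurements on `m` modes. -/
abbrev Measurements (m : ℕ) : Type 1 :=
  ∀ (X : Type) [MeasurableSpace X], POVM (L2 m) X → Prop

/-- Total variation norm of a complex measure: supremum of `∑ |ν(A)|` over finite families of
disjoint measurable sets. -/
def totalVariation {X : Type} [MeasurableSpace X] (ν : Set X → ℂ) : ℝ≥0∞ :=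
  ⨆ (P : Finset (Set X)) (_ : ∀ A ∈ P, MeasurableSet A)
    (_ : (P : Set (Set X)).PairwiseDisjoint id), ∑ A ∈ P, ‖ν A‖ₑ

/-- The distinguishability norm `‖Z‖_M = sup_{E ∈ M} ∫ |Tr[Z E(dx)]|`. -/
def distNorm {m : ℕ} (M : Measurements m) (Z : L2 m →L[ℂ] L2 m) : ℝ≥0∞ :=
  ⨆ (X : Type) (_ : MeasurableSpace X) (E : POVM (L2 m) X) (_ : M X E),
    totalVariation (fun A => opTrace (Z * E.toFun A))

/-- The bias of the scheme `(ρ, σ; p)` with respect to measurements in `M`. -/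
def bias {m : ℕ} (M : Measurements m) (ρ σ : L2 m →L[ℂ] L2 m) (p : ℝ) : ℝ≥0∞ :=
  distNorm M ((p : ℂ) • ρ - ((1 - p : ℝ) : ℂ) • σ)

/-- The bias `β₁ = ‖p ρ - (1 - p) σ‖₁` with respect to all measurements. -/
def biasAll {m : ℕ} (ρ σ : L2 m →L[ℂ] L2 m) (p : ℝ) : ℝ≥0∞ :=
  traceNorm ((p : ℂ) • ρ - ((1 - p : ℝ) : ℂ) • σ)

namespace POVM

variable {H K : Type} [NormedAddCommGroup H] [InnerProductSpace ℂ H] [CompleteSpace H]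
  [NormedAddCommGroup K] [InnerProductSpace ℂ K] [CompleteSpace K]
  {X Y : Type} [MeasurableSpace X] [MeasurableSpace Y]

/-- The trivial measurement, with one outcome (the system is discarded). -/
def trivial (H : Type) [NormedAddCommGroup H] [InnerProductSpace ℂ H] [CompleteSpace H] :
    POVM H Unit where
  toFun A := A.indicator (fun _ => (1 : H →L[ℂ] H)) ()
  pos A _ := by
    by_cases h : () ∈ A
    · simp [h, ContinuousLinearMap.isPositive_one]
    · simp [h, ContinuousLinearMap.isPositive_zero]
  univ := by simp
  sigma_additive A hA hd ψ := by
    by_cases h : ∃ n, () ∈ A n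
    · obtain ⟨n, hn⟩ := h
      have hU : () ∈ ⋃ n, A n := Set.mem_iUnion.2 ⟨n, hn⟩
      have hs := hasSum_single (f := fun k => ⟪ψ, (A k).indicator
        (fun _ => (1 : H →L[ℂ] H)) () ψ⟫_ℂ) n (fun k hk => by
          have : () ∉ A k := fun hk' => (Set.disjoint_left.1 (hd hk)) hk' hn
          simp [this])
      simpa [hn, hU] using hs
    · have hU : () ∉ ⋃ n, A n := by simpa using h
      push Not at h
      simp [h, hU]

/-- Classical post-processing of the outcome. -/
def map (E : POVM H X) (f : X → Y) (hf : Measurable f) : POVM H Y where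
  toFun A := E.toFun (f ⁻¹' A)
  pos A hA := E.pos _ (hf hA)
  univ := by simpa using E.univ
  sigma_additive A hA hd ψ := by
    rw [Set.preimage_iUnion]
    exact E.sigma_additive _ (fun n => hf (hA n)) (fun i j hij => (hd hij).preimage f) ψ

/-- Apply the isometry `V` first, then measure `E`: the POVM `A ↦ V† E(A) V`. -/
def pullback (E : POVM K X) (V : H →ₗᵢ[ℂ] K) : POVM H X where
  toFun A := ContinuousLinearMap.adjoint V.toContinuousLinearMap ∘L
    E.toFun A ∘L V.toContinuousLinearMap
  pos A hA := (E.pos A hA).adjoint_conj _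
  univ := by
    rw [E.univ]
    ext ψ
    refine ext_inner_right ℂ fun φ => ?_
    simp [ContinuousLinearMap.adjoint_inner_left]
  sigma_additive A hA hd ψ := by
    simpa [ContinuousLinearMap.adjoint_inner_right] using E.sigma_additive A hA hd (V ψ)

end POVM

/-! ## Gaussian unitaries -/

/-- The quadratic Hamiltonian
`∑ (α_j a_j† + α_j* a_j) + ∑ (X_jk a_j† a_k + Y_jk a_j a_k + Y_jk* a_j† a_k†)`
on Schwartz functions. -/
def quadHamiltonian {m : ℕ} (α : Fin m → ℂ) (X Y : Matrix (Fin m) (Fin m) ℂ) :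
    Schw m →L[ℂ] Schw m :=
  ∑ j, (α j • creation j + conj (α j) • annihilation j) +
    ∑ j, ∑ k, (X j k • (creation j ∘L annihilation k) +
      Y j k • (annihilation j ∘L annihilation k) +
      conj (Y j k) • (creation j ∘L creation k))

/-- `U = exp(iH)`: there is a strongly continuous one-parameter unitary group `V t = exp(itH)`
with `V 1 = U` whose generator is `iH` on the Schwartz space. The Schwartz space is required to be
invariant under the group, hence it is a core of the generator and `H` determines `V`. -/
def IsExpI {m : ℕ} (U : L2 m ≃ₗᵢ[ℂ] L2 m) (H : Schw m →L[ℂ] Schw m) : Prop :=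
  ∃ V : ℝ → (L2 m ≃ₗᵢ[ℂ] L2 m),
    (∀ s t, V (s + t) = V s * V t) ∧ (∀ ψ, Continuous fun t => V t ψ) ∧ V 1 = U ∧
    (∀ t (f : Schw m), ∃ g : Schw m, V t f.vec = g.vec) ∧
    ∀ f : Schw m, HasDerivAt (fun t => V t f.vec) (Complex.I • (H f).vec) 0

/-- Gaussian unitaries: products of exponentials `exp(iH)` of quadratic Hamiltonians. -/
def IsGaussianUnitary {m : ℕ} (U : L2 m ≃ₗᵢ[ℂ] L2 m) : Prop :=
  U ∈ Submonoid.closure {W : L2 m ≃ₗᵢ[ℂ] L2 m |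
    ∃ (α : Fin m → ℂ) (X Y : Matrix (Fin m) (Fin m) ℂ),
      X.IsHermitian ∧ Y.IsSymm ∧ IsExpI W (quadHamiltonian α X Y)}

/-! ## GOCC measurements -/

/-- The wave function of `ψ ⊗ |0⟩`, with the vacuum in mode `j`. -/
def ancillaFun {m : ℕ} (j : Fin (m + 1)) (ψ : L2 m) (z : Fin (m + 1) → ℝ) : ℂ :=
  vacuum 1 (fun _ => z j) * ψ (j.removeNth z)

theorem ancilla_quasi {m : ℕ} (j : Fin (m + 1)) :
    Measure.QuasiMeasurePreserving (fun z : Fin (m + 1) → ℝ => j.removeNth z) volume volume :=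
  Measure.quasiMeasurePreserving_snd.comp
    (volume_preserving_piFinSuccAbove (fun _ : Fin (m + 1) => ℝ) j).quasiMeasurePreserving

theorem vacuum_one_sq (x : ℝ) :
    ‖vacuum 1 (fun _ => x)‖ ^ 2 = (Real.pi ^ (-(1 : ℝ) / 2)) * Real.exp (-1 * x ^ 2) := by
  rw [vacuum_apply, vacuumFun, Complex.norm_real, Real.norm_eq_abs, sq_abs, mul_pow,
    ← Real.exp_nat_mul, ← Real.rpow_natCast, ← Real.rpow_mul Real.pi_pos.le]
  congr 2
  · norm_num
  · simp only [Finset.univ_unique, Finset.sum_const, Finset.card_singleton, one_smul]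
    push_cast; ring

theorem integrable_vacuum_one : Integrable (fun x : ℝ => ‖vacuum 1 (fun _ => x)‖ ^ 2) := by
  simp_rw [vacuum_one_sq]
  exact (integrable_exp_neg_mul_sq one_pos).const_mul _

theorem integral_vacuum_one : ∫ x : ℝ, ‖vacuum 1 (fun _ => x)‖ ^ 2 = 1 := by
  simp_rw [vacuum_one_sq]
  rw [integral_const_mul, integral_gaussian, div_one, Real.sqrt_eq_rpow,
    ← Real.rpow_add Real.pi_pos]
  norm_num

theorem ancilla_memLp {m : ℕ} (j : Fin (m + 1)) (ψ : L2 m) :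
    MemLp (ancillaFun j ψ) 2 volume := by
  have hm : AEStronglyMeasurable (ancillaFun j ψ) volume := by
    refine AEStronglyMeasurable.mul ?_ ?_
    · refine Continuous.aestronglyMeasurable ?_
      exact (vacuum 1).continuous.comp (by fun_prop)
    · exact (Lp.aestronglyMeasurable ψ).comp_quasiMeasurePreserving (ancilla_quasi j)
  rw [memLp_two_iff_integrable_sq_norm hm]
  have h1 : Integrable (fun p : ℝ × (Fin m → ℝ) =>
      ‖vacuum 1 (fun _ => p.1)‖ ^ 2 * ‖ψ p.2‖ ^ 2) (volume.prod volume) :=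
    integrable_vacuum_one.mul_prod ((memLp_two_iff_integrable_sq_norm (Lp.aestronglyMeasurable ψ)).1
      (Lp.memLp ψ))
  have h2 := (volume_preserving_piFinSuccAbove (fun _ : Fin (m + 1) => ℝ) j).integrable_comp_emb
    (MeasurableEquiv.measurableEmbedding _) |>.2 h1
  refine h2.congr (Eventually.of_forall fun z => ?_)
  simp [ancillaFun, mul_pow, MeasurableEquiv.piFinSuccAbove_apply]

theorem norm_sq_eq {m : ℕ} (ψ : L2 m) : ‖ψ‖ ^ 2 = ∫ x, ‖ψ x‖ ^ 2 := by
  have h := L2.inner_def (𝕜 := ℂ) ψ ψ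
  rw [inner_self_eq_norm_sq_to_K] at h
  have h2 : ∀ x, ⟪ψ x, ψ x⟫_ℂ = ((‖ψ x‖ ^ 2 : ℝ) : ℂ) := fun x => by
    rw [inner_self_eq_norm_sq_to_K]; simp
  simp_rw [h2] at h
  rw [integral_complex_ofReal] at h
  exact Complex.ofReal_injective (by simpa using h)

/-- Adding an ancillary mode in the vacuum, in position `j`: the isometry `ψ ↦ ψ ⊗ |0⟩`. -/
def addVacuum {m : ℕ} (j : Fin (m + 1)) : L2 m →ₗᵢ[ℂ] L2 (m + 1) where
  toFun ψ := (ancilla_memLp j ψ).toLp (ancillaFun j ψ)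
  map_add' ψ φ := by
    rw [← MemLp.toLp_add]
    refine MemLp.toLp_congr _ _ ?_
    filter_upwards [(ancilla_quasi j).ae (Lp.coeFn_add ψ φ)] with z hz
    simp only [ancillaFun, Pi.add_apply] at hz ⊢
    rw [hz]; ring
  map_smul' c ψ := by
    rw [RingHom.id_apply, ← MemLp.toLp_const_smul]
    refine MemLp.toLp_congr _ _ ?_
    filter_upwards [(ancilla_quasi j).ae (Lp.coeFn_smul c ψ)] with z hz
    simp only [ancillaFun, Pi.smul_apply, smul_eq_mul] at hz ⊢
    rw [hz]; ring
  norm_map' ψ := by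
    have h : ‖(ancilla_memLp j ψ).toLp (ancillaFun j ψ)‖ ^ 2 = ‖ψ‖ ^ 2 := by
      rw [norm_sq_eq, norm_sq_eq]
      have h1 : ∫ z, ‖(ancilla_memLp j ψ).toLp (ancillaFun j ψ) z‖ ^ 2 = ∫ z, ‖ancillaFun j ψ z‖ ^ 2 := by
        refine integral_congr_ae ?_
        filter_upwards [(ancilla_memLp j ψ).coeFn_toLp] with z hz
        rw [hz]
      rw [h1]
      have h2 := (volume_preserving_piFinSuccAbove (fun _ : Fin (m + 1) => ℝ) j).integral_comp'
        (fun p : ℝ × (Fin m → ℝ) => ‖vacuum 1 (fun _ => p.1)‖ ^ 2 * ‖ψ p.2‖ ^ 2)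
      have h3 : ∀ z : Fin (m + 1) → ℝ, ‖ancillaFun j ψ z‖ ^ 2 =
          (fun p : ℝ × (Fin m → ℝ) => ‖vacuum 1 (fun _ => p.1)‖ ^ 2 * ‖ψ p.2‖ ^ 2)
            (MeasurableEquiv.piFinSuccAbove (fun _ => ℝ) j z) := fun z => by
        simp [ancillaFun, mul_pow, MeasurableEquiv.piFinSuccAbove_apply]
      simp_rw [h3]
      rw [h2]
      have h4 := integral_prod_mul (μ := (volume : Measure ℝ))
        (ν := (volume : Measure (Fin m → ℝ)))
        (fun x : ℝ => ‖vacuum 1 (fun _ => x)‖ ^ 2) (fun y => ‖ψ y‖ ^ 2)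
      rw [integral_vacuum_one, one_mul] at h4
      exact h4
    exact (pow_left_inj₀ (norm_nonneg _) (norm_nonneg _) two_ne_zero).1 h

open Classical in
/-- The unnormalised conditional state `ψ(x_j = x, ·) ∈ L²(ℝᵐ)`, defined for almost every `x`. -/
def slice {m : ℕ} (j : Fin (m + 1)) (ψ : L2 (m + 1)) (x : ℝ) : L2 m :=
  if h : MemLp (fun y : Fin m → ℝ => ψ (j.insertNth x y)) 2 volume then h.toLp else 0

/-- GOCC measurements, described from the first operation on. In a GOCC protocol one may
stop and discard the remaining modes; process the outcomes classically; apply a Gaussian unitary;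
add an ancillary mode in the vacuum; or homodyne a mode, i.e. measure the quadrature `x_j` of
a mode `j` destructively, and continue on the remaining modes with a GOCC protocol `F x` that
depends on the outcome `x`. In the last case the overall POVM is
`E(B) = ∫ |x⟩⟨x|_j ⊗ F x {y | (x, y) ∈ B} dx`. Other quadratures are obtained by a prior Gaussian
unitary. -/
inductive IsGOCC : ∀ {m : ℕ} {X : Type} [MeasurableSpace X], POVM (L2 m) X → Prop
  | discard (m : ℕ) : IsGOCC (POVM.trivial (L2 m))
  | postprocess {m : ℕ} {X Y : Type} [MeasurableSpace X] [MeasurableSpace Y]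
      (E : POVM (L2 m) X) (f : X → Y) (hf : Measurable f) :
      IsGOCC E → IsGOCC (E.map f hf)
  | unitary {m : ℕ} {X : Type} [MeasurableSpace X] (E : POVM (L2 m) X)
      (U : L2 m ≃ₗᵢ[ℂ] L2 m) :
      IsGaussianUnitary U → IsGOCC E → IsGOCC (E.pullback U.toLinearIsometry)
  | ancilla {m : ℕ} {X : Type} [MeasurableSpace X] (j : Fin (m + 1))
      (E : POVM (L2 (m + 1)) X) :
      IsGOCC E → IsGOCC (E.pullback (addVacuum j))
  | homodyne {m : ℕ} {X : Type} [MeasurableSpace X] (j : Fin (m + 1))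
      (F : ℝ → POVM (L2 m) X) (E : POVM (L2 (m + 1)) (ℝ × X)) :
      (∀ x, IsGOCC (F x)) →
      (∀ A, MeasurableSet A → ∀ φ, Measurable fun x => ⟪φ, (F x).toFun A φ⟫_ℂ) →
      (∀ B, MeasurableSet B → ∀ ψ, ⟪ψ, E.toFun B ψ⟫_ℂ =
        ∫ x, ⟪slice j ψ x, (F x).toFun {y | (x, y) ∈ B} (slice j ψ x)⟫_ℂ) →
      IsGOCC E

/-- The set of GOCC measurements on `m` modes. -/
def GOCC (m : ℕ) : Measurements m := fun _ _ E => IsGOCC E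

/-! ## Wigner functions and Wigner-positive measurements -/

/-- The displacement operator `D(α) = exp(∑ (α_j a_j† - α_j* a_j))` in the Schrödinger
representation: `(D(α) f)(x) = exp(i ∑ (√2 Im α_j x_j - Re α_j Im α_j)) f(x - √2 Re α)`. -/
def displace {m : ℕ} (α : Fin m → ℂ) (f : (Fin m → ℝ) → ℂ) (x : Fin m → ℝ) : ℂ :=
  Complex.exp (Complex.I *
    ((∑ j, (Real.sqrt 2 * (α j).im * x j - (α j).re * (α j).im) : ℝ) : ℂ)) *
    f (fun j => x j - Real.sqrt 2 * (α j).re)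

/-- The Wigner function `W_ψ(α) = (2/π)ᵐ ⟨ψ| D(2α) (-1)^N |ψ⟩` of `|ψ⟩⟨ψ|`. The parity operator
`(-1)^N` acts as `ψ(x) ↦ ψ(-x)`. -/
def wigner {m : ℕ} (ψ : Schw m) (α : Fin m → ℂ) : ℂ :=
  ((2 / Real.pi) ^ m : ℝ) *
    ∫ x, conj (ψ x) * displace (fun j => 2 * α j) (fun y => ψ (-y)) x

/-- The bounded operator `E` has non-negative Wigner distribution. The Wigner distribution
`W_E` of `E` is the tempered distribution with `⟨ψ|E|ψ⟩ = πᵐ ∫ W_ψ W_E` for all Schwartz `ψ`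
(for trace-class `E` this is the Wigner function); it is non-negative when it is a positive
tempered measure `μ`. -/
def HasNonnegWigner {m : ℕ} (E : L2 m →L[ℂ] L2 m) : Prop :=
  ∃ μ : Measure (Fin m → ℂ), μ.HasTemperateGrowth ∧
    ∀ ψ : Schw m, ⟪ψ.vec, E ψ.vec⟫_ℂ = (Real.pi ^ m : ℝ) * ∫ α, wigner ψ α ∂μ

/-- The set `W₊` of measurements with non-negative Wigner distribution. -/
def WignerPos (m : ℕ) : Measurements m := fun _ _ E =>
  ∀ A, MeasurableSet A → HasNonnegWigner (E.toFun A)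

/-! ## Even and odd thermal states -/

/-- The rank-one operator `|n⟩⟨n|`. -/
def fockProj (n : ℕ) : L2 1 →L[ℂ] L2 1 :=
  InnerProductSpace.rankOne ℂ (fock n).vec (fock n).vec

/-- `ω_l⁺ = (1 - l²) ∑ l^{2n} |2n⟩⟨2n|`. -/
def evenThermal (l : ℝ) : L2 1 →L[ℂ] L2 1 :=
  ((1 - l ^ 2 : ℝ) : ℂ) • ∑' n : ℕ, ((l ^ (2 * n) : ℝ) : ℂ) • fockProj (2 * n)

/-- `ω_l⁻ = (1 - l²) ∑ l^{2n} |2n+1⟩⟨2n+1|`. -/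
def oddThermal (l : ℝ) : L2 1 →L[ℂ] L2 1 :=
  ((1 - l ^ 2 : ℝ) : ℂ) • ∑' n : ℕ, ((l ^ (2 * n) : ℝ) : ℂ) • fockProj (2 * n + 1)

end CV

end

noncomputable section

namespace CV

/-! ## Schwartz vectors -/

/-! The two states have disjoint supports in the Fock basis, so everything on the trace-norm side is
diagonal bookkeeping (`abs_diagOp`, `traceNorm_diagOp`). The substance is that the parity separating
them is almost invisible to measurements with non-negative Wigner distribution.

Everything on phase space goes through the phase point operators `Π(α) = D(2α)(-1)^N`, realised on
Schwartz functions by `phasePoint`: the Wigner function is a multiple of `⟨ψ|Π(α)|ψ⟩`. They are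
reflections: self-adjoint, involutive, and they conjugate `a_j` into `2α_j - a_j`. This one
commutation rule gives the rapid decay of matrix elements, their derivatives in `α`, the vacuum
Gaussian and the Fock recursions.

GOCC measurements are Wigner-positive by induction on the protocol (`IsGOCC.hasNonnegWigner`).
Conjugation by `exp(iH)` with `H` quadratic moves `Π(α)` along an affine flow, so the Wigner measure
is pushed forward. A vacuum ancilla integrates the measure against a Gaussian in one mode. A
homodyne step glues the measures `μ_q` of the later protocols into `dq ⊗ μ_q ⊗ dp`. This requires `q
↦ μ_q` to be a kernel although each `μ_q` was merely chosen; measurability is recovered because the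
characteristic function of `exp(-2|α|²) μ_q` is an integral of matrix elements of `Π` between two
displaced vacua (`WignerFamily.measurable_damped`). The identity operator is itself treated as a
homodyne measurement whose outcome is ignored.

For the bound on Wigner-positive measurements, only the Fock diagonal of each effect `E(A)` matters.
By `hasSum_fockElem`, `∑ tⁿ ⟨n|Π(α)|n⟩ = (1+t)⁻¹ exp(-u|α|²)` with `u = 2(1-t)/(1+t)`. Hence the
diagonal of `E(A)` is encoded in the Laplace transform of a positive measure `ν_A` on the line, the
image of its Wigner measure under `α ↦ |α|²` (`exists_radial_measure`). For a full partition the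
diagonals add up to `1`, so the total Laplace transform is `1/u`, and by uniqueness `∑ ν_A` is
Lebesgue measure on the half-line (`measure_eq_volume_of_laplace`). The diagonal entries of the
difference of the states combine `lⁿ` and `(-l)ⁿ`, so `Tr[(ω⁺ - ω⁻)E(A)] = 2 ∫ f dν_A` with `f =
thermalWigner l` a difference of two exponentials. Positivity of the `ν_A` now bounds the sum of
absolute values by `2 ∫₀^∞ |f|`, whatever the measurement (`sum_norm_thermal_le`). Since `f` has
total integral zero and a single sign change, this integral is explicit
(`integral_abs_thermalWigner`). The case `l = 0` is a limit for a fixed measurement, and the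
behaviour near `1` follows by writing the exponent as `1 + (1-l)²/(2l)`. -/

theorem vec_add {m : ℕ} (f g : Schw m) : (f + g).vec = f.vec + g.vec :=
  (SchwartzMap.toLpCLM ℂ ℂ 2 (volume : Measure (Fin m → ℝ))).map_add f g

theorem vec_sub {m : ℕ} (f g : Schw m) : (f - g).vec = f.vec - g.vec :=
  (SchwartzMap.toLpCLM ℂ ℂ 2 (volume : Measure (Fin m → ℝ))).map_sub f g

theorem vec_smul {m : ℕ} (c : ℂ) (f : Schw m) : (c • f).vec = c • f.vec :=
  (SchwartzMap.toLpCLM ℂ ℂ 2 (volume : Measure (Fin m → ℝ))).map_smul c f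

theorem vec_zero {m : ℕ} : (0 : Schw m).vec = 0 :=
  (SchwartzMap.toLpCLM ℂ ℂ 2 (volume : Measure (Fin m → ℝ))).map_zero

theorem vec_sum {m : ℕ} {ι : Type*} (s : Finset ι) (f : ι → Schw m) :
    (∑ i ∈ s, f i).vec = ∑ i ∈ s, (f i).vec :=
  map_sum (SchwartzMap.toLpCLM ℂ ℂ 2 (volume : Measure (Fin m → ℝ))) f s

theorem inner_vec {m : ℕ} (f g : Schw m) : ⟪f.vec, g.vec⟫_ℂ = ∫ x, conj (f x) * g x := by
  rw [L2.inner_def]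
  refine integral_congr_ae ?_
  filter_upwards [f.coeFn_toLp 2 volume, g.coeFn_toLp 2 volume] with x hf hg
  rw [hf, hg, RCLike.inner_apply, mul_comm]

/-- The pointwise complex conjugate of a Schwartz function. -/
def conjSchw {m : ℕ} (f : Schw m) : Schw m :=
  SchwartzMap.postcompCLM (𝕜 := ℝ) (Complex.conjCLE : ℂ →L[ℝ] ℂ) f

@[simp] theorem conjSchw_apply {m : ℕ} (f : Schw m) (x : Fin m → ℝ) :
    conjSchw f x = conj (f x) := by
  simp [conjSchw, SchwartzMap.postcompCLM_apply]

theorem integrable_conj_mul {m : ℕ} (f g : Schw m) :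
    Integrable fun x => conj (f x) * g x := by
  have := (SchwartzMap.pairing (𝕜 := ℂ) (ContinuousLinearMap.mul ℂ ℂ) (conjSchw f) g).integrable
    (μ := volume)
  refine this.congr (Eventually.of_forall fun x => ?_)
  simp [SchwartzMap.pairing_apply_apply]

/-! ## Ladder operators -/

theorem partialDeriv_apply {m : ℕ} (j : Fin m) (f : Schw m) (x : Fin m → ℝ) :
    partialDeriv j f x = fderiv ℝ f x (Pi.single j 1) :=
  SchwartzMap.lineDerivOp_apply_eq_fderiv _ f x

theorem annihilation_apply {m : ℕ} (j : Fin m) (f : Schw m) (x : Fin m → ℝ) :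
    annihilation j f x = ((1 / Real.sqrt 2 : ℝ) : ℂ) * ((x j : ℂ) * f x + partialDeriv j f x) := by
  simp only [annihilation, smul_apply, add_apply, position_apply, smul_eq_mul]

theorem creation_apply {m : ℕ} (j : Fin m) (f : Schw m) (x : Fin m → ℝ) :
    creation j f x = ((1 / Real.sqrt 2 : ℝ) : ℂ) * ((x j : ℂ) * f x - partialDeriv j f x) := by
  simp only [creation, smul_apply, sub_apply, position_apply, smul_eq_mul]

theorem partialDeriv_conjSchw {m : ℕ} (j : Fin m) (f : Schw m) (x : Fin m → ℝ) :
    partialDeriv j (conjSchw f) x = conj (partialDeriv j f x) := by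
  rw [partialDeriv_apply, partialDeriv_apply]
  have h : (conjSchw f : (Fin m → ℝ) → ℂ) = (Complex.conjCLE : ℂ →L[ℝ] ℂ) ∘ f := by
    ext y; simp
  have h2 : HasFDerivAt (conjSchw f) ((Complex.conjCLE : ℂ →L[ℝ] ℂ) ∘L fderiv ℝ f x) x := by
    rw [h]
    exact (Complex.conjCLE : ℂ →L[ℝ] ℂ).hasFDerivAt.comp x (f.hasFDerivAt x)
  rw [h2.fderiv]; simp

theorem inner_position {m : ℕ} (j : Fin m) (f g : Schw m) :
    ⟪(position j f).vec, g.vec⟫_ℂ = ⟪f.vec, (position j g).vec⟫_ℂ := by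
  rw [inner_vec, inner_vec]
  congr 1; ext x
  simp [position_apply]; ring

theorem inner_partialDeriv {m : ℕ} (j : Fin m) (f g : Schw m) :
    ⟪(partialDeriv j f).vec, g.vec⟫_ℂ = -⟪f.vec, (partialDeriv j g).vec⟫_ℂ := by
  rw [inner_vec, inner_vec]
  have h := SchwartzMap.integral_mul_lineDerivOp_right_eq_neg_left (μ := volume) (conjSchw f) g
    (Pi.single j (1 : ℝ) : Fin m → ℝ)
  have h1 : ∀ (u : Schw m) x, (LineDeriv.lineDerivOp (Pi.single j (1 : ℝ) : Fin m → ℝ) u : Schw m) x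
      = partialDeriv j u x := fun u x => rfl
  simp_rw [h1, partialDeriv_conjSchw, conjSchw_apply] at h
  rw [h, neg_neg]

theorem inner_creation {m : ℕ} (j : Fin m) (f g : Schw m) :
    ⟪(creation j f).vec, g.vec⟫_ℂ = ⟪f.vec, (annihilation j g).vec⟫_ℂ := by
  simp only [creation, annihilation, smul_apply, add_apply,
    sub_apply, vec_smul, vec_add, vec_sub, inner_smul_left, inner_smul_right,
    inner_sub_left, inner_add_right, inner_position, inner_partialDeriv, Complex.conj_ofReal]
  ring

theorem inner_annihilation {m : ℕ} (j : Fin m) (f g : Schw m) :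
    ⟪(annihilation j f).vec, g.vec⟫_ℂ = ⟪f.vec, (creation j g).vec⟫_ℂ := by
  rw [← inner_conj_symm, ← inner_creation, inner_conj_symm]

/-! ## Phase point operators -/

/-- Every derivative is a power of `I` times the function itself, hence of modulus one. This is what
makes multiplication by a linear phase an operator on Schwartz space. -/
theorem hasTemperateGrowth_cexp_I :
    Function.HasTemperateGrowth (fun t : ℝ => Complex.exp (Complex.I * t)) := by
  have hd : ∀ t : ℝ, HasDerivAt (fun t : ℝ => Complex.exp (Complex.I * t))
      (Complex.I * Complex.exp (Complex.I * t)) t := fun t => by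
    have := ((Complex.ofRealCLM.hasDerivAt (x := t)).const_mul Complex.I).cexp
    simpa [mul_comm] using this
  have hit : ∀ n : ℕ, iteratedDeriv n (fun t : ℝ => Complex.exp (Complex.I * t)) =
      fun t : ℝ => Complex.I ^ n * Complex.exp (Complex.I * t) := by
    intro n
    induction n with
    | zero => simp
    | succ n ih =>
      rw [iteratedDeriv_succ, ih]
      ext t
      rw [((hd t).const_mul _).deriv, pow_succ, mul_assoc]
  refine ⟨?_, fun n => ⟨0, 1, fun t => ?_⟩⟩
  · exact (contDiff_const.mul Complex.ofRealCLM.contDiff).cexp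
  · rw [norm_iteratedFDeriv_eq_norm_iteratedDeriv, hit]
    simp [Complex.norm_exp]

/-- The phase of the phase point operator at `α`. -/
def phaseAngle {m : ℕ} (α : Fin m → ℂ) (x : Fin m → ℝ) : ℝ :=
  ∑ j, (Real.sqrt 2 * (2 * α j).im * x j - (2 * α j).re * (2 * α j).im)

/-- The centre of reflection (times two) of the phase point operator at `α`. -/
def shift {m : ℕ} (α : Fin m → ℂ) (j : Fin m) : ℝ := Real.sqrt 2 * (2 * α j).re

theorem hasTemperateGrowth_phase {m : ℕ} (α : Fin m → ℂ) :
    Function.HasTemperateGrowth (fun x => Complex.exp (Complex.I * (phaseAngle α x : ℝ))) := by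
  have h1 : Function.HasTemperateGrowth (phaseAngle α) := by
    unfold phaseAngle
    refine Function.HasTemperateGrowth.sum (fun j _ => ?_)
    refine Function.HasTemperateGrowth.sub ?_ (Function.HasTemperateGrowth.const _)
    exact (Function.HasTemperateGrowth.const _).mul
      ((ContinuousLinearMap.proj (R := ℝ) (φ := fun _ : Fin m => ℝ) j).hasTemperateGrowth)
  exact hasTemperateGrowth_cexp_I.comp h1

/-- The phase point operator `D(2α) (-1)^N` on Schwartz functions. -/
def phasePoint {m : ℕ} (α : Fin m → ℂ) : Schw m →L[ℂ] Schw m :=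
  SchwartzMap.smulLeftCLM ℂ (fun x => Complex.exp (Complex.I * (phaseAngle α x : ℝ))) ∘L
    SchwartzMap.compSubConstCLM ℂ (shift α) ∘L
    SchwartzMap.compCLMOfContinuousLinearEquiv ℂ (ContinuousLinearEquiv.neg ℝ)

theorem phasePoint_apply {m : ℕ} (α : Fin m → ℂ) (f : Schw m) (x : Fin m → ℝ) :
    phasePoint α f x = Complex.exp (Complex.I * (phaseAngle α x : ℝ)) * f (shift α - x) := by
  simp [phasePoint, SchwartzMap.smulLeftCLM_apply_apply (hasTemperateGrowth_phase α)]

/-- Bridge from the integral definition to operators; afterwards Wigner functions are handled only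
through matrix elements of `phasePoint`. -/
theorem wigner_eq {m : ℕ} (ψ : Schw m) (α : Fin m → ℂ) :
    wigner ψ α = ((2 / Real.pi) ^ m : ℝ) * ⟪ψ.vec, (phasePoint α ψ).vec⟫_ℂ := by
  rw [wigner, inner_vec]
  congr 2
  ext x
  rw [phasePoint_apply, displace, phaseAngle]
  congr 4
  ext j
  simp [shift]

theorem norm_phase {m : ℕ} (α : Fin m → ℂ) (x : Fin m → ℝ) :
    ‖Complex.exp (Complex.I * (phaseAngle α x : ℝ))‖ = 1 := by
  rw [mul_comm, Complex.norm_exp_ofReal_mul_I]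

theorem norm_phasePoint_apply {m : ℕ} (α : Fin m → ℂ) (f : Schw m) (x : Fin m → ℝ) :
    ‖phasePoint α f x‖ = ‖f (shift α - x)‖ := by
  rw [phasePoint_apply, norm_mul, norm_phase, one_mul]

/-- Three point reflections compose to the reflection in the fourth vertex of a parallelogram. The
phase is proportional to the symplectic area of the triangle `a b c`. -/
theorem phasePoint_comp₃ {m : ℕ} (a b c : Fin m → ℂ) (f : Schw m) :
    phasePoint a (phasePoint b (phasePoint c f)) =
      Complex.exp (Complex.I * ((∑ j, 4 * ((b j - a j).re * (c j - b j).im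
        - (b j - a j).im * (c j - b j).re) : ℝ) : ℂ)) • phasePoint (a - b + c) f := by
  ext x
  have hs : shift c - (shift b - (shift a - x)) = shift (a - b + c) - x := by
    ext j; simp [shift]; ring
  rw [smul_apply, phasePoint_apply, phasePoint_apply, phasePoint_apply,
    phasePoint_apply, hs, smul_eq_mul, ← mul_assoc, ← mul_assoc, ← mul_assoc, ← Complex.exp_add,
    ← Complex.exp_add, ← Complex.exp_add]
  congr 2
  rw [← mul_add, ← mul_add, ← mul_add, ← Complex.ofReal_add, ← Complex.ofReal_add,
    ← Complex.ofReal_add]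
  congr 2
  simp only [phaseAngle, ← Finset.sum_add_distrib]
  refine Finset.sum_congr rfl fun j _ => ?_
  have h2 : Real.sqrt 2 * Real.sqrt 2 = 2 := Real.mul_self_sqrt (by norm_num)
  simp [shift]
  linear_combination (2 * (b j).im * (2 * (a j).re) + 2 * (c j).im * (2 * (b j).re) - 2 * (c j).im * (2 * (a j).re)) * h2

theorem phasePoint_phasePoint {m : ℕ} (a : Fin m → ℂ) (f : Schw m) :
    phasePoint a (phasePoint a f) = f := by
  ext x
  have hs : shift a - (shift a - x) = x := sub_sub_cancel _ _
  rw [phasePoint_apply, phasePoint_apply, hs, ← mul_assoc, ← Complex.exp_add, ← mul_add,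
    ← Complex.ofReal_add]
  have : phaseAngle a x + phaseAngle a (shift a - x) = 0 := by
    simp only [phaseAngle, ← Finset.sum_add_distrib]
    refine Finset.sum_eq_zero fun j _ => ?_
    have h2 : Real.sqrt 2 * Real.sqrt 2 = 2 := Real.mul_self_sqrt (by norm_num)
    simp [shift]
    linear_combination (4 * (a j).im * (a j).re) * h2
  simp [this]

/-- Reflecting the integration variable, `x ↦ shift a - x`, turns self-adjointness into the
involution property. -/
theorem inner_phasePoint {m : ℕ} (a : Fin m → ℂ) (f g : Schw m) :
    ⟪(phasePoint a f).vec, g.vec⟫_ℂ = ⟪f.vec, (phasePoint a g).vec⟫_ℂ := by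
  rw [inner_vec, inner_vec,
    ← integral_sub_left_eq_self (fun x => conj (f x) * phasePoint a g x) volume (shift a)]
  congr 1; ext x
  have h := congrArg (fun u : Schw m => u x) (phasePoint_phasePoint a g)
  have hs : shift a - (shift a - x) = x := sub_sub_cancel _ _
  simp only [phasePoint_apply, hs] at h ⊢
  have h1 : conj (Complex.exp (Complex.I * (phaseAngle a x : ℝ))) *
      Complex.exp (Complex.I * (phaseAngle a x : ℝ)) = 1 := by
    rw [← Complex.normSq_eq_conj_mul_self, Complex.normSq_eq_norm_sq, norm_phase]; simp
  rw [map_mul]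
  linear_combination (-(conj (Complex.exp (Complex.I * (phaseAngle a x : ℝ))) *
    conj (f (shift a - x)))) * h + (conj (f (shift a - x)) *
    (Complex.exp (Complex.I * (phaseAngle a (shift a - x) : ℝ)) * g x)) * h1

theorem norm_phasePoint {m : ℕ} (a : Fin m → ℂ) (f : Schw m) :
    ‖(phasePoint a f).vec‖ = ‖f.vec‖ := by
  have h : ⟪(phasePoint a f).vec, (phasePoint a f).vec⟫_ℂ = ⟪f.vec, f.vec⟫_ℂ := by
    rw [inner_phasePoint, phasePoint_phasePoint]
  rw [inner_self_eq_norm_sq_to_K, inner_self_eq_norm_sq_to_K] at h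
  have h' : ‖(phasePoint a f).vec‖ ^ 2 = ‖f.vec‖ ^ 2 := by exact_mod_cast h
  exact (pow_left_inj₀ (norm_nonneg _) (norm_nonneg _) two_ne_zero).1 h'

theorem partialDeriv_phasePoint {m : ℕ} (j : Fin m) (α : Fin m → ℂ) (f : Schw m)
    (x : Fin m → ℝ) :
    partialDeriv j (phasePoint α f) x =
      Complex.I * ((Real.sqrt 2 * (2 * α j).im : ℝ) : ℂ) * phasePoint α f x
        - phasePoint α (partialDeriv j f) x := by
  have h1 : HasFDerivAt (fun x => (phaseAngle α x : ℝ))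
      (∑ i, (Real.sqrt 2 * (2 * α i).im) •
        (ContinuousLinearMap.proj (R := ℝ) (φ := fun _ : Fin m => ℝ) i)) x := by
    unfold phaseAngle
    refine HasFDerivAt.fun_sum fun i _ => ?_
    exact ((ContinuousLinearMap.proj (R := ℝ) (φ := fun _ : Fin m => ℝ) i).hasFDerivAt.const_mul
      _).sub_const _
  have h2 : HasFDerivAt (fun x => Complex.exp (Complex.I * (phaseAngle α x : ℝ))) _ x :=
    ((Complex.ofRealCLM.hasFDerivAt.comp x h1).const_mul Complex.I).cexp
  have h3 : HasFDerivAt (fun x => f (shift α - x)) ((fderiv ℝ f (shift α - x)) ∘L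
      (-(ContinuousLinearMap.id ℝ _))) x :=
    (f.hasFDerivAt (shift α - x)).comp x ((hasFDerivAt_id x).const_sub (shift α))
  have h4 := h2.fun_mul h3
  have h5 : (phasePoint α f : (Fin m → ℝ) → ℂ) = fun x =>
    Complex.exp (Complex.I * (phaseAngle α x : ℝ)) * f (shift α - x) := by
    ext y; exact phasePoint_apply α f y
  rw [partialDeriv_apply, h5, h4.fderiv, phasePoint_apply, partialDeriv_apply]
  simp [Pi.single_apply]
  ring

/-- The commutation rule behind everything: parity sends `a_j` to `-a_j` and the displacement by
`2α` adds `2α_j`. -/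
theorem annihilation_phasePoint {m : ℕ} (j : Fin m) (α : Fin m → ℂ) (f : Schw m) :
    annihilation j (phasePoint α f) =
      (2 * α j) • phasePoint α f - phasePoint α (annihilation j f) := by
  ext x
  rw [annihilation_apply, partialDeriv_phasePoint, sub_apply, smul_apply,
    phasePoint_apply, phasePoint_apply, phasePoint_apply, annihilation_apply]
  have h2 : ((Real.sqrt 2 : ℝ) : ℂ) * ((Real.sqrt 2 : ℝ) : ℂ) = 2 := by
    rw [← Complex.ofReal_mul, Real.mul_self_sqrt (by norm_num)]; simp
  have h3 : ((1 / Real.sqrt 2 : ℝ) : ℂ) * ((Real.sqrt 2 : ℝ) : ℂ) = 1 := by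
    rw [← Complex.ofReal_mul, one_div, inv_mul_cancel₀ (by positivity)]; simp
  have h4 : α j = (α j).re + (α j).im * Complex.I := (Complex.re_add_im _).symm
  have h5 : (2 * α j).re = 2 * (α j).re := by simp
  have h6 : (2 * α j).im = 2 * (α j).im := by simp
  simp only [shift, Pi.sub_apply, smul_eq_mul, h5, h6]
  have h4' : (2 * α j : ℂ) = 2 * ((α j).re + (α j).im * Complex.I) := by rw [← h4]
  rw [h4']
  push_cast at h3 ⊢
  linear_combination (Complex.exp (Complex.I * (phaseAngle α x : ℝ)) * f (shift α - x)) *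
    (2 * (α j).re + 2 * (α j).im * Complex.I) * h3

theorem creation_phasePoint {m : ℕ} (j : Fin m) (α : Fin m → ℂ) (f : Schw m) :
    creation j (phasePoint α f) =
      (2 * conj (α j)) • phasePoint α f - phasePoint α (creation j f) := by
  ext x
  rw [creation_apply, partialDeriv_phasePoint, sub_apply, smul_apply,
    phasePoint_apply, phasePoint_apply, phasePoint_apply, creation_apply]
  have h3 : ((1 / Real.sqrt 2 : ℝ) : ℂ) * ((Real.sqrt 2 : ℝ) : ℂ) = 1 := by
    rw [← Complex.ofReal_mul, one_div, inv_mul_cancel₀ (by positivity)]; simp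
  have h4 : conj (α j) = (α j).re - (α j).im * Complex.I := by
    apply Complex.ext <;> simp
  have h5 : (2 * α j).re = 2 * (α j).re := by simp
  have h6 : (2 * α j).im = 2 * (α j).im := by simp
  simp only [shift, Pi.sub_apply, smul_eq_mul, h5, h6, h4]
  push_cast at h3 ⊢
  linear_combination (Complex.exp (Complex.I * (phaseAngle α x : ℝ)) * f (shift α - x)) *
    (2 * (α j).re - 2 * (α j).im * Complex.I) * h3

/-! ## Matrix elements of phase point operators -/

/-- The matrix element `⟨ψ| D(2α) (-1)^N |φ⟩`. -/
def phaseElem {m : ℕ} (ψ φ : Schw m) (α : Fin m → ℂ) : ℂ := ⟪ψ.vec, (phasePoint α φ).vec⟫_ℂ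

theorem norm_phaseElem_le {m : ℕ} (ψ φ : Schw m) (α : Fin m → ℂ) :
    ‖phaseElem ψ φ α‖ ≤ ‖ψ.vec‖ * ‖φ.vec‖ :=
  (norm_inner_le_norm _ _).trans_eq (by rw [norm_phasePoint])

/-- Trades a coordinate factor on phase space for ladder operators on the states. Used for decay in
`α` and, on Fock states, for the three-term recursion. -/
theorem two_mul_phaseElem {m : ℕ} (ψ φ : Schw m) (α : Fin m → ℂ) (j : Fin m) :
    2 * α j * phaseElem ψ φ α =
      phaseElem (creation j ψ) φ α + phaseElem ψ (annihilation j φ) α := by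
  simp only [phaseElem, inner_creation, annihilation_phasePoint, vec_sub, vec_smul,
    inner_sub_right, inner_smul_right]
  ring

theorem two_mul_conj_phaseElem {m : ℕ} (ψ φ : Schw m) (α : Fin m → ℂ) (j : Fin m) :
    2 * conj (α j) * phaseElem ψ φ α =
      phaseElem (annihilation j ψ) φ α + phaseElem ψ (creation j φ) α := by
  simp only [phaseElem, inner_annihilation, creation_phasePoint, vec_sub, vec_smul,
    inner_sub_right, inner_smul_right]
  ring

/-- Matrix elements of a unitary are bounded, and each further power of `‖α‖` is paid for by one
ladder operator acting on `ψ` or `φ`. -/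
theorem phaseElem_decay {m : ℕ} (N : ℕ) (ψ φ : Schw m) :
    ∃ C : ℝ, 0 ≤ C ∧ ∀ α, ‖α‖ ^ N * ‖phaseElem ψ φ α‖ ≤ C := by
  induction N generalizing ψ φ with
  | zero => exact ⟨‖ψ.vec‖ * ‖φ.vec‖, by positivity, fun α => by
      simpa using norm_phaseElem_le ψ φ α⟩
  | succ N ih =>
    choose C1 hC1 h1 using fun j : Fin m => ih (creation j ψ) φ
    choose C2 hC2 h2 using fun j : Fin m => ih ψ (annihilation j φ)
    refine ⟨∑ j, (C1 j + C2 j), Finset.sum_nonneg fun j _ => add_nonneg (hC1 j) (hC2 j),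
      fun α => ?_⟩
    have hn : ‖α‖ ≤ ∑ j, ‖α j‖ := by
      refine (pi_norm_le_iff_of_nonneg (Finset.sum_nonneg fun j _ => norm_nonneg _)).2 fun j => ?_
      exact Finset.single_le_sum (f := fun j => ‖α j‖) (fun _ _ => norm_nonneg _)
        (Finset.mem_univ j)
    calc ‖α‖ ^ (N + 1) * ‖phaseElem ψ φ α‖
        ≤ ‖α‖ ^ N * (∑ j, ‖α j‖) * ‖phaseElem ψ φ α‖ := by rw [pow_succ]; gcongr
      _ = ∑ j, ‖α‖ ^ N * (‖α j‖ * ‖phaseElem ψ φ α‖) := by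
          rw [Finset.mul_sum, Finset.sum_mul]; simp_rw [mul_assoc]
      _ ≤ ∑ j, (C1 j + C2 j) := by
          refine Finset.sum_le_sum fun j _ => ?_
          have h3 : ‖α j‖ * ‖phaseElem ψ φ α‖ ≤
              ‖phaseElem (creation j ψ) φ α‖ + ‖phaseElem ψ (annihilation j φ) α‖ := by
            have := norm_add_le (phaseElem (creation j ψ) φ α) (phaseElem ψ (annihilation j φ) α)
            rw [← two_mul_phaseElem, norm_mul, norm_mul] at this
            have h0 : 0 ≤ ‖α j‖ * ‖phaseElem ψ φ α‖ := by positivity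
            simp only [Complex.norm_ofNat] at this
            linarith
          calc _ ≤ ‖α‖ ^ N * (‖phaseElem (creation j ψ) φ α‖ +
                ‖phaseElem ψ (annihilation j φ) α‖) := by gcongr
            _ ≤ _ := by rw [mul_add]; exact add_le_add (h1 j α) (h2 j α)

theorem continuous_shift {m : ℕ} : Continuous (shift : (Fin m → ℂ) → Fin m → ℝ) := by
  unfold shift; fun_prop

theorem norm_le_seminorm {m : ℕ} (f : Schw m) (x : Fin m → ℝ) :
    ‖f x‖ ≤ SchwartzMap.seminorm ℝ 0 0 f := SchwartzMap.norm_le_seminorm ℝ f x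

theorem continuous_phasePoint_apply {m : ℕ} (f : Schw m) (x : Fin m → ℝ) :
    Continuous fun α => phasePoint α f x := by
  simp_rw [phasePoint_apply]
  have h1 : Continuous fun α : Fin m → ℂ => phaseAngle α x := by unfold phaseAngle; fun_prop
  have h2 : Continuous fun α : Fin m → ℂ => f (shift α - x) :=
    f.continuous.comp (continuous_shift.sub continuous_const)
  exact (Complex.continuous_exp.comp
    (continuous_const.mul (Complex.continuous_ofReal.comp h1))).mul h2

theorem continuous_phaseElem {m : ℕ} (ψ φ : Schw m) : Continuous (phaseElem ψ φ) := by
  unfold phaseElem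
  simp_rw [inner_vec]
  refine continuous_of_dominated (bound := fun x => ‖ψ x‖ * SchwartzMap.seminorm ℝ 0 0 φ)
    (fun α => ?_) (fun α => Eventually.of_forall fun x => ?_) ?_
    (Eventually.of_forall fun x => continuous_const.mul (continuous_phasePoint_apply φ x))
  · exact (integrable_conj_mul ψ (phasePoint α φ)).1
  · rw [norm_mul, RCLike.norm_conj, norm_phasePoint_apply]
    gcongr
    exact norm_le_seminorm _ _
  · exact ψ.integrable.norm.mul_const _

theorem integrable_phaseElem {m : ℕ} (ψ φ : Schw m) (μ : Measure (Fin m → ℂ))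
    [μ.HasTemperateGrowth] : Integrable (phaseElem ψ φ) μ := by
  obtain ⟨C, _, hC⟩ := phaseElem_decay (0 + μ.integrablePower) ψ φ
  have := integrable_of_le_of_pow_mul_le (k := 0) (norm_phaseElem_le ψ φ) hC
    (continuous_phaseElem ψ φ).aestronglyMeasurable
  simp only [pow_zero, one_mul] at this
  exact (integrable_norm_iff (continuous_phaseElem ψ φ).aestronglyMeasurable).1 this

/-- The derivative of `α ↦ D(2α) (-1)^N φ` in the direction `δ`. -/
def phaseDeriv {m : ℕ} (α δ : Fin m → ℂ) (φ : Schw m) : Schw m :=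
  ∑ j, (δ j • ((2 * conj (α j)) • phasePoint α φ - (2 : ℂ) • phasePoint α (creation j φ)) -
    conj (δ j) • ((2 * α j) • phasePoint α φ - (2 : ℂ) • phasePoint α (annihilation j φ)))

theorem sum_apply' {m : ℕ} {ι : Type*} (s : Finset ι) (f : ι → Schw m) (x : Fin m → ℝ) :
    (∑ i ∈ s, f i) x = ∑ i ∈ s, f i x := by
  classical
  induction s using Finset.induction_on with
  | empty => simp
  | insert a s ha ih => rw [Finset.sum_insert ha, Finset.sum_insert ha, ← ih]; rfl

theorem phaseDeriv_apply {m : ℕ} (α δ : Fin m → ℂ) (φ : Schw m) (x : Fin m → ℝ) :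
    phaseDeriv α δ φ x = ∑ j, (δ j * ((2 * conj (α j)) * phasePoint α φ x
      - 2 * phasePoint α (creation j φ) x) -
    conj (δ j) * ((2 * α j) * phasePoint α φ x - 2 * phasePoint α (annihilation j φ) x)) := by
  rw [phaseDeriv, sum_apply']
  rfl

theorem fderiv_eq_sum_partialDeriv {m : ℕ} (f : Schw m) (x v : Fin m → ℝ) :
    fderiv ℝ f x v = ∑ j, (v j : ℂ) * partialDeriv j f x := by
  simp_rw [partialDeriv_apply]
  conv_lhs => rw [← Finset.univ_sum_single v]
  rw [map_sum]
  refine Finset.sum_congr rfl fun j _ => ?_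
  have : Pi.single j (v j) = v j • (Pi.single j (1 : ℝ) : Fin m → ℝ) := by
    rw [← Pi.single_smul]; simp
  rw [this, map_smul]; simp

/-- Moving the centre by `δ` conjugates `Π(α)` by a displacement, so the derivative is the
commutator of `∑ (δ_j a_j† - δ_j* a_j)` with `Π(α)`; `phaseDeriv` is that commutator with all ladder
operators moved to the right. -/
theorem hasDerivAt_phasePoint_apply {m : ℕ} {α : ℝ → Fin m → ℂ} {δ : Fin m → ℂ} {t : ℝ}
    (hα : HasDerivAt α δ t) (φ : Schw m) (x : Fin m → ℝ) :
    HasDerivAt (fun t => phasePoint (α t) φ x) (phaseDeriv (α t) δ φ x) t := by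
  simp_rw [phasePoint_apply]
  have hj := hasDerivAt_pi.1 hα
  have hre : ∀ j, HasDerivAt (fun t => (α t j).re) (δ j).re t := fun j =>
    Complex.reCLM.hasFDerivAt.comp_hasDerivAt t (hj j)
  have him : ∀ j, HasDerivAt (fun t => (α t j).im) (δ j).im t := fun j =>
    Complex.imCLM.hasFDerivAt.comp_hasDerivAt t (hj j)
  have h1 : HasDerivAt (fun t => phaseAngle (α t) x)
      (∑ j, (Real.sqrt 2 * (2 * (δ j).im) * x j -
        ((2 * (δ j).re) * (2 * (α t j).im) + (2 * (α t j).re) * (2 * (δ j).im)))) t := by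
    unfold phaseAngle
    refine HasDerivAt.fun_sum fun j _ => ?_
    have e1 : ∀ z : ℂ, (2 * z).im = 2 * z.im := fun z => by simp
    have e2 : ∀ z : ℂ, (2 * z).re = 2 * z.re := fun z => by simp
    simp_rw [e1, e2]
    exact ((((him j).const_mul 2).const_mul _).mul_const _).sub
      (((hre j).const_mul 2).mul ((him j).const_mul 2))
  have h2 : HasDerivAt (fun t => shift (α t) - x)
      (fun j => Real.sqrt 2 * (2 * (δ j).re)) t := by
    refine HasDerivAt.sub_const _ ?_
    refine hasDerivAt_pi.2 fun j => ?_
    have e2 : ∀ z : ℂ, (2 * z).re = 2 * z.re := fun z => by simp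
    simp_rw [shift, e2]
    exact ((hre j).const_mul 2).const_mul _
  have h3 := (φ.hasFDerivAt (shift (α t) - x)).comp_hasDerivAt t h2
  have h4 : HasDerivAt (fun t => Complex.exp (Complex.I * (phaseAngle (α t) x : ℝ))) _ t :=
    ((h1.ofReal_comp).const_mul Complex.I).cexp
  have h5 := h4.fun_mul h3
  refine h5.congr_deriv ?_
  rw [fderiv_eq_sum_partialDeriv, phaseDeriv_apply]
  simp only [phasePoint_apply, creation_apply, annihilation_apply, Function.comp_apply]
  push_cast
  rw [mul_assoc, mul_comm _ (φ _), ← mul_assoc, Finset.mul_sum, Finset.mul_sum, Finset.mul_sum,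
    ← Finset.sum_add_distrib]
  refine Finset.sum_congr rfl fun j _ => ?_
  have h22 : ((Real.sqrt 2 : ℝ) : ℂ) * ((Real.sqrt 2 : ℝ) : ℂ) = 2 := by
    rw [← Complex.ofReal_mul, Real.mul_self_sqrt (by norm_num)]; simp
  have h3 : (1 / ((Real.sqrt 2 : ℝ) : ℂ)) = ((Real.sqrt 2 : ℝ) : ℂ) / 2 := by
    have : ((Real.sqrt 2 : ℝ) : ℂ) ≠ 0 := by
      intro h0; rw [h0] at h22; norm_num at h22
    rw [div_eq_div_iff this (by norm_num), one_mul, h22]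
  have e1 : conj (α t j) = (α t j).re - (α t j).im * Complex.I := by
    apply Complex.ext <;> simp
  have e2 : conj (δ j) = (δ j).re - (δ j).im * Complex.I := by
    apply Complex.ext <;> simp
  have e3 : (α t j : ℂ) = (α t j).re + (α t j).im * Complex.I := (Complex.re_add_im _).symm
  have e4 : (δ j : ℂ) = (δ j).re + (δ j).im * Complex.I := (Complex.re_add_im _).symm
  have e5 : ((shift (α t) - x) j : ℂ) = Real.sqrt 2 * (2 * (α t j).re) - x j := by
    simp [shift]
  rw [h3, e1, e2, e5]
  generalize (α t j).re = ar at *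
  generalize (α t j).im = ai at *
  generalize (δ j).re = dr at *
  generalize (δ j).im = di at *
  rw [e3, e4]
  generalize φ (shift (α t) - x) = F
  generalize partialDeriv j φ (shift (α t) - x) = G
  generalize Complex.exp (Complex.I * (phaseAngle (α t) x : ℝ)) = K
  linear_combination (4 * Complex.I * K * F * di * ar) * h22

theorem hasDerivAt_phaseElem {m : ℕ} {α δ : ℝ → Fin m → ℂ} (hα : ∀ t, HasDerivAt α (δ t) t)
    (hδ : Continuous δ) (ψ φ : Schw m) (t : ℝ) :
    HasDerivAt (fun t => phaseElem ψ φ (α t)) ⟪ψ.vec, (phaseDeriv (α t) (δ t) φ).vec⟫_ℂ t := by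
  have hαc : Continuous α := continuous_iff_continuousAt.2 fun t => (hα t).continuousAt
  obtain ⟨R1, hR1⟩ := (isCompact_closedBall t 1).exists_bound_of_continuousOn hαc.continuousOn
  obtain ⟨R2, hR2⟩ := (isCompact_closedBall t 1).exists_bound_of_continuousOn hδ.continuousOn
  have hR1' : 0 ≤ R1 := (norm_nonneg _).trans (hR1 t (by simp))
  have hR2' : 0 ≤ R2 := (norm_nonneg _).trans (hR2 t (by simp))
  set S : Schw m → ℝ := fun f => SchwartzMap.seminorm ℝ 0 0 f with hS
  have hb : ∀ (β : Fin m → ℂ) (f : Schw m) x, ‖phasePoint β f x‖ ≤ S f := fun β f x => by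
    rw [norm_phasePoint_apply]; exact norm_le_seminorm _ _
  have hS0 : ∀ f, 0 ≤ S f := fun f => (norm_nonneg _).trans (hb 0 f 0)
  -- A bound for the derivative uniform in `x` and in times within distance `1` of `t`; multiplied
  -- by `‖ψ x‖` it dominates the differentiated integrand.
  set K : ℝ := ∑ j : Fin m, (R2 * (2 * R1 * S φ + 2 * S (creation j φ)) +
    R2 * (2 * R1 * S φ + 2 * S (annihilation j φ))) with hK
  have hbound : ∀ x, ∀ s ∈ Metric.ball t 1, ‖phaseDeriv (α s) (δ s) φ x‖ ≤ K := by
    intro x s hs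
    have hs' := Metric.ball_subset_closedBall hs
    have h1 : ∀ j, ‖α s j‖ ≤ R1 := fun j => (norm_le_pi_norm _ j).trans (hR1 s hs')
    have h2 : ∀ j, ‖δ s j‖ ≤ R2 := fun j => (norm_le_pi_norm _ j).trans (hR2 s hs')
    rw [phaseDeriv_apply]
    refine (norm_sum_le _ _).trans (Finset.sum_le_sum fun j _ => ?_)
    have hp : ∀ (a : ℂ) (f : Schw m), ‖a‖ ≤ R1 →
        ‖2 * a * phasePoint (α s) φ x - 2 * phasePoint (α s) f x‖ ≤ 2 * R1 * S φ + 2 * S f := by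
      intro a f ha
      refine (norm_sub_le _ _).trans ?_
      simp only [norm_mul, Complex.norm_ofNat]
      have := hb (α s) φ x
      have := hb (α s) f x
      gcongr
    refine (norm_sub_le _ _).trans ?_
    rw [norm_mul, norm_mul, RCLike.norm_conj]
    have h3 := hp (conj (α s j)) (creation j φ) (by rw [RCLike.norm_conj]; exact h1 j)
    have h4 := hp (α s j) (annihilation j φ) (h1 j)
    have h5 := h2 j
    gcongr
  unfold phaseElem
  simp_rw [inner_vec]
  refine (hasDerivAt_integral_of_dominated_loc_of_deriv_le
    (F' := fun s x => conj (ψ x) * phaseDeriv (α s) (δ s) φ x)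
    (bound := fun x => ‖ψ x‖ * K) (Metric.ball_mem_nhds t one_pos)
    (Eventually.of_forall fun s => (integrable_conj_mul ψ _).1) (integrable_conj_mul ψ _)
    (integrable_conj_mul ψ _).1 (Eventually.of_forall fun x s hs => ?_)
    (ψ.integrable.norm.mul_const _)
    (Eventually.of_forall fun x s _ => ?_)).2
  · rw [norm_mul, RCLike.norm_conj]
    gcongr
    exact hbound x s hs
  · exact (hasDerivAt_phasePoint_apply (hα s) φ x).const_mul _

/-- For isometries weak continuity gives strong continuity: the squared distance is `2‖f‖²` minus
twice the real part of a matrix element. -/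
theorem continuous_vec_phasePoint {m : ℕ} (f : Schw m) :
    Continuous fun α => (phasePoint α f).vec := by
  refine continuous_iff_continuousAt.2 fun α => ?_
  have h1 : Tendsto (fun β => ‖(phasePoint β f).vec - (phasePoint α f).vec‖ ^ 2) (𝓝 α) (𝓝 0) := by
    have h2 : ∀ β, ‖(phasePoint β f).vec - (phasePoint α f).vec‖ ^ 2 =
        2 * ‖f.vec‖ ^ 2 - 2 * (phaseElem (phasePoint α f) f β).re := fun β => by
      rw [← norm_neg, neg_sub, @norm_sub_sq ℂ, norm_phasePoint, norm_phasePoint, phaseElem]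
      simp only [RCLike.re_to_complex]
      ring
    simp_rw [h2]
    have h3 : Continuous fun β => 2 * ‖f.vec‖ ^ 2 - 2 * (phaseElem (phasePoint α f) f β).re :=
      continuous_const.sub (continuous_const.mul
        (Complex.continuous_re.comp (continuous_phaseElem _ _)))
    have h4 := h3.tendsto α
    rw [← h2 α] at h4
    simpa using h4
  rw [ContinuousAt, tendsto_iff_norm_sub_tendsto_zero]
  have := h1.sqrt
  simpa [Real.sqrt_sq] using this

/-! ## Quadratic Hamiltonians -/

/-- The Hamiltonian vector field (up to the factor `i`) of a quadratic Hamiltonian. -/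
def hamField {m : ℕ} (β : Fin m → ℂ) (X Y : Matrix (Fin m) (Fin m) ℂ) (α : Fin m → ℂ)
    (j : Fin m) : ℂ :=
  β j + ∑ k, X j k * α k + ∑ k, (conj (Y j k) + conj (Y k j)) * conj (α k)

theorem quadHamiltonian_apply {m : ℕ} (β : Fin m → ℂ) (X Y : Matrix (Fin m) (Fin m) ℂ)
    (f : Schw m) : quadHamiltonian β X Y f =
      ∑ j, (β j • creation j f + conj (β j) • annihilation j f) +
      ∑ j, ∑ k, (X j k • creation j (annihilation k f) +
      Y j k • annihilation j (annihilation k f) +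
      conj (Y j k) • creation j (creation k f)) := by
  simp [quadHamiltonian]

theorem inner_quadHamiltonian {m : ℕ} (β : Fin m → ℂ) {X Y : Matrix (Fin m) (Fin m) ℂ}
    (hX : X.IsHermitian) (hY : Y.IsSymm) (f g : Schw m) :
    ⟪(quadHamiltonian β X Y f).vec, g.vec⟫_ℂ = ⟪f.vec, (quadHamiltonian β X Y g).vec⟫_ℂ := by
  simp only [quadHamiltonian_apply, vec_add, vec_sum, vec_smul, inner_add_left, inner_add_right,
    sum_inner, inner_sum, inner_smul_left, inner_smul_right, inner_creation, inner_annihilation,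
    Complex.conj_conj, Finset.sum_add_distrib]
  have hX' : ∀ j k, conj (X j k) = X k j := fun j k => hX.apply k j
  have hY' : ∀ j k, Y j k = Y k j := fun j k => hY.apply k j
  have s1 : ∑ j, ∑ k, conj (X j k) * ⟪f.vec, (creation k (annihilation j g)).vec⟫_ℂ =
      ∑ j, ∑ k, X j k * ⟪f.vec, (creation j (annihilation k g)).vec⟫_ℂ := by
    rw [Finset.sum_comm]
    simp_rw [hX']
  have s2 : ∑ j, ∑ k, conj (Y j k) * ⟪f.vec, (creation k (creation j g)).vec⟫_ℂ =
      ∑ j, ∑ k, conj (Y j k) * ⟪f.vec, (creation j (creation k g)).vec⟫_ℂ := by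
    rw [Finset.sum_comm]
    refine Finset.sum_congr rfl fun j _ => Finset.sum_congr rfl fun k _ => ?_
    rw [hY' k j]
  have s3 : ∑ j, ∑ k, Y j k * ⟪f.vec, (annihilation k (annihilation j g)).vec⟫_ℂ =
      ∑ j, ∑ k, Y j k * ⟪f.vec, (annihilation j (annihilation k g)).vec⟫_ℂ := by
    rw [Finset.sum_comm]
    refine Finset.sum_congr rfl fun j _ => Finset.sum_congr rfl fun k _ => ?_
    rw [hY' k j]
  rw [s1, s2, s3]
  ring

/-- Infinitesimal covariance: the commutator of a quadratic Hamiltonian with `Π(α)` is the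
derivative of `Π` along the corresponding affine vector field on phase space. -/
theorem phaseDeriv_hamField {m : ℕ} (β : Fin m → ℂ) {X : Matrix (Fin m) (Fin m) ℂ}
    (Y : Matrix (Fin m) (Fin m) ℂ) (hX : X.IsHermitian) (α : Fin m → ℂ) (f : Schw m) :
    phaseDeriv α (Complex.I • hamField β X Y α) f =
      Complex.I • (quadHamiltonian β X Y (phasePoint α f) -
        phasePoint α (quadHamiltonian β X Y f)) := by
  ext x
  rw [phaseDeriv_apply]
  set A := phasePoint α f x with hA
  set D : Fin m → ℂ := fun j => phasePoint α (creation j f) x with hD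
  set B : Fin m → ℂ := fun j => phasePoint α (annihilation j f) x with hB
  have hX' : ∀ j k, conj (X j k) = X k j := fun j k => hX.apply k j
  -- Passing two ladder operators through the reflection changes sign twice, so the terms quadratic
  -- in them cancel in the commutator and only linear ones survive.
  have key : (quadHamiltonian β X Y (phasePoint α f) -
        phasePoint α (quadHamiltonian β X Y f)) x =
      ∑ j, (β j * (2 * conj (α j) * A - 2 * D j) + conj (β j) * (2 * α j * A - 2 * B j)) +
      ∑ j, ∑ k, (X j k * (α k * (2 * conj (α j) * A - 2 * D j) +
          conj (α j) * (2 * α k * A - 2 * B k)) +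
        Y j k * (α k * (2 * α j * A - 2 * B j) + α j * (2 * α k * A - 2 * B k)) +
        conj (Y j k) * (conj (α k) * (2 * conj (α j) * A - 2 * D j) +
          conj (α j) * (2 * conj (α k) * A - 2 * D k))) := by
    simp only [quadHamiltonian_apply, annihilation_phasePoint, creation_phasePoint, map_sub,
      map_smul, map_add, map_sum]
    simp only [sub_apply, add_apply, smul_apply, sum_apply', smul_eq_mul]
    rw [add_sub_add_comm, ← Finset.sum_sub_distrib, ← Finset.sum_sub_distrib]
    simp_rw [← Finset.sum_sub_distrib]
    congr 1
    · refine Finset.sum_congr rfl fun j _ => ?_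
      ring
    · refine Finset.sum_congr rfl fun j _ => Finset.sum_congr rfl fun k _ => ?_
      ring
  rw [smul_apply, smul_eq_mul, key]
  have e1 : ∀ j, conj (hamField β X Y α j) = conj (β j) + ∑ k, X k j * conj (α k) +
      ∑ k, (Y j k + Y k j) * α k := fun j => by
    simp [hamField, hX']
  simp only [Pi.smul_apply, smul_eq_mul, map_mul, Complex.conj_I, e1]
  simp only [hamField]
  have s1 : ∀ (M : Fin m → Fin m → ℂ), ∑ j, ∑ k, M j k = ∑ j, ∑ k, M k j :=
    fun M => Finset.sum_comm
  have t1 : ∀ (u : Matrix (Fin m) (Fin m) ℂ) (p q : Fin m → ℂ),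
      ∑ j, ∑ k, u j k * (q j * p k) = ∑ j, (∑ k, u k j * q k) * p j := fun u p q => by
    rw [s1]
    refine Finset.sum_congr rfl fun j _ => ?_
    rw [Finset.sum_mul]
    exact Finset.sum_congr rfl fun k _ => by ring
  have t2 : ∀ (u : Matrix (Fin m) (Fin m) ℂ) (p q : Fin m → ℂ),
      ∑ j, ∑ k, u j k * (q k * p j) = ∑ j, (∑ k, u j k * q k) * p j := fun u p q => by
    refine Finset.sum_congr rfl fun j _ => ?_
    rw [Finset.sum_mul]
    exact Finset.sum_congr rfl fun k _ => by ring
  set P : Fin m → ℂ := fun j => 2 * conj (α j) * A - 2 * D j with hP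
  set Q : Fin m → ℂ := fun j => 2 * α j * A - 2 * B j with hQ
  have rhs : ∑ j, (β j * P j + conj (β j) * Q j) +
      ∑ j, ∑ k, (X j k * (α k * P j + conj (α j) * Q k) +
        Y j k * (α k * Q j + α j * Q k) +
        conj (Y j k) * (conj (α k) * P j + conj (α j) * P k)) =
      ∑ j, ((β j + ∑ k, X j k * α k + ∑ k, (conj (Y j k) + conj (Y k j)) * conj (α k)) * P j +
        (conj (β j) + ∑ k, X k j * conj (α k) + ∑ k, (Y j k + Y k j) * α k) * Q j) := by
    have u1 := t2 X P α
    have u2 := t1 X Q (fun k => conj (α k))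
    have u3 := t2 Y Q α
    have u4 := t1 Y Q α
    have u5 := t2 (fun j k => conj (Y j k)) P (fun k => conj (α k))
    have u6 := t1 (fun j k => conj (Y j k)) P (fun k => conj (α k))
    simp only [mul_add, add_mul, Finset.sum_add_distrib]
    simp only [u1, u2, u3, u4, u5, u6]
    ring
  have lhs := congrArg (Complex.I * ·) rhs
  beta_reduce at lhs
  rw [lhs, Finset.mul_sum]
  refine Finset.sum_congr rfl fun j _ => ?_
  simp only [hP, hQ]
  ring

/-! ## Hamiltonian flow on phase space -/

/-- The generator of the affine Hamiltonian flow, made linear by adding one coordinate. -/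
def flowGen {m : ℕ} (β : Fin m → ℂ) (X Y : Matrix (Fin m) (Fin m) ℂ) :
    ((Fin m → ℂ) × ℝ) →L[ℝ] ((Fin m → ℂ) × ℝ) :=
  LinearMap.toContinuousLinearMap
    { toFun := fun v => (Complex.I • fun j => (v.2 : ℂ) * β j + ∑ k, X j k * v.1 k +
        ∑ k, (conj (Y j k) + conj (Y k j)) * conj (v.1 k), 0)
      map_add' := fun v w => by
        ext j
        · simp only [Prod.fst_add, Prod.snd_add, Pi.add_apply, Pi.smul_apply, smul_eq_mul, map_add,
            mul_add, Finset.sum_add_distrib, Complex.ofReal_add, add_mul]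
          ring
        · simp
      map_smul' := fun c v => by
        ext j
        · simp only [Prod.smul_fst, Prod.smul_snd, Pi.smul_apply, smul_eq_mul, RingHom.id_apply,
            Complex.real_smul, map_mul, Complex.conj_ofReal, Complex.ofReal_mul, mul_add,
            Finset.mul_sum]
          congr 1
          · congr 1
            · ring
            · exact Finset.sum_congr rfl fun k _ => by ring
          · exact Finset.sum_congr rfl fun k _ => by ring
        · simp }

theorem flowGen_apply_one {m : ℕ} (β : Fin m → ℂ) (X Y : Matrix (Fin m) (Fin m) ℂ)
    (v : (Fin m → ℂ) × ℝ) (hv : v.2 = 1) :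
    flowGen β X Y v = (Complex.I • hamField β X Y v.1, 0) := by
  simp only [flowGen, LinearMap.coe_toContinuousLinearMap', LinearMap.coe_mk, AddHom.coe_mk, hv]
  ext j <;> simp [hamField]

/-- The one-parameter group generated by a bounded operator. -/
def expFlow {E : Type*} [NormedAddCommGroup E] [NormedSpace ℝ E] (L : E →L[ℝ] E) (t : ℝ) :
    E →L[ℝ] E := NormedSpace.exp (t • L)

theorem expFlow_zero {E : Type*} [NormedAddCommGroup E] [NormedSpace ℝ E] (L : E →L[ℝ] E) :
    expFlow L 0 = 1 := by
  rw [expFlow, zero_smul, NormedSpace.exp_zero]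

section

variable {E : Type*} [NormedAddCommGroup E] [NormedSpace ℝ E] [CompleteSpace E]

theorem hasDerivAt_expFlow (L : E →L[ℝ] E) (v : E) (t : ℝ) :
    HasDerivAt (fun t => expFlow L t v) (L (expFlow L t v)) t := by
  have h := hasDerivAt_exp_smul_const' (𝕂 := ℝ) L t
  have := h.clm_apply (hasDerivAt_const t v)
  simpa [expFlow] using this

theorem expFlow_add (L : E →L[ℝ] E) (s t : ℝ) (v : E) :
    expFlow L (s + t) v = expFlow L s (expFlow L t v) := by
  have hc : Commute (s • L) (t • L) := ((Commute.refl L).smul_left s).smul_right t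
  let _ : NormedAlgebra ℚ (E →L[ℝ] E) := NormedAlgebra.restrictScalars ℚ ℝ (E →L[ℝ] E)
  rw [expFlow, add_smul, NormedSpace.exp_add_of_commute hc]
  rfl

end

/-- The linear Hamiltonian flow on the extended phase space. -/
def flowExp {m : ℕ} (β : Fin m → ℂ) (X Y : Matrix (Fin m) (Fin m) ℂ) (t : ℝ) :
    ((Fin m → ℂ) × ℝ) →L[ℝ] ((Fin m → ℂ) × ℝ) :=
  expFlow (flowGen β X Y) t

theorem hasDerivAt_flowExp {m : ℕ} (β : Fin m → ℂ) (X Y : Matrix (Fin m) (Fin m) ℂ)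
    (v : (Fin m → ℂ) × ℝ) (t : ℝ) :
    HasDerivAt (fun t => flowExp β X Y t v) (flowGen β X Y (flowExp β X Y t v)) t :=
  hasDerivAt_expFlow _ v t

theorem flowExp_zero {m : ℕ} (β : Fin m → ℂ) (X Y : Matrix (Fin m) (Fin m) ℂ) :
    flowExp β X Y 0 = 1 := expFlow_zero _

theorem flowExp_add {m : ℕ} (β : Fin m → ℂ) (X Y : Matrix (Fin m) (Fin m) ℂ) (s t : ℝ)
    (v : (Fin m → ℂ) × ℝ) :
    flowExp β X Y (s + t) v = flowExp β X Y s (flowExp β X Y t v) := expFlow_add _ s t v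

/-- The added coordinate is conserved, so the linear group preserves the hyperplane where it equals
`1` and acts there as the affine flow. -/
theorem flowExp_snd {m : ℕ} (β : Fin m → ℂ) (X Y : Matrix (Fin m) (Fin m) ℂ)
    (v : (Fin m → ℂ) × ℝ) (t : ℝ) : (flowExp β X Y t v).2 = v.2 := by
  have h : ∀ t, HasDerivAt (fun t => (flowExp β X Y t v).2) 0 t := fun t => by
    have := (ContinuousLinearMap.snd ℝ (Fin m → ℂ) ℝ).hasFDerivAt.comp_hasDerivAt t
      (hasDerivAt_flowExp β X Y v t)
    have h0 : (flowGen β X Y (flowExp β X Y t v)).2 = 0 := rfl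
    rw [← h0]
    exact this
  have := is_const_of_deriv_eq_zero (fun t => (h t).differentiableAt) (fun t => (h t).deriv) t 0
  simpa [flowExp_zero] using this

/-- The affine Hamiltonian flow on phase space. -/
def flow {m : ℕ} (β : Fin m → ℂ) (X Y : Matrix (Fin m) (Fin m) ℂ) (t : ℝ) (α : Fin m → ℂ) :
    Fin m → ℂ := (flowExp β X Y t (α, 1)).1

theorem hasDerivAt_flow {m : ℕ} (β : Fin m → ℂ) (X Y : Matrix (Fin m) (Fin m) ℂ)
    (α : Fin m → ℂ) (t : ℝ) :
    HasDerivAt (fun t => flow β X Y t α) (Complex.I • hamField β X Y (flow β X Y t α)) t := by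
  have := (ContinuousLinearMap.fst ℝ (Fin m → ℂ) ℝ).hasFDerivAt.comp_hasDerivAt t
    (hasDerivAt_flowExp β X Y (α, 1) t)
  rw [flowGen_apply_one _ _ _ _ (flowExp_snd β X Y (α, 1) t)] at this
  exact this

theorem flow_zero {m : ℕ} (β : Fin m → ℂ) (X Y : Matrix (Fin m) (Fin m) ℂ) (α : Fin m → ℂ) :
    flow β X Y 0 α = α := by simp [flow, flowExp_zero]

theorem flow_neg_flow {m : ℕ} (β : Fin m → ℂ) (X Y : Matrix (Fin m) (Fin m) ℂ) (t : ℝ)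
    (α : Fin m → ℂ) : flow β X Y t (flow β X Y (-t) α) = α := by
  have h : (flow β X Y (-t) α, (1 : ℝ)) = flowExp β X Y (-t) (α, 1) :=
    Prod.ext rfl (flowExp_snd β X Y (α, 1) (-t)).symm
  rw [flow, h, ← flowExp_add, add_neg_cancel, flowExp_zero]; rfl

theorem continuous_flow {m : ℕ} (β : Fin m → ℂ) (X Y : Matrix (Fin m) (Fin m) ℂ) (t : ℝ) :
    Continuous (flow β X Y t) := by
  unfold flow; fun_prop

theorem norm_flow_le {m : ℕ} (β : Fin m → ℂ) (X Y : Matrix (Fin m) (Fin m) ℂ) (t : ℝ)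
    (α : Fin m → ℂ) : ‖flow β X Y t α‖ ≤ ‖flowExp β X Y t‖ * (1 + ‖α‖) := by
  refine (norm_fst_le _).trans ((ContinuousLinearMap.le_opNorm _ _).trans ?_)
  gcongr
  rw [Prod.norm_mk, norm_one]
  exact max_le (by linarith) (by linarith [norm_nonneg α])

/-! ## Gaussian unitaries act on Wigner functions by affine maps -/

/-- The second factor vanishes at `t`, so the first need only be continuous. This replaces the
product rule where a reflected vector is not known to be differentiable. -/
theorem hasDerivAt_inner_sub_right {H : Type*} [NormedAddCommGroup H] [InnerProductSpace ℂ H]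
    {p q : ℝ → H} {q' : H} {t : ℝ} (hp : ContinuousAt p t) (hq : HasDerivAt q q' t) :
    HasDerivAt (fun s => ⟪p s, q s - q t⟫_ℂ) ⟪p t, q'⟫_ℂ t := by
  rw [hasDerivAt_iff_tendsto_slope] at hq ⊢
  have h := (hp.tendsto.mono_left (nhdsWithin_le_nhds (s := {t}ᶜ))).inner (𝕜 := ℂ) hq
  refine h.congr fun s => ?_
  simp only [slope_def_module, sub_self, inner_zero_right, sub_zero]
  rw [← Complex.coe_smul, inner_smul_right, Complex.real_smul]

theorem hasDerivAt_inner_sub_left {H : Type*} [NormedAddCommGroup H] [InnerProductSpace ℂ H]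
    {p q : ℝ → H} {p' : H} {t : ℝ} (hp : HasDerivAt p p' t) (hq : ContinuousAt q t) :
    HasDerivAt (fun s => ⟪p s - p t, q s⟫_ℂ) ⟪p', q t⟫_ℂ t := by
  have h := hasDerivAt_inner_sub_right hq hp
  have := (Complex.conjCLE : ℂ →L[ℝ] ℂ).hasFDerivAt.comp_hasDerivAt t h
  simpa [Function.comp_def] using this

/-- Evolving both states by `exp(itH)` and the phase space point by the Hamiltonian flow leaves the
matrix element constant: the contributions of `H` on the two states cancel the commutator in
`phaseDeriv_hamField`. -/
theorem phaseElem_expI {m : ℕ} {β : Fin m → ℂ} {X Y : Matrix (Fin m) (Fin m) ℂ}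
    (hX : X.IsHermitian) (hY : Y.IsSymm) {V : ℝ → (L2 m ≃ₗᵢ[ℂ] L2 m)}
    (hV : ∀ s t, V (s + t) = V s * V t) (hVc : ∀ ψ, Continuous fun t => V t ψ)
    (hd : ∀ f : Schw m,
      HasDerivAt (fun t => V t f.vec) (Complex.I • (quadHamiltonian β X Y f).vec) 0)
    {f g : ℝ → Schw m} (hf : ∀ t, V t (f 0).vec = (f t).vec) (hg : ∀ t, V t (g 0).vec = (g t).vec)
    (α : Fin m → ℂ) (t : ℝ) :
    phaseElem (g t) (f t) (flow β X Y t α) = phaseElem (g 0) (f 0) α := by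
  have hder : ∀ {f : ℝ → Schw m}, (∀ t, V t (f 0).vec = (f t).vec) → ∀ t,
      HasDerivAt (fun s => (f s).vec) (Complex.I • (quadHamiltonian β X Y (f t)).vec) t := by
    intro f hf t
    have h1 := hd (f t)
    rw [← sub_self t] at h1
    have h2 := h1.comp_sub_const t t
    refine h2.congr_of_eventuallyEq (Eventually.of_forall fun s => ?_)
    change (f s).vec = V (s - t) (f t).vec
    rw [← hf t, ← hf s]
    have : V s = V (s - t) * V t := by rw [← hV, sub_add_cancel]
    rw [this]; rfl
  set a : ℝ → Fin m → ℂ := fun t => flow β X Y t α with ha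
  have had : ∀ t, HasDerivAt a (Complex.I • hamField β X Y (a t)) t := hasDerivAt_flow β X Y α
  have hac : Continuous a := continuous_iff_continuousAt.2 fun t => (had t).continuousAt
  have hfieldc : Continuous fun t => Complex.I • hamField β X Y (a t) := by
    refine continuous_pi fun j => ?_
    have : ∀ k, Continuous fun t => a t k := fun k => (continuous_apply k).comp hac
    simp only [hamField, Pi.smul_apply]
    have h2 : ∀ k, Continuous fun t => conj (a t k) := fun k => Complex.continuous_conj.comp (this k)
    fun_prop
  have hcont : ∀ {f : ℝ → Schw m}, (∀ t, V t (f 0).vec = (f t).vec) →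
      Continuous fun s => (f s).vec := fun {f} hf => by
    have := hVc (f 0).vec
    simpa [hf] using this
  have key : ∀ t, HasDerivAt (fun s => phaseElem (g s) (f s) (a s)) 0 t := by
    intro t
    have c1 : ContinuousAt (fun s => (phasePoint (a s) (f s)).vec) t := by
      have e1 : ∀ s, (phasePoint (a s) (f s)).vec =
          (phasePoint (a s) (f s - f t)).vec + (phasePoint (a s) (f t)).vec := fun s => by
        rw [← vec_add, ← map_add, sub_add_cancel]
      simp_rw [e1]
      refine ContinuousAt.add ?_ ((continuous_vec_phasePoint (f t)).comp hac).continuousAt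
      rw [ContinuousAt, sub_self, map_zero, vec_zero, tendsto_zero_iff_norm_tendsto_zero]
      simp_rw [norm_phasePoint, vec_sub]
      have := ((hcont hf).tendsto t).sub_const (f t).vec
      rw [sub_self] at this
      exact tendsto_zero_iff_norm_tendsto_zero.1 this
    have c2 : ContinuousAt (fun s => (phasePoint (a s) (g t)).vec) t :=
      ((continuous_vec_phasePoint (g t)).comp hac).continuousAt
    -- Telescoping of `⟨g_s|Π_s|f_s⟩` into `⟨g_s - g_t, Π_s f_s⟩ + ⟨Π_s g_t, f_s - f_t⟩ + ⟨g_t, Π_s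
    -- f_t⟩`, so that each summand has only one factor to differentiate.
    have d1 := hasDerivAt_inner_sub_left (hder hg t) c1
    have d2 := hasDerivAt_inner_sub_right c2 (hder hf t)
    have d3 := hasDerivAt_phaseElem had hfieldc (g t) (f t) t
    have d4 := (d1.add d2).add d3
    refine (d4.congr_of_eventuallyEq (Eventually.of_forall fun s => ?_)).congr_deriv ?_
    · simp only [Pi.add_apply, phaseElem, inner_sub_left]
      rw [← vec_sub, inner_phasePoint (a s) (g t) (f s - f t), map_sub, vec_sub, inner_sub_right]
      ring
    · rw [phaseDeriv_hamField β Y hX]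
      simp only [vec_smul, vec_sub, inner_smul_left, inner_smul_right, inner_sub_right,
        Complex.conj_I]
      rw [inner_quadHamiltonian β hX hY, inner_phasePoint]
      ring
  have := is_const_of_deriv_eq_zero (fun t => (key t).differentiableAt) (fun t => (key t).deriv) t 0
  simpa [ha, flow_zero] using this

theorem wigner_expI {m : ℕ} {U : L2 m ≃ₗᵢ[ℂ] L2 m} {β : Fin m → ℂ}
    {X Y : Matrix (Fin m) (Fin m) ℂ} (hX : X.IsHermitian) (hY : Y.IsSymm)
    (hU : IsExpI U (quadHamiltonian β X Y)) (f : Schw m) :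
    ∃ g : Schw m, U f.vec = g.vec ∧ ∀ α, wigner g α = wigner f (flow β X Y (-1) α) := by
  obtain ⟨V, hV, hVc, hV1, hS, hd⟩ := hU
  choose F hF using fun t => hS t f
  have hV0 : V 0 = 1 := by
    have := hV 0 0
    rw [add_zero] at this
    exact (mul_eq_left.1 this.symm)
  have hF0 : (F 0).vec = f.vec := by rw [← hF 0, hV0]; rfl
  have hF' : ∀ t, V t (F 0).vec = (F t).vec := fun t => by rw [hF0, hF]
  refine ⟨F 1, by rw [← hV1, hF], fun α => ?_⟩
  have h := phaseElem_expI hX hY hV hVc hd hF' hF' (flow β X Y (-1) α) 1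
  rw [flow_neg_flow] at h
  have hFf : F 0 = f := SchwartzMap.injective_toLp 2 volume hF0
  rw [wigner_eq, wigner_eq]
  change _ * phaseElem (F 1) (F 1) α = _ * phaseElem f f _
  rw [h, hFf]

/-- The Wigner function of `Uψ` is that of `ψ` composed with the inverse flow, so the pushforward of
the measure under the inverse flow serves. -/
theorem hasNonnegWigner_pullback_expI {m : ℕ} {U : L2 m ≃ₗᵢ[ℂ] L2 m} {β : Fin m → ℂ}
    {X Y : Matrix (Fin m) (Fin m) ℂ} (hX : X.IsHermitian) (hY : Y.IsSymm)
    (hU : IsExpI U (quadHamiltonian β X Y)) {E E' : L2 m →L[ℂ] L2 m} (hE : HasNonnegWigner E)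
    (hE' : ∀ ψ, ⟪ψ, E' ψ⟫_ℂ = ⟪U ψ, E (U ψ)⟫_ℂ) : HasNonnegWigner E' := by
  obtain ⟨μ, hμ, h⟩ := hE
  refine ⟨μ.map (flow β X Y (-1)), ?_, fun ψ => ?_⟩
  · obtain ⟨n, hn⟩ := hμ.exists_integrable
    refine ⟨n, ?_⟩
    have hc : Continuous fun x : Fin m → ℂ => (1 + ‖x‖) ^ (-(n : ℝ)) := by
      refine Continuous.rpow_const (by fun_prop) fun x => Or.inl ?_
      positivity
    rw [integrable_map_measure hc.aestronglyMeasurable (continuous_flow β X Y _).aemeasurable]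
    set K := ‖flowExp β X Y 1‖ with hK
    refine (hn.const_mul ((1 + K) ^ (n : ℝ))).mono'
      (hc.comp (continuous_flow β X Y _)).aestronglyMeasurable (Eventually.of_forall fun α => ?_)
    have h1 := norm_flow_le β X Y 1 (flow β X Y (-1) α)
    rw [flow_neg_flow, ← hK] at h1
    set s := flow β X Y (-1) α with hs
    have hK0 : 0 ≤ K := norm_nonneg _
    -- The flow is affine and changes `1 + ‖α‖` by at most a constant factor, which preserves
    -- temperate growth with the same exponent.
    have h2 : 1 + ‖α‖ ≤ (1 + K) * (1 + ‖s‖) := by nlinarith [norm_nonneg s]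
    simp only [Function.comp_apply, ← hs]
    rw [Real.norm_of_nonneg (by positivity), Real.rpow_neg (by positivity),
      Real.rpow_neg (by positivity), ← div_eq_mul_inv, inv_eq_one_div,
      div_le_div_iff₀ (by positivity) (by positivity), one_mul,
      ← Real.mul_rpow (by positivity) (by positivity)]
    exact Real.rpow_le_rpow (by positivity) h2 (by positivity)
  · obtain ⟨g, hg, hw⟩ := wigner_expI hX hY hU ψ
    rw [hE', hg, h g, integral_map (continuous_flow β X Y _).aemeasurable]
    · simp_rw [hw]
    · have : wigner ψ = fun α => ((2 / Real.pi) ^ m : ℝ) * phaseElem ψ ψ α :=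
        funext (wigner_eq ψ)
      rw [this]
      exact (continuous_const.mul (continuous_phaseElem ψ ψ)).aestronglyMeasurable

theorem hasNonnegWigner_pullback_gaussian {m : ℕ} {U : L2 m ≃ₗᵢ[ℂ] L2 m}
    (hU : IsGaussianUnitary U) : ∀ {E E' : L2 m →L[ℂ] L2 m}, HasNonnegWigner E →
    (∀ ψ, ⟪ψ, E' ψ⟫_ℂ = ⟪U ψ, E (U ψ)⟫_ℂ) → HasNonnegWigner E' := by
  unfold IsGaussianUnitary at hU
  induction hU using Submonoid.closure_induction with
  | mem U h =>
    obtain ⟨β, X, Y, hX, hY, hexp⟩ := h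
    exact fun hE hE' => hasNonnegWigner_pullback_expI hX hY hexp hE hE'
  | one =>
    rintro E E' ⟨μ, hμ, h⟩ hE'
    exact ⟨μ, hμ, fun ψ => by rw [hE' ψ.vec]; exact h ψ⟩
  | mul U W _ _ ihU ihW =>
    intro E E' hE hE'
    set Uc : L2 m →L[ℂ] L2 m := U.toLinearIsometry.toContinuousLinearMap
    have h1 : HasNonnegWigner (ContinuousLinearMap.adjoint Uc ∘L E ∘L Uc) :=
      ihU hE fun ψ => by
        simp only [ContinuousLinearMap.comp_apply, ContinuousLinearMap.adjoint_inner_right]; rfl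
    refine ihW h1 fun ψ => ?_
    rw [hE']
    simp only [ContinuousLinearMap.comp_apply, ContinuousLinearMap.adjoint_inner_right]; rfl

/-! ## The vacuum and coherent states -/

theorem inner_vacuum_vacuum (m : ℕ) : ⟪(vacuum m).vec, (vacuum m).vec⟫_ℂ = 1 := by
  rw [inner_vec]
  have h1 : ∀ x : Fin m → ℝ, conj (vacuum m x) * vacuum m x =
      ((Real.pi ^ (-(m : ℝ) / 2) * ∏ j, Real.exp (-1 * x j ^ 2) : ℝ) : ℂ) := fun x => by
    rw [vacuum_apply, vacuumFun, Complex.conj_ofReal, ← Complex.ofReal_mul]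
    congr 1
    rw [← Real.exp_sum, mul_mul_mul_comm, ← Real.rpow_add Real.pi_pos, ← Real.exp_add,
      ← Finset.mul_sum]
    congr 2 <;> ring
  simp_rw [h1]
  rw [integral_complex_ofReal, integral_const_mul,
    integral_fintype_prod_volume_eq_pow (fun x : ℝ => Real.exp (-1 * x ^ 2)), integral_gaussian,
    div_one, Real.sqrt_eq_rpow, ← Real.rpow_mul_natCast Real.pi_pos.le,
    ← Real.rpow_add Real.pi_pos, Fintype.card_fin]
  have : -(m : ℝ) / 2 + 1 / 2 * m = 0 := by ring
  rw [this, Real.rpow_zero, Complex.ofReal_one]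

theorem norm_vacuum (m : ℕ) : ‖(vacuum m).vec‖ = 1 := by
  have h := inner_vacuum_vacuum m
  rw [inner_self_eq_norm_sq_to_K] at h
  have h' : ‖(vacuum m).vec‖ ^ 2 = 1 := Complex.ofReal_injective (by simpa using h)
  exact (pow_eq_one_iff_of_nonneg (norm_nonneg _) two_ne_zero).1 h'

theorem annihilation_vacuum {m : ℕ} (j : Fin m) : annihilation j (vacuum m) = 0 := by
  ext x
  rw [annihilation_apply, partialDeriv_apply]
  have h1 : HasFDerivAt (fun x : Fin m → ℝ => -(∑ j, x j ^ 2) / 2)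
      (-(∑ i, x i • (ContinuousLinearMap.proj (R := ℝ) (φ := fun _ : Fin m => ℝ) i))) x := by
    have h2 : HasFDerivAt (fun x : Fin m → ℝ => ∑ j, x j ^ 2) (∑ i, (2 * x i) •
        (ContinuousLinearMap.proj (R := ℝ) (φ := fun _ : Fin m => ℝ) i)) x := by
      refine HasFDerivAt.fun_sum fun i _ => ?_
      simpa using
        (ContinuousLinearMap.proj (R := ℝ) (φ := fun _ : Fin m => ℝ) i).hasFDerivAt (x := x)|>.pow 2
    have h3 := h2.const_mul (-1 / 2 : ℝ)
    refine (h3.congr_of_eventuallyEq (Eventually.of_forall fun y => by ring)).congr_fderiv ?_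
    rw [Finset.smul_sum, ← Finset.sum_neg_distrib]
    refine Finset.sum_congr rfl fun i _ => ?_
    ext y
    simp
    ring
  have h4 := ((h1.exp.const_mul (Real.pi ^ (-(m : ℝ) / 4))))
  have h5 := Complex.ofRealCLM.hasFDerivAt.comp x h4
  have h6 : (vacuum m : (Fin m → ℝ) → ℂ) = Complex.ofRealCLM ∘ fun x : Fin m → ℝ =>
      Real.pi ^ (-(m : ℝ) / 4) * Real.exp (-(∑ j, x j ^ 2) / 2) := by
    ext y; exact vacuum_apply m y
  rw [h6, h5.fderiv]
  simp [Pi.single_apply]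
  ring_nf

/-- Along the ray `t • α` the derivative formula closes up, because `a_j` kills the vacuum on either
side: the element satisfies `y' = -4ts y`, whose solution is Gaussian. -/
theorem phaseElem_vacuum {m : ℕ} (α : Fin m → ℂ) :
    phaseElem (vacuum m) (vacuum m) α = Real.exp (-2 * ∑ j, ‖α j‖ ^ 2) := by
  set v := vacuum m with hv
  set s : ℝ := ∑ j, ‖α j‖ ^ 2 with hs
  have hd : ∀ t : ℝ, HasDerivAt (fun t : ℝ => phaseElem v v (t • α))
      (-(4 * t * s : ℝ) * phaseElem v v (t • α)) t := by
    intro t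
    have h1 : ∀ t : ℝ, HasDerivAt (fun t : ℝ => t • α) α t := fun t => by
      simpa using (hasDerivAt_id t).smul_const α
    refine (hasDerivAt_phaseElem h1 continuous_const v v t).congr_deriv ?_
    have ha : ∀ j, phaseElem v (annihilation j v) (t • α) = 0 := fun j => by
      rw [hv, annihilation_vacuum, phaseElem, map_zero, vec_zero, inner_zero_right]
    have hc : ∀ j, phaseElem v (creation j v) (t • α) =
        2 * conj ((t • α) j) * phaseElem v v (t • α) := fun j => by
      have h0 : phaseElem (annihilation j v) v (t • α) = 0 := by
        rw [hv, annihilation_vacuum, phaseElem, vec_zero, inner_zero_left]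
      rw [two_mul_conj_phaseElem, h0, zero_add]
    simp only [phaseElem] at ha hc
    simp only [phaseDeriv, vec_sum, vec_sub, vec_smul, inner_sum, inner_sub_right,
      inner_smul_right, ha, hc, phaseElem]
    rw [hs, Complex.ofReal_mul, Complex.ofReal_sum, Finset.mul_sum, ← Finset.sum_neg_distrib,
      Finset.sum_mul]
    refine Finset.sum_congr rfl fun j _ => ?_
    have : ((‖α j‖ ^ 2 : ℝ) : ℂ) = α j * conj (α j) := by
      rw [Complex.mul_conj, Complex.normSq_eq_norm_sq]
    rw [this]
    simp
    ring
  have hd2 : ∀ t : ℝ, HasDerivAt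
      (fun t : ℝ => ((Real.exp (2 * s * t ^ 2) : ℝ) : ℂ) * phaseElem v v (t • α)) 0 t := by
    intro t
    have h1 : HasDerivAt (fun t : ℝ => Real.exp (2 * s * t ^ 2))
        (Real.exp (2 * s * t ^ 2) * (2 * s * (2 * t))) t := by
      have := ((hasDerivAt_pow 2 t).const_mul (2 * s)).exp
      simpa using this
    refine (h1.ofReal_comp.mul (hd t)).congr_deriv ?_
    push_cast
    ring
  have := is_const_of_deriv_eq_zero (fun t => (hd2 t).differentiableAt)
    (fun t => (hd2 t).deriv) 1 0
  simp only [one_pow, mul_one, one_smul, zero_smul, ne_eq, OfNat.ofNat_ne_zero,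
    not_false_eq_true, zero_pow, mul_zero, Real.exp_zero, Complex.ofReal_one, one_mul] at this
  have h0 : phaseElem v v 0 = 1 := by
    have : phasePoint 0 v = v := by
      ext x
      rw [phasePoint_apply, hv, vacuum_apply, vacuum_apply]
      have h1 : shift (0 : Fin m → ℂ) = 0 := by ext; simp [shift]
      have h2 : phaseAngle (0 : Fin m → ℂ) x = 0 := by simp [phaseAngle]
      rw [h1, h2]
      simp [vacuumFun]
    rw [phaseElem, this, hv, inner_vacuum_vacuum]
  rw [h0] at this
  have h3 : Real.exp (-2 * s) * Real.exp (2 * s) = 1 := by rw [← Real.exp_add]; simp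
  have h4 : ((Real.exp (-2 * s) : ℝ) : ℂ) * ((Real.exp (2 * s) : ℝ) : ℂ) = 1 := by
    rw [← Complex.ofReal_mul, h3, Complex.ofReal_one]
  linear_combination ((Real.exp (-2 * s) : ℝ) : ℂ) * this - phaseElem v v α * h4

theorem phaseElem_phasePoint_phasePoint {m : ℕ} (ψ φ : Schw m) (a c α : Fin m → ℂ) :
    phaseElem (phasePoint a ψ) (phasePoint c φ) α =
      Complex.exp (Complex.I * ((∑ j, 4 * ((α j - a j).re * (c j - α j).im
        - (α j - a j).im * (c j - α j).re) : ℝ) : ℂ)) * phaseElem ψ φ (a - α + c) := by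
  rw [phaseElem, inner_phasePoint, phasePoint_comp₃, vec_smul, inner_smul_right]; rfl

/-- Coherent states. -/
def coherent {m : ℕ} (β : Fin m → ℂ) : Schw m := phasePoint (fun j => β j / 2) (vacuum m)

theorem norm_coherent {m : ℕ} (β : Fin m → ℂ) : ‖(coherent β).vec‖ = 1 := by
  rw [coherent, norm_phasePoint, norm_vacuum]

/-- Both outer reflections have centre `β/2`, so the area phase vanishes. Coherent states thus test
a Wigner measure against translated Gaussians. -/
theorem phaseElem_coherent {m : ℕ} (β α : Fin m → ℂ) :
    phaseElem (coherent β) (coherent β) α = Real.exp (-2 * ∑ j, ‖α j - β j‖ ^ 2) := by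
  rw [coherent, phaseElem_phasePoint_phasePoint, phaseElem_vacuum]
  have h1 : (∑ j, 4 * ((α j - β j / 2).re * (β j / 2 - α j).im
        - (α j - β j / 2).im * (β j / 2 - α j).re) : ℝ) = 0 := by
    refine Finset.sum_eq_zero fun j _ => ?_
    simp only [Complex.sub_re, Complex.sub_im]
    ring
  rw [h1]
  have h2 : ∀ j, ‖((fun j => β j / 2) - α + fun j => β j / 2) j‖ = ‖α j - β j‖ := fun j => by
    rw [← norm_neg]
    congr 1
    simp only [Pi.add_apply, Pi.sub_apply]
    ring
  simp_rw [h2]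
  simp

/-- Opposite displacements keep the Gaussian centred at the origin and produce a plane wave; these
matrix elements are the integrands of the characteristic functions in `measurable_damped`. -/
theorem phaseElem_opposite_vacuum {m : ℕ} (γ α : Fin m → ℂ) :
    phaseElem (phasePoint γ (vacuum m)) (phasePoint (-γ) (vacuum m)) α =
      Complex.exp (((8 * ∑ j, ((γ j).re * (α j).im - (γ j).im * (α j).re) : ℝ) : ℂ) * Complex.I) *
        Real.exp (-2 * ∑ j, ‖α j‖ ^ 2) := by
  rw [phaseElem_phasePoint_phasePoint, phaseElem_vacuum, mul_comm Complex.I]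
  have h1 : (∑ j, 4 * ((α j - γ j).re * ((-γ) j - α j).im
        - (α j - γ j).im * ((-γ) j - α j).re) : ℝ) =
      8 * ∑ j, ((γ j).re * (α j).im - (γ j).im * (α j).re) := by
    rw [Finset.mul_sum]
    refine Finset.sum_congr rfl fun j _ => ?_
    simp only [Complex.sub_re, Complex.sub_im, Pi.neg_apply, Complex.neg_re, Complex.neg_im]
    ring
  have h2 : ∀ j, ‖(γ - α + -γ) j‖ = ‖α j‖ := fun j => by
    rw [← norm_neg]
    congr 1
    simp
  rw [h1]
  simp_rw [h2]

/-! ## Tensor products with the vacuum -/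

section Tensor

variable {D E₁ E₂ : Type*} [NormedAddCommGroup D] [NormedSpace ℝ D] [NormedAddCommGroup E₁]
  [NormedSpace ℝ E₁] [NormedAddCommGroup E₂] [NormedSpace ℝ E₂]

theorem iteratedFDeriv_comp_decay (f : 𝓢(E₁, ℂ)) (L : D →L[ℝ] E₁) (k n : ℕ) :
    ∃ C : ℝ, 0 ≤ C ∧ ∀ z, (1 + ‖L z‖) ^ k * ‖iteratedFDeriv ℝ n (fun z => f (L z)) z‖ ≤ C := by
  refine ⟨2 ^ k * ((Finset.Iic (k, n)).sup
    (fun m => SchwartzMap.seminorm ℝ m.1 m.2) f) * ‖L‖ ^ n, by positivity, fun z => ?_⟩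
  have h1 := L.iteratedFDeriv_comp_right (f.smooth ⊤) z (i := n) (by exact_mod_cast le_top)
  have h2 : ‖iteratedFDeriv ℝ n (fun z => f (L z)) z‖ ≤ ‖iteratedFDeriv ℝ n f (L z)‖ * ‖L‖ ^ n := by
    change ‖iteratedFDeriv ℝ n (f ∘ L) z‖ ≤ _
    rw [h1]
    refine (ContinuousMultilinearMap.norm_compContinuousLinearMap_le _ _).trans ?_
    simp
  have h3 := SchwartzMap.one_add_le_sup_seminorm_apply (𝕜 := ℝ) (m := (k, n)) le_rfl le_rfl f (L z)
  calc _ ≤ (1 + ‖L z‖) ^ k * (‖iteratedFDeriv ℝ n f (L z)‖ * ‖L‖ ^ n) := by gcongr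
    _ = (1 + ‖L z‖) ^ k * ‖iteratedFDeriv ℝ n f (L z)‖ * ‖L‖ ^ n := by ring
    _ ≤ _ := by gcongr

/-- The exterior product of two Schwartz functions of complementary sets of coordinates. -/
def tensorSchw (f : 𝓢(E₁, ℂ)) (g : 𝓢(E₂, ℂ)) (L₁ : D →L[ℝ] E₁) (L₂ : D →L[ℝ] E₂)
    (hL : ∀ z, ‖z‖ ≤ max ‖L₁ z‖ ‖L₂ z‖) : 𝓢(D, ℂ) where
  toFun z := f (L₁ z) * g (L₂ z)
  smooth' := ((f.smooth ⊤).comp L₁.contDiff).mul ((g.smooth ⊤).comp L₂.contDiff)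
  decay' k n := by
    choose C1 hC1 h1 using fun i => iteratedFDeriv_comp_decay f L₁ k i
    choose C2 hC2 h2 using fun i => iteratedFDeriv_comp_decay g L₂ k i
    refine ⟨∑ i ∈ Finset.range (n + 1), (n.choose i : ℝ) * C1 i * C2 (n - i), fun z => ?_⟩
    have h3 := norm_iteratedFDeriv_mul_le (𝕜 := ℝ) ((f.smooth ⊤).comp L₁.contDiff)
      ((g.smooth ⊤).comp L₂.contDiff) z (n := n) (by exact_mod_cast le_top)
    refine (mul_le_mul_of_nonneg_left h3 (by positivity)).trans ?_
    rw [Finset.mul_sum]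
    refine Finset.sum_le_sum fun i _ => ?_
    have h4 : ‖z‖ ^ k ≤ (1 + ‖L₁ z‖) ^ k * (1 + ‖L₂ z‖) ^ k := by
      rw [← mul_pow]
      refine pow_le_pow_left₀ (norm_nonneg _) ((hL z).trans (max_le ?_ ?_)) _
      · nlinarith [norm_nonneg (L₁ z), norm_nonneg (L₂ z),
          mul_nonneg (norm_nonneg (L₁ z)) (norm_nonneg (L₂ z))]
      · nlinarith [norm_nonneg (L₁ z), norm_nonneg (L₂ z),
          mul_nonneg (norm_nonneg (L₁ z)) (norm_nonneg (L₂ z))]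
    calc ‖z‖ ^ k * ((n.choose i : ℝ) * ‖iteratedFDeriv ℝ i (fun z => f (L₁ z)) z‖ *
          ‖iteratedFDeriv ℝ (n - i) (fun z => g (L₂ z)) z‖)
        ≤ (1 + ‖L₁ z‖) ^ k * (1 + ‖L₂ z‖) ^ k *
          ((n.choose i : ℝ) * ‖iteratedFDeriv ℝ i (fun z => f (L₁ z)) z‖ *
          ‖iteratedFDeriv ℝ (n - i) (fun z => g (L₂ z)) z‖) := by gcongr
      _ = (n.choose i : ℝ) * ((1 + ‖L₁ z‖) ^ k * ‖iteratedFDeriv ℝ i (fun z => f (L₁ z)) z‖) *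
          ((1 + ‖L₂ z‖) ^ k * ‖iteratedFDeriv ℝ (n - i) (fun z => g (L₂ z)) z‖) := by ring
      _ ≤ _ := by
        gcongr
        · exact mul_nonneg (by positivity) (hC1 i)
        · exact h1 i z
        · exact h2 (n - i) z

end Tensor

/-- Forgetting the coordinate `j`. -/
def removeCLM {m : ℕ} (j : Fin (m + 1)) : (Fin (m + 1) → ℝ) →L[ℝ] (Fin m → ℝ) :=
  ContinuousLinearMap.pi fun i => ContinuousLinearMap.proj (j.succAbove i)

/-- The Schwartz function `ψ ⊗ |0⟩` with the vacuum in mode `j`. -/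
def vacTensor {m : ℕ} (j : Fin (m + 1)) (ψ : Schw m) : Schw (m + 1) :=
  tensorSchw (vacuum 1) ψ (ContinuousLinearMap.pi fun _ => ContinuousLinearMap.proj j)
    (removeCLM j) fun z => by
      refine (pi_norm_le_iff_of_nonneg (le_max_of_le_left (norm_nonneg _))).2 fun i => ?_
      rcases Fin.eq_self_or_eq_succAbove j i with rfl | ⟨k, rfl⟩
      · exact le_max_of_le_left (norm_le_pi_norm
          ((ContinuousLinearMap.pi fun _ : Fin 1 => ContinuousLinearMap.proj i :
            (Fin (m + 1) → ℝ) →L[ℝ] (Fin 1 → ℝ)) z) 0)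
      · exact le_max_of_le_right (norm_le_pi_norm (removeCLM j z) k)

theorem vacTensor_apply {m : ℕ} (j : Fin (m + 1)) (ψ : Schw m) (z : Fin (m + 1) → ℝ) :
    vacTensor j ψ z = vacuum 1 (fun _ => z j) * ψ (j.removeNth z) := rfl

theorem addVacuum_vec {m : ℕ} (j : Fin (m + 1)) (ψ : Schw m) :
    addVacuum j ψ.vec = (vacTensor j ψ).vec := by
  refine Lp.ext ?_
  have h1 : addVacuum j ψ.vec =ᵐ[volume] ancillaFun j ψ.vec :=
    (ancilla_memLp j ψ.vec).coeFn_toLp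
  filter_upwards [h1, (ancilla_quasi j).ae (ψ.coeFn_toLp 2 volume),
    (vacTensor j ψ).coeFn_toLp 2 volume] with z h1 h2 h3
  rw [h1, h3, vacTensor_apply, ancillaFun, h2]

theorem phaseAngle_succAbove {m : ℕ} (j : Fin (m + 1)) (α : Fin (m + 1) → ℂ)
    (x : Fin (m + 1) → ℝ) : phaseAngle α x =
      phaseAngle (fun _ : Fin 1 => α j) (fun _ => x j) +
        phaseAngle (j.removeNth α) (j.removeNth x) := by
  rw [phaseAngle, Fin.sum_univ_succAbove _ j]
  simp [phaseAngle, Fin.removeNth]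

theorem phaseElem_vacTensor {m : ℕ} (j : Fin (m + 1)) (ψ : Schw m) (α : Fin (m + 1) → ℂ) :
    phaseElem (vacTensor j ψ) (vacTensor j ψ) α =
      Real.exp (-2 * ‖α j‖ ^ 2) * phaseElem ψ ψ (j.removeNth α) := by
  have hv : ∫ x : ℝ, conj (vacuum 1 (fun _ => x)) *
      phasePoint (fun _ => α j) (vacuum 1) (fun _ => x) = Real.exp (-2 * ‖α j‖ ^ 2) := by
    have h1 := phaseElem_vacuum (fun _ : Fin 1 => α j)
    rw [phaseElem, inner_vec] at h1
    have h2 := (volume_preserving_funUnique (Fin 1) ℝ).symm.integral_comp'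
      (fun x : Fin 1 → ℝ => conj (vacuum 1 x) * phasePoint (fun _ => α j) (vacuum 1) x)
    have h3 := h2.trans h1
    have h4 : ∀ x : ℝ, (MeasurableEquiv.funUnique (Fin 1) ℝ).symm x = fun _ => x := fun x => by
      ext i; rw [Subsingleton.elim i 0]; rfl
    simp only [h4] at h3
    simpa using h3
  rw [← hv, phaseElem, phaseElem, inner_vec, inner_vec]
  have h3 := (volume_preserving_piFinSuccAbove (fun _ : Fin (m + 1) => ℝ) j).integral_comp'
    (fun p : ℝ × (Fin m → ℝ) => (conj (vacuum 1 (fun _ => p.1)) *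
      phasePoint (fun _ => α j) (vacuum 1) (fun _ => p.1)) *
      (conj (ψ p.2) * phasePoint (j.removeNth α) ψ p.2))
  rw [← integral_prod_mul (μ := (volume : Measure ℝ)) (ν := (volume : Measure (Fin m → ℝ)))
    (fun x : ℝ => conj (vacuum 1 (fun _ => x)) *
      phasePoint (fun _ => α j) (vacuum 1) (fun _ => x))
    (fun y => conj (ψ y) * phasePoint (j.removeNth α) ψ y), ← Measure.volume_eq_prod, ← h3]
  congr 1; ext z
  simp only [MeasurableEquiv.piFinSuccAbove_apply, phasePoint_apply, vacTensor_apply,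
    phaseAngle_succAbove j α z, map_mul]
  rw [Complex.ofReal_add, mul_add, Complex.exp_add]
  have e1 : (fun _ => (shift α - z) j : Fin 1 → ℝ) =
      shift (fun _ : Fin 1 => α j) - fun _ => z j := rfl
  have e2 : j.removeNth (shift α - z) = shift (j.removeNth α) - j.removeNth z := rfl
  rw [e1, e2]
  simp only [Fin.insertNthEquiv_symm_apply]
  ring

theorem norm_le_insert {m : ℕ} (j : Fin (m + 1)) (α : Fin (m + 1) → ℂ) :
    1 + ‖α‖ ≤ (1 + ‖j.removeNth α‖) * (1 + ‖α j‖) := by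
  have h : ‖α‖ ≤ max ‖α j‖ ‖j.removeNth α‖ := by
    refine (pi_norm_le_iff_of_nonneg (le_max_of_le_left (norm_nonneg _))).2 fun i => ?_
    rcases Fin.eq_self_or_eq_succAbove j i with rfl | ⟨k, rfl⟩
    · exact le_max_left _ _
    · exact le_max_of_le_right (norm_le_pi_norm (j.removeNth α) k)
  have h1 := norm_nonneg (α j)
  have h2 := norm_nonneg (j.removeNth α)
  rcases le_max_iff.1 h with h | h <;> nlinarith [mul_nonneg h1 h2]

theorem measurable_removeNth {m : ℕ} (j : Fin (m + 1)) :
    Measurable fun α : Fin (m + 1) → ℂ => j.removeNth α :=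
  measurable_pi_lambda _ fun i => measurable_pi_apply (j.succAbove i)

theorem continuous_one_add_norm_rpow {E : Type*} [NormedAddCommGroup E] (n : ℝ) :
    Continuous fun x : E => (1 + ‖x‖) ^ n :=
  Continuous.rpow_const (by fun_prop) fun x => Or.inl (by positivity)

/-- The Wigner function of a product with the vacuum factorises, so the new measure is the old one
weighted by a Gaussian in the ancillary coordinate, with that coordinate then forgotten. The
Gaussian absorbs polynomial growth in that direction. -/
theorem hasNonnegWigner_ancilla {m : ℕ} (j : Fin (m + 1)) {E : L2 (m + 1) →L[ℂ] L2 (m + 1)}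
    {E' : L2 m →L[ℂ] L2 m} (hE : HasNonnegWigner E)
    (hE' : ∀ ψ, ⟪ψ, E' ψ⟫_ℂ = ⟪addVacuum j ψ, E (addVacuum j ψ)⟫_ℂ) : HasNonnegWigner E' := by
  obtain ⟨μ, hμ, h⟩ := hE
  -- The factor `2` is `π` times the prefactor `2/π` of the extra mode.
  set w : (Fin (m + 1) → ℂ) → ℝ≥0∞ := fun α => ENNReal.ofReal (2 * Real.exp (-2 * ‖α j‖ ^ 2))
    with hw
  have hwm : Measurable w := by
    refine ENNReal.measurable_ofReal.comp (Continuous.measurable ?_)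
    fun_prop
  have hwt : ∀ᵐ α ∂μ, w α < ∞ := Eventually.of_forall fun α => ENNReal.ofReal_lt_top
  have hwr : ∀ α, (w α).toReal = 2 * Real.exp (-2 * ‖α j‖ ^ 2) := fun α =>
    ENNReal.toReal_ofReal (by positivity)
  refine ⟨(μ.withDensity w).map fun α => j.removeNth α, ?_, fun ψ => ?_⟩
  · obtain ⟨n, hn⟩ := hμ.exists_integrable
    refine ⟨n, ?_⟩
    rw [integrable_map_measure (continuous_one_add_norm_rpow _).aestronglyMeasurable
      (measurable_removeNth j).aemeasurable,
      integrable_withDensity_iff_integrable_smul' hwm hwt]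
    obtain ⟨C, hC⟩ := bounded_pow_mul_gauss n
    refine (hn.const_mul (2 * C)).mono' ?_ (Eventually.of_forall fun α => ?_)
    · refine (Measurable.smul hwm.ennreal_toReal ?_).aestronglyMeasurable
      exact (continuous_one_add_norm_rpow _).measurable.comp (measurable_removeNth j)
    · simp only [hwr, Function.comp_apply, smul_eq_mul]
      rw [Real.norm_of_nonneg (by positivity), Real.rpow_neg (by positivity),
        Real.rpow_neg (by positivity), Real.rpow_natCast, Real.rpow_natCast, ← div_eq_mul_inv,
        ← div_eq_mul_inv, div_le_div_iff₀ (by positivity) (by positivity)]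
      have h1 := hC ‖α j‖ (norm_nonneg _)
      have h2 : Real.exp (-2 * ‖α j‖ ^ 2) ≤ Real.exp (-‖α j‖ ^ 2 / 2) :=
        Real.exp_le_exp.2 (by nlinarith [sq_nonneg ‖α j‖])
      calc 2 * Real.exp (-2 * ‖α j‖ ^ 2) * (1 + ‖α‖) ^ n
          ≤ 2 * Real.exp (-‖α j‖ ^ 2 / 2) * ((1 + ‖j.removeNth α‖) * (1 + ‖α j‖)) ^ n := by
            gcongr
            exact norm_le_insert j α
        _ = 2 * ((1 + ‖α j‖) ^ n * Real.exp (-‖α j‖ ^ 2 / 2)) * (1 + ‖j.removeNth α‖) ^ n := by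
            rw [mul_pow]; ring
        _ ≤ _ := by gcongr
  · have hwc : ∀ ψ : Schw m, Continuous (wigner ψ) := fun ψ => by
      rw [funext (wigner_eq ψ)]
      exact continuous_const.mul (continuous_phaseElem ψ ψ)
    rw [hE', addVacuum_vec, h, integral_map (measurable_removeNth j).aemeasurable
      (hwc ψ).aestronglyMeasurable, integral_withDensity_eq_integral_toReal_smul hwm hwt,
      ← integral_const_mul, ← integral_const_mul]
    congr 1; ext α
    simp only [wigner_eq, hwr]
    change _ * (_ * phaseElem _ _ α) = _ * (_ • (_ * phaseElem _ _ _))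
    rw [phaseElem_vacTensor, Complex.real_smul]
    have hpi : (Real.pi : ℂ) ≠ 0 := by exact_mod_cast Real.pi_ne_zero
    push_cast
    rw [pow_succ, pow_succ]
    field_simp

/-! ## Measurability of families of measures via characteristic functions -/

section CharFun

variable {Ω V : Type*} [MeasurableSpace Ω] [NormedAddCommGroup V] [InnerProductSpace ℝ V]
  [FiniteDimensional ℝ V] [MeasurableSpace V] [BorelSpace V]

/-- Fourier inversion and Fubini write the integral of `g` as the integral of its transform against
the characteristic function, which is jointly measurable, being continuous in the frequency and
measurable in the parameter. -/
theorem measurable_integral_schwartz {ν : Ω → Measure V} [∀ x, IsFiniteMeasure (ν x)]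
    (h : ∀ w, Measurable fun x => charFun (ν x) w) (g : 𝓢(V, ℂ)) :
    Measurable fun x => ∫ v, g v ∂(ν x) := by
  have hG := (FourierTransform.fourier g).integrable (μ := (volume : Measure V))
  set G : 𝓢(V, ℂ) := FourierTransform.fourier g with hGdef
  have h1 : ∀ v, g v = ∫ w, Complex.exp ((2 * Real.pi * ⟪w, v⟫_ℝ : ℝ) * Complex.I) * G w := by
    intro v
    have h2 : (FourierTransformInv.fourierInv G : 𝓢(V, ℂ)) = g :=
      FourierTransform.fourierInv_fourier_eq g
    have h3 := congrArg (fun u : 𝓢(V, ℂ) => u v) h2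
    simp only [SchwartzMap.fourierInv_coe, Real.fourierInv_eq'] at h3
    rw [← h3]
    simp
  have h2 : ∀ x, ∫ v, g v ∂(ν x) =
      ∫ w, G w * charFun (ν x) ((2 * Real.pi) • w) := by
    intro x
    simp_rw [h1]
    rw [integral_integral_swap]
    · congr 1; ext w
      rw [integral_mul_const, mul_comm, charFun_apply]
      congr 2
      ext v
      rw [inner_smul_right, real_inner_comm]
    · have h3 : Integrable (fun p : V × V => G p.2) ((ν x).prod volume) := hG.comp_snd _
      refine h3.norm.mono' ?_ (Eventually.of_forall fun p => ?_)
      · refine Continuous.aestronglyMeasurable ?_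
        have := G.continuous
        fun_prop
      · simp [Function.uncurry, Complex.norm_exp]
  simp_rw [h2]
  have h3 : StronglyMeasurable (fun p : V × Ω => charFun (ν p.2) p.1) := by
    have := stronglyMeasurable_uncurry_of_continuous_of_stronglyMeasurable
      (u := fun (w : V) x => charFun (ν x) w) (fun x => ?_) (fun w => (h w).stronglyMeasurable)
    · exact this
    · have : Continuous fun w : V => ∫ v, Complex.exp (⟪v, w⟫_ℝ * Complex.I) ∂(ν x) := by
        refine continuous_of_dominated (bound := fun _ => 1) (fun w => ?_) (fun w => ?_)
          (integrable_const _) (Eventually.of_forall fun v => by fun_prop)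
        · exact Continuous.aestronglyMeasurable (by fun_prop)
        · exact Eventually.of_forall fun v => by simp [Complex.norm_exp]
      simpa [funext fun w => charFun_apply (μ := ν x) w] using this
  have h4 : StronglyMeasurable
      (fun p : Ω × V => G p.2 * charFun (ν p.1) ((2 * Real.pi) • p.2)) := by
    refine (G.continuous.measurable.stronglyMeasurable.comp_measurable measurable_snd).mul ?_
    exact h3.comp_measurable (g := fun p : Ω × V => ((2 * Real.pi) • p.2, p.1)) (by fun_prop)
  exact h4.integral_prod_right.measurable

/-- Open sets form a generating π-system, and their indicators are bounded pointwise limits of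
smooth compactly supported functions, to which `measurable_integral_schwartz` applies. -/
theorem measurable_of_measurable_charFun {ν : Ω → Measure V} [∀ x, IsFiniteMeasure (ν x)]
    (h : ∀ w, Measurable fun x => charFun (ν x) w) : Measurable ν := by
  have hopen : ∀ U : Set V, IsOpen U → Measurable fun x => ν x U := by
    intro U hU
    obtain ⟨f, hf, hfs, hfr⟩ := hU.exists_contDiff_support_eq (n := ⊤)
    have hf0 : ∀ v, 0 ≤ f v := fun v => (hfr (Set.mem_range_self v)).1
    let b : ℕ → ContDiffBump (0 : V) := fun n =>
      ⟨n + 1, n + 2, by positivity, by linarith⟩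
    -- Since `f` is positive exactly on `U`, the transition factor tends to the indicator of `U`;
    -- the bump of growing radius supplies compact support.
    set r : ℕ → V → ℝ := fun n v => b n v * Real.smoothTransition (n * f v) with hr
    have hrs : ∀ n, ContDiff ℝ (⊤ : ℕ∞) (r n) := fun n =>
      (b n).contDiff.mul (Real.smoothTransition.contDiff.comp (contDiff_const.mul hfs))
    have hr0 : ∀ n v, ‖r n v‖ ≤ 1 := fun n v => by
      rw [Real.norm_of_nonneg (mul_nonneg (b n).nonneg (Real.smoothTransition.nonneg _))]
      exact mul_le_one₀ (b n).le_one (Real.smoothTransition.nonneg _)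
        (Real.smoothTransition.le_one _)
    set g : ℕ → V → ℂ := fun n v => (r n v : ℂ) with hg
    have hgs : ∀ n, HasCompactSupport (g n) := fun n =>
      ((b n).hasCompactSupport.mul_right).comp_left (g := ((↑) : ℝ → ℂ)) rfl
    have hgc : ∀ n, ContDiff ℝ (⊤ : ℕ∞) (g n) := fun n =>
      Complex.ofRealCLM.contDiff.comp (hrs n)
    have hm : ∀ n, Measurable fun x => ∫ v, g n v ∂(ν x) := fun n =>
      measurable_integral_schwartz h ((hgs n).toSchwartzMap (hgc n))
    have hlim : ∀ x, Tendsto (fun n => ∫ v, g n v ∂(ν x)) atTop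
        (𝓝 (((ν x).real U : ℝ) : ℂ)) := by
      intro x
      have h1 : (((ν x).real U : ℝ) : ℂ) = ∫ v, U.indicator (fun _ => (1 : ℂ)) v ∂(ν x) := by
        rw [integral_indicator hU.measurableSet]; simp
      rw [h1]
      refine tendsto_integral_of_dominated_convergence (fun _ => 1)
        (fun n => (hgc n).continuous.aestronglyMeasurable) (integrable_const _)
        (fun n => Eventually.of_forall fun v => ?_) (Eventually.of_forall fun v => ?_)
      · rw [hg, Complex.norm_real]; exact hr0 n v
      · have h2 : ∀ᶠ n : ℕ in atTop, b n v = 1 := by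
          obtain ⟨N, hN⟩ := exists_nat_ge ‖v‖
          filter_upwards [eventually_ge_atTop N] with n hn
          refine (b n).one_of_mem_closedBall ?_
          rw [mem_closedBall_zero_iff]
          have : (N : ℝ) ≤ n := by exact_mod_cast hn
          change ‖v‖ ≤ (n : ℝ) + 1
          linarith
        by_cases hv : v ∈ U
        · have hfv : 0 < f v := lt_of_le_of_ne (hf0 v) (Ne.symm (by
            rw [← hf] at hv; exact hv))
          have h3 : ∀ᶠ n : ℕ in atTop, Real.smoothTransition (n * f v) = 1 := by
            obtain ⟨N, hN⟩ := exists_nat_ge (1 / f v)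
            filter_upwards [eventually_ge_atTop N] with n hn
            refine Real.smoothTransition.one_of_one_le ?_
            have : (N : ℝ) ≤ n := by exact_mod_cast hn
            rw [div_le_iff₀ hfv] at hN
            nlinarith
          refine tendsto_const_nhds.congr' ?_
          filter_upwards [h2, h3] with n h2 h3
          simp [hg, hr, h2, h3, hv]
        · have hfv : f v = 0 := by
            rw [← hf] at hv; simpa using hv
          refine tendsto_const_nhds.congr' (Eventually.of_forall fun n => ?_)
          simp [hg, hr, hfv, hv]
    have h3 := (measurable_of_tendsto_metrizable hm (tendsto_pi_nhds.2 hlim))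
    have h4 : Measurable fun x => ENNReal.ofReal (((ν x).real U : ℝ) : ℂ).re :=
      ENNReal.measurable_ofReal.comp (Complex.measurable_re.comp h3)
    simpa [Measure.real] using h4
  refine Measurable.measure_of_isPiSystem (S := {U : Set V | IsOpen U}) ?_ isPiSystem_isOpen
    hopen (hopen _ isOpen_univ)
  exact BorelSpace.measurable_eq

end CharFun

/-! ## Gaussian bounds for Wigner measures -/

/-- The Gaussian `exp(-2 |α - β|²)` on phase space. -/
def phaseGauss {m : ℕ} (α β : Fin m → ℂ) : ℝ := Real.exp (-2 * ∑ j, ‖α j - β j‖ ^ 2)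

theorem continuous_phaseGauss (m : ℕ) :
    Continuous fun p : (Fin m → ℂ) × (Fin m → ℂ) => phaseGauss p.1 p.2 := by
  unfold phaseGauss; fun_prop

theorem phaseGauss_pos {m : ℕ} (α β : Fin m → ℂ) : 0 < phaseGauss α β := Real.exp_pos _

theorem continuous_phaseGauss_zero (m : ℕ) : Continuous fun α : Fin m → ℂ => phaseGauss α 0 := by
  unfold phaseGauss; fun_prop

/-- A polynomial weight integrable for Lebesgue measure is dominated by a multiple of its own
Gaussian average; Fubini then moves the average onto `μ`, where it is uniformly bounded. -/
theorem hasTemperateGrowth_of_lintegral_phaseGauss {m : ℕ} (μ : Measure (Fin m → ℂ)) [SFinite μ]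
    {C : ℝ≥0∞} (hC : C ≠ ∞) (h : ∀ β, ∫⁻ α, ENNReal.ofReal (phaseGauss α β) ∂μ ≤ C) :
    μ.HasTemperateGrowth := by
  obtain ⟨n, hn⟩ := (inferInstance :
    (volume : Measure (Fin m → ℂ)).HasTemperateGrowth).exists_integrable
  refine ⟨n, ?_⟩
  set w : (Fin m → ℂ) → ℝ := fun x => (1 + ‖x‖) ^ (-(n : ℝ)) with hw
  have hw0 : ∀ x, 0 ≤ w x := fun x => by positivity
  have hwc : Continuous w := continuous_one_add_norm_rpow _
  -- On the unit ball about `α` the Gaussian is at least `exp(-2m)` and the weight drops by a factor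
  -- of at most `2ⁿ`.
  set c : ℝ≥0∞ := ENNReal.ofReal (2 ^ (-(n : ℝ)) * Real.exp (-2 * m)) *
    volume (Metric.ball (0 : Fin m → ℂ) 1) with hc
  have hc0 : c ≠ 0 := by
    refine mul_ne_zero ?_ (Metric.measure_ball_pos volume _ one_pos).ne'
    rw [Ne, ENNReal.ofReal_eq_zero, not_le]; positivity
  have hlow : ∀ α, c * ENNReal.ofReal (w α) ≤
      ∫⁻ β, ENNReal.ofReal (w β) * ENNReal.ofReal (phaseGauss α β) ∂volume := by
    intro α
    calc c * ENNReal.ofReal (w α) = ∫⁻ _ in Metric.ball α 1,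
          ENNReal.ofReal (2 ^ (-(n : ℝ)) * Real.exp (-2 * m)) * ENNReal.ofReal (w α) := by
          rw [lintegral_const, Measure.restrict_apply_univ, hc,
            Measure.addHaar_ball_center volume α]
          ring
      _ ≤ ∫⁻ β in Metric.ball α 1, ENNReal.ofReal (w β) * ENNReal.ofReal (phaseGauss α β) := by
          refine setLIntegral_mono' measurableSet_ball fun β hβ => ?_
          rw [← ENNReal.ofReal_mul (by positivity), ← ENNReal.ofReal_mul (hw0 β)]
          refine ENNReal.ofReal_le_ofReal ?_
          have hd : ‖α - β‖ < 1 := by rwa [Metric.mem_ball, dist_comm, dist_eq_norm] at hβ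
          have h1 : Real.exp (-2 * m) ≤ phaseGauss α β := by
            refine Real.exp_le_exp.2 ?_
            have : ∑ j, ‖α j - β j‖ ^ 2 ≤ ∑ _j : Fin m, (1 : ℝ) := by
              refine Finset.sum_le_sum fun j _ => pow_le_one₀ (norm_nonneg _) ?_
              exact (norm_le_pi_norm (α - β) j).trans hd.le
            simp at this
            linarith
          have h2 : 2 ^ (-(n : ℝ)) * w α ≤ w β := by
            rw [hw, ← Real.mul_rpow (by norm_num) (by positivity)]
            refine Real.rpow_le_rpow_of_nonpos (by positivity) ?_ (by simp)
            have : ‖β‖ ≤ ‖α‖ + ‖α - β‖ := by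
              have := norm_sub_le α (α - β)
              rwa [sub_sub_cancel] at this
            linarith [norm_nonneg α]
          calc _ = 2 ^ (-(n : ℝ)) * w α * Real.exp (-2 * m) := by ring
            _ ≤ w β * phaseGauss α β := mul_le_mul h2 h1 (by positivity) (hw0 β)
      _ ≤ _ := setLIntegral_le_lintegral _ _
  have htot : ∫⁻ α, c * ENNReal.ofReal (w α) ∂μ ≤ C * ∫⁻ β, ENNReal.ofReal (w β) := by
    calc ∫⁻ α, c * ENNReal.ofReal (w α) ∂μ
        ≤ ∫⁻ α, (∫⁻ β, ENNReal.ofReal (w β) * ENNReal.ofReal (phaseGauss α β)) ∂μ :=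
          lintegral_mono hlow
      _ = ∫⁻ β, (∫⁻ α, ENNReal.ofReal (w β) * ENNReal.ofReal (phaseGauss α β) ∂μ) := by
          refine lintegral_lintegral_swap (Measurable.aemeasurable ?_)
          refine (ENNReal.measurable_ofReal.comp (hwc.measurable.comp measurable_snd)).mul ?_
          exact ENNReal.measurable_ofReal.comp (continuous_phaseGauss m).measurable
      _ ≤ ∫⁻ β, ENNReal.ofReal (w β) * C := by
          refine lintegral_mono fun β => ?_
          rw [lintegral_const_mul' _ _ ENNReal.ofReal_ne_top]
          gcongr
          exact h β
      _ = _ := by rw [lintegral_mul_const' _ _ hC, mul_comm]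
  refine ⟨hwc.aestronglyMeasurable, ?_⟩
  rw [hasFiniteIntegral_iff_ofReal (Eventually.of_forall hw0)]
  have hfin : ∫⁻ β, ENNReal.ofReal (w β) < ∞ := by
    have := hn.2
    rwa [hasFiniteIntegral_iff_ofReal (Eventually.of_forall hw0)] at this
  rw [lintegral_const_mul _ hwc.measurable.ennreal_ofReal] at htot
  have h3 := htot.trans_lt (ENNReal.mul_lt_top hC.lt_top hfin)
  exact lt_top_iff_ne_top.2 fun h4 => by
    rw [h4, ENNReal.mul_top hc0] at h3
    exact lt_irrefl _ h3

theorem integral_wigner {m : ℕ} (ψ : Schw m) (μ : Measure (Fin m → ℂ)) :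
    (Real.pi ^ m : ℝ) * ∫ α, wigner ψ α ∂μ = 2 ^ m * ∫ α, phaseElem ψ ψ α ∂μ := by
  have : ∀ α, wigner ψ α = ((2 / Real.pi) ^ m : ℝ) * phaseElem ψ ψ α := wigner_eq ψ
  simp_rw [this]
  rw [integral_const_mul, ← mul_assoc, ← Complex.ofReal_mul, ← mul_pow,
    mul_div_cancel₀ _ Real.pi_ne_zero]
  simp

/-- The integral is `2⁻ᵐ` times the expectation of `E` in a coherent state. The cruder bound `1`,
uniform in the centre, suffices. -/
theorem lintegral_phaseGauss_le {m : ℕ} {E : L2 m →L[ℂ] L2 m} {μ : Measure (Fin m → ℂ)}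
    [μ.HasTemperateGrowth] (hE : ∀ φ, ‖⟪φ, E φ⟫_ℂ‖ ≤ ‖φ‖ ^ 2)
    (h : ∀ ψ : Schw m, ⟪ψ.vec, E ψ.vec⟫_ℂ = 2 ^ m * ∫ α, phaseElem ψ ψ α ∂μ)
    (β : Fin m → ℂ) : ∫⁻ α, ENNReal.ofReal (phaseGauss α β) ∂μ ≤ 1 := by
  have h1 : ∀ α, phaseElem (coherent β) (coherent β) α = (phaseGauss α β : ℝ) :=
    phaseElem_coherent β
  have hint : Integrable (fun α => phaseGauss α β) μ := by
    have := (integrable_phaseElem (coherent β) (coherent β) μ).re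
    simpa [h1] using this
  have h2 := hE (coherent β).vec
  rw [h, norm_coherent] at h2
  simp_rw [h1] at h2
  rw [integral_complex_ofReal, norm_mul, Complex.norm_real, Real.norm_of_nonneg
    (integral_nonneg fun α => (phaseGauss_pos _ _).le), norm_pow, Complex.norm_ofNat, one_pow] at h2
  rw [← ofReal_integral_eq_lintegral_ofReal hint (Eventually.of_forall fun α => (phaseGauss_pos _ _).le)]
  have h3 : (1 : ℝ) ≤ 2 ^ m := one_le_pow₀ (by norm_num)
  have h4 : 0 ≤ ∫ α, phaseGauss α β ∂μ := integral_nonneg fun α => (phaseGauss_pos _ _).le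
  refine ENNReal.ofReal_le_one.2 ?_
  nlinarith

/-- The data of a `WignerFamily` concern only diagonal elements, whereas plane waves come from
off-diagonal ones. -/
theorem phaseElem_polarization {m : ℕ} (ψ φ : Schw m) (α : Fin m → ℂ) :
    phaseElem ψ φ α = 1 / 4 * (phaseElem (ψ + φ) (ψ + φ) α - phaseElem (ψ - φ) (ψ - φ) α
      - Complex.I * phaseElem (ψ + Complex.I • φ) (ψ + Complex.I • φ) α
      + Complex.I * phaseElem (ψ - Complex.I • φ) (ψ - Complex.I • φ) α) := by
  simp only [phaseElem, map_add, map_sub, map_smul, vec_add, vec_sub, vec_smul, inner_add_left,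
    inner_add_right, inner_sub_left, inner_sub_right, inner_smul_left, inner_smul_right,
    Complex.conj_I]
  linear_combination (⟪ψ.vec, (phasePoint α φ).vec⟫_ℂ / 2 - ⟪φ.vec, (phasePoint α ψ).vec⟫_ℂ / 2) *
    Complex.I_sq

/-- A family of Wigner measures depending measurably on a parameter in the weak sense. -/
structure WignerFamily {m : ℕ} {Ω : Type*} [MeasurableSpace Ω] (G : Ω → L2 m →L[ℂ] L2 m)
    (μ : Ω → Measure (Fin m → ℂ)) : Prop where
  temperate : ∀ x, (μ x).HasTemperateGrowth
  bound : ∀ x φ, ‖⟪φ, G x φ⟫_ℂ‖ ≤ ‖φ‖ ^ 2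
  measurable : ∀ φ, Measurable fun x => ⟪φ, G x φ⟫_ℂ
  eq : ∀ x, ∀ ψ : Schw m, ⟪ψ.vec, G x ψ.vec⟫_ℂ = 2 ^ m * ∫ α, phaseElem ψ ψ α ∂(μ x)

namespace WignerFamily

variable {m : ℕ} {Ω : Type*} [MeasurableSpace Ω] {G : Ω → L2 m →L[ℂ] L2 m}
  {μ : Ω → Measure (Fin m → ℂ)}

theorem measurable_integral_phaseElem (h : WignerFamily G μ) (ψ φ : Schw m) :
    Measurable fun x => ∫ α, phaseElem ψ φ α ∂(μ x) := by
  have hq : ∀ ψ : Schw m, Measurable fun x => ∫ α, phaseElem ψ ψ α ∂(μ x) := fun ψ => by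
    have h1 := (h.measurable ψ.vec).const_mul ((2 ^ m : ℂ)⁻¹)
    have h2 : ∀ x, (2 ^ m : ℂ)⁻¹ * ⟪ψ.vec, G x ψ.vec⟫_ℂ = ∫ α, phaseElem ψ ψ α ∂(μ x) := fun x => by
      rw [h.eq, inv_mul_cancel_left₀ (pow_ne_zero _ two_ne_zero)]
    simpa [h2] using h1
  have h3 : ∀ x, ∫ α, phaseElem ψ φ α ∂(μ x) =
      1 / 4 * (∫ α, phaseElem (ψ + φ) (ψ + φ) α ∂(μ x) - ∫ α, phaseElem (ψ - φ) (ψ - φ) α ∂(μ x)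
      - Complex.I * ∫ α, phaseElem (ψ + Complex.I • φ) (ψ + Complex.I • φ) α ∂(μ x)
      + Complex.I * ∫ α, phaseElem (ψ - Complex.I • φ) (ψ - Complex.I • φ) α ∂(μ x)) := by
    intro x
    have := h.temperate x
    have hi := fun ψ : Schw m => integrable_phaseElem ψ ψ (μ x)
    rw [integral_congr_ae (Eventually.of_forall (phaseElem_polarization ψ φ)), integral_const_mul,
      integral_add, integral_sub, integral_sub (hi _) (hi _), integral_const_mul,
      integral_const_mul]
    · exact (hi _).sub (hi _)
    · exact (hi _).const_mul _
    · exact ((hi _).sub (hi _)).sub ((hi _).const_mul _)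
    · exact (hi _).const_mul _
  simp_rw [h3]
  exact ((((hq _).sub (hq _)).sub ((hq _).const_mul _)).add ((hq _).const_mul _)).const_mul _

/-- The finite measures `exp(-2|α|²) μ x`. -/
def damped (μ : Ω → Measure (Fin m → ℂ)) (x : Ω) : Measure (Fin m → ℂ) :=
  (μ x).withDensity fun α => ENNReal.ofReal (phaseGauss α 0)

theorem measurable_ofReal_phaseGauss :
    Measurable fun α : Fin m → ℂ => ENNReal.ofReal (phaseGauss α 0) :=
  (continuous_phaseGauss_zero m).measurable.ennreal_ofReal

theorem damped_univ_le (h : WignerFamily G μ) (x : Ω) : damped μ x Set.univ ≤ 1 := by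
  have := h.temperate x
  rw [damped, withDensity_apply _ MeasurableSet.univ, Measure.restrict_univ]
  exact lintegral_phaseGauss_le (h.bound x) (h.eq x) 0

/-- The measures are not assumed to depend measurably on the parameter; this is deduced from their
characteristic functions, which after Gaussian damping are integrals of off-diagonal matrix
elements. -/
theorem measurable_damped (h : WignerFamily G μ) : Measurable (damped μ) := by
  -- Characteristic functions need an inner product, whereas the product space carries the sup norm.
  let e := (MeasurableEquiv.toLp 2 (Fin m → ℂ))
  have hfin : ∀ x, IsFiniteMeasure ((damped μ x).map e) := fun x =>
    ⟨by rw [Measure.map_apply e.measurable MeasurableSet.univ]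
        exact (damped_univ_le h x).trans_lt ENNReal.one_lt_top⟩
  have h1 : Measurable fun x => (damped μ x).map e := by
    refine measurable_of_measurable_charFun (V := PiLp 2 fun _ : Fin m => ℂ) fun w => ?_
    -- The choice `γ = -i w / 8` turns the phase `8 ∑ (Re γ Im α - Im γ Re α)` into the real inner
    -- product of `α` and `w`.
    have h2 : ∀ x, charFun ((damped μ x).map e) w = ∫ α,
        phaseElem (phasePoint (fun j => -Complex.I * w j / 8) (vacuum m))
          (phasePoint (-fun j => -Complex.I * w j / 8) (vacuum m)) α ∂(μ x) := by
      intro x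
      rw [charFun_apply, integral_map e.measurable.aemeasurable, damped,
        integral_withDensity_eq_integral_toReal_smul measurable_ofReal_phaseGauss
          (Eventually.of_forall fun α => ENNReal.ofReal_lt_top)]
      · congr 1; ext α
        rw [phaseElem_opposite_vacuum, ENNReal.toReal_ofReal (phaseGauss_pos _ _).le,
          Complex.real_smul, mul_comm]
        congr 1
        · congr 3
          rw [PiLp.inner_apply, Finset.mul_sum]
          refine Finset.sum_congr rfl fun j _ => ?_
          have : e α j = α j := rfl
          rw [this, Complex.inner]
          simp
          ring
        · simp [phaseGauss]
      · refine Continuous.aestronglyMeasurable ?_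
        fun_prop
    simp_rw [h2]
    exact h.measurable_integral_phaseElem _ _
  have h3 : damped μ = fun x => ((damped μ x).map e).map e.symm := by
    ext1 x
    rw [Measure.map_map e.symm.measurable e.measurable, e.symm_comp_self, Measure.map_id]
  rw [h3]
  exact (Measure.measurable_map e.symm e.symm.measurable).comp h1

/-- The finite kernel `x ↦ damped μ x`. -/
def dampedKernel (h : WignerFamily G μ) : ProbabilityTheory.Kernel Ω (Fin m → ℂ) :=
  ⟨damped μ, h.measurable_damped⟩

instance (h : WignerFamily G μ) : ProbabilityTheory.IsFiniteKernel h.dampedKernel :=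
  ⟨1, ENNReal.one_lt_top, h.damped_univ_le⟩

/-- The transition kernel `x ↦ μ x`. -/
def kernel (h : WignerFamily G μ) : ProbabilityTheory.Kernel Ω (Fin m → ℂ) :=
  h.dampedKernel.withDensity fun _ α => ((Real.toNNReal (phaseGauss α 0)⁻¹ : NNReal) : ℝ≥0∞)

instance (h : WignerFamily G μ) : ProbabilityTheory.IsSFiniteKernel h.kernel := by
  unfold kernel
  infer_instance

/-- The two densities are mutually inverse. The detour through the finite damped measures is what
makes the possibly infinite family an s-finite kernel. -/
theorem kernel_apply (h : WignerFamily G μ) (x : Ω) : h.kernel x = μ x := by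
  have hc : Continuous fun α : Fin m → ℂ => (phaseGauss α 0)⁻¹ :=
    (continuous_phaseGauss_zero m).inv₀ fun α => (phaseGauss_pos _ _).ne'
  have hm : Measurable fun α : Fin m → ℂ =>
      ((Real.toNNReal (phaseGauss α 0)⁻¹ : NNReal) : ℝ≥0∞) :=
    measurable_coe_nnreal_ennreal.comp (measurable_real_toNNReal.comp hc.measurable)
  have hm' : Measurable (Function.uncurry fun (_ : Ω) (α : Fin m → ℂ) =>
      ((Real.toNNReal (phaseGauss α 0)⁻¹ : NNReal) : ℝ≥0∞)) := hm.comp measurable_snd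
  rw [kernel, ProbabilityTheory.Kernel.withDensity_apply _ hm']
  change (damped μ x).withDensity _ = _
  rw [damped, ← withDensity_mul _ measurable_ofReal_phaseGauss hm]
  convert withDensity_one using 2
  ext α
  change ENNReal.ofReal _ * ENNReal.ofReal _ = 1
  rw [← ENNReal.ofReal_mul (phaseGauss_pos _ _).le, mul_inv_cancel₀ (phaseGauss_pos _ _).ne',
    ENNReal.ofReal_one]

end WignerFamily

/-! ## Homodyne measurements -/

theorem insertNth_eq_add {m : ℕ} (j : Fin (m + 1)) (x : ℝ) (y : Fin m → ℝ) :
    (j.insertNth x y : Fin (m + 1) → ℝ) = j.insertNth (0 : ℝ) y + Pi.single j x := by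
  ext i
  rcases Fin.eq_self_or_eq_succAbove j i with rfl | ⟨k, rfl⟩ <;> simp

/-- The linear embedding `y ↦ (0, y)`. -/
def insertCLM {m : ℕ} (j : Fin (m + 1)) : (Fin m → ℝ) →L[ℝ] (Fin (m + 1) → ℝ) :=
  LinearMap.toContinuousLinearMap
    { toFun := fun y => j.insertNth (0 : ℝ) y
      map_add' := fun y z => by
        ext i
        rcases Fin.eq_self_or_eq_succAbove j i with rfl | ⟨k, rfl⟩ <;> simp
      map_smul' := fun c y => by
        ext i
        rcases Fin.eq_self_or_eq_succAbove j i with rfl | ⟨k, rfl⟩ <;> simp }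

theorem hasTemperateGrowth_insertNth {m : ℕ} (j : Fin (m + 1)) (x : ℝ) :
    Function.HasTemperateGrowth fun y : Fin m → ℝ => (j.insertNth x y : Fin (m + 1) → ℝ) := by
  rw [funext (insertNth_eq_add j x)]
  exact (insertCLM j).hasTemperateGrowth.add (Function.HasTemperateGrowth.const _)

theorem norm_le_norm_insertNth {m : ℕ} (j : Fin (m + 1)) (x : ℝ) (y : Fin m → ℝ) :
    ‖y‖ ≤ ‖(j.insertNth x y : Fin (m + 1) → ℝ)‖ := by
  refine (pi_norm_le_iff_of_nonneg (norm_nonneg _)).2 fun i => ?_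
  simpa using norm_le_pi_norm (j.insertNth x y : Fin (m + 1) → ℝ) (j.succAbove i)

/-- The restriction of a Schwartz function to the hyperplane `x_j = x`. -/
def sliceSchw {m : ℕ} (j : Fin (m + 1)) (ψ : Schw (m + 1)) (x : ℝ) : Schw m :=
  SchwartzMap.compCLM ℂ (hasTemperateGrowth_insertNth j x)
    ⟨1, 1, fun y => by
      rw [pow_one, one_mul]
      exact (norm_le_norm_insertNth j x y).trans (by linarith)⟩ ψ

theorem sliceSchw_apply {m : ℕ} (j : Fin (m + 1)) (ψ : Schw (m + 1)) (x : ℝ) (y : Fin m → ℝ) :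
    sliceSchw j ψ x y = ψ (j.insertNth x y) := rfl

theorem insertNth_measurePreserving {m : ℕ} (j : Fin (m + 1)) :
    MeasurePreserving (MeasurableEquiv.piFinSuccAbove (fun _ : Fin (m + 1) => ℝ) j).symm
      (volume.prod volume) volume :=
  (volume_preserving_piFinSuccAbove (fun _ : Fin (m + 1) => ℝ) j).symm

/-- `slice` depends on a representative, so by Fubini it agrees with honest restriction only for
almost every outcome; this is enough under the outcome integral. -/
theorem slice_vec {m : ℕ} (j : Fin (m + 1)) (ψ : Schw (m + 1)) :
    ∀ᵐ x : ℝ, slice j ψ.vec x = (sliceSchw j ψ x).vec := by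
  have h1 := (insertNth_measurePreserving j).quasiMeasurePreserving.ae (ψ.coeFn_toLp 2 volume)
  filter_upwards [Measure.ae_ae_of_ae_prod h1] with x hx
  have h2 : (fun y : Fin m → ℝ => ψ.vec (j.insertNth x y)) =ᵐ[volume] sliceSchw j ψ x := hx
  have h3 : MemLp (fun y : Fin m → ℝ => ψ.vec (j.insertNth x y)) 2 volume :=
    (memLp_congr_ae h2).2 ((sliceSchw j ψ x).memLp 2 volume)
  rw [slice, dif_pos h3]
  exact (MemLp.toLp_eq_toLp_iff _ _).2 h2

theorem integrable_insertNth {m : ℕ} (j : Fin (m + 1)) {f : (Fin (m + 1) → ℝ) → ℂ}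
    (hf : Integrable f) :
    Integrable (fun p : ℝ × (Fin m → ℝ) => f (j.insertNth p.1 p.2)) (volume.prod volume) :=
  (insertNth_measurePreserving j).integrable_comp_emb
    (MeasurableEquiv.measurableEmbedding _) |>.2 hf

theorem integral_insertNth {m : ℕ} (j : Fin (m + 1)) {f : (Fin (m + 1) → ℝ) → ℂ}
    (hf : Integrable f) : ∫ z, f z = ∫ x : ℝ, ∫ y : Fin m → ℝ, f (j.insertNth x y) := by
  rw [← integral_prod _ (integrable_insertNth j hf)]
  exact ((insertNth_measurePreserving j).integral_comp' f).symm

theorem phasePoint_insertNth {m : ℕ} (j : Fin (m + 1)) (ψ : Schw (m + 1)) (c : ℂ) (α : Fin m → ℂ)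
    (x : ℝ) (y : Fin m → ℝ) :
    phasePoint (j.insertNth c α) ψ (j.insertNth x y) =
      Complex.exp (Complex.I * (phaseAngle (fun _ : Fin 1 => c) (fun _ => x) : ℝ)) *
        phasePoint α (sliceSchw j ψ (Real.sqrt 2 * (2 * c).re - x)) y := by
  rw [phasePoint_apply, phasePoint_apply, sliceSchw_apply, phaseAngle_succAbove j]
  simp only [Fin.insertNth_apply_same, Fin.removeNth_insertNth]
  rw [Complex.ofReal_add, mul_add, Complex.exp_add, mul_assoc]
  congr 3
  ext i
  rcases Fin.eq_self_or_eq_succAbove j i with rfl | ⟨k, rfl⟩ <;> simp [shift]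

theorem phaseElem_insertNth {m : ℕ} (j : Fin (m + 1)) (ψ : Schw (m + 1)) (c : ℂ)
    (α : Fin m → ℂ) : phaseElem ψ ψ (j.insertNth c α) =
      ∫ x : ℝ, Complex.exp (Complex.I * (phaseAngle (fun _ : Fin 1 => c) (fun _ => x) : ℝ)) *
        phaseElem (sliceSchw j ψ x) (sliceSchw j ψ (Real.sqrt 2 * (2 * c).re - x)) α := by
  rw [phaseElem, inner_vec, integral_insertNth j (integrable_conj_mul _ _)]
  congr 1; ext x
  rw [phaseElem, inner_vec, ← integral_const_mul]
  congr 1; ext y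
  rw [phasePoint_insertNth, sliceSchw_apply]
  ring

theorem integrable_phaseElem_slice {m : ℕ} (j : Fin (m + 1)) (ψ : Schw (m + 1)) (c : ℂ)
    (α : Fin m → ℂ) : Integrable fun x : ℝ =>
      Complex.exp (Complex.I * (phaseAngle (fun _ : Fin 1 => c) (fun _ => x) : ℝ)) *
        phaseElem (sliceSchw j ψ x) (sliceSchw j ψ (Real.sqrt 2 * (2 * c).re - x)) α := by
  have h := (integrable_insertNth j
    (integrable_conj_mul ψ (phasePoint (j.insertNth c α) ψ))).integral_prod_left
  refine h.congr (Eventually.of_forall fun x => ?_)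
  simp only
  rw [phaseElem, inner_vec, ← integral_const_mul]
  congr 1; ext y
  rw [phasePoint_insertNth, sliceSchw_apply]
  ring

/-- Needed because Fourier inversion in `integral_phaseElem_momentum` is applied at a single point.
One slice is dominated by an integrable power of `1 + ‖y‖`, the other by its supremum. -/
theorem continuous_phaseElem_slice {m : ℕ} (j : Fin (m + 1)) (ψ : Schw (m + 1)) (a : ℝ)
    (α : Fin m → ℂ) : Continuous fun x : ℝ =>
      phaseElem (sliceSchw j ψ x) (sliceSchw j ψ (a - x)) α := by
  unfold phaseElem
  simp_rw [inner_vec]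
  obtain ⟨n, hn⟩ := (inferInstance :
    (volume : Measure (Fin m → ℝ)).HasTemperateGrowth).exists_integrable
  set C := 2 ^ n * (Finset.Iic (n, 0)).sup (fun m => SchwartzMap.seminorm ℝ m.1 m.2) ψ with hC
  have hdec : ∀ (x : ℝ) (y : Fin m → ℝ), ‖ψ (j.insertNth x y)‖ ≤ C * (1 + ‖y‖) ^ (-(n : ℝ)) := by
    intro x y
    have h1 := SchwartzMap.one_add_le_sup_seminorm_apply (𝕜 := ℝ) (m := (n, 0)) le_rfl le_rfl ψ
      (j.insertNth x y)
    rw [norm_iteratedFDeriv_zero] at h1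
    rw [Real.rpow_neg (by positivity), Real.rpow_natCast, ← div_eq_mul_inv,
      le_div_iff₀ (by positivity), mul_comm]
    refine le_trans ?_ h1
    gcongr
    exact norm_le_norm_insertNth j x y
  have hcont : Continuous fun p : ℝ × (Fin m → ℝ) => ψ (j.insertNth p.1 p.2) :=
    ψ.continuous.comp (Continuous.finInsertNth (A := fun _ => ℝ) j continuous_fst continuous_snd)
  refine continuous_of_dominated (bound := fun y => C * (1 + ‖y‖) ^ (-(n : ℝ)) *
    SchwartzMap.seminorm ℝ 0 0 ψ) (fun x => ?_) (fun x => Eventually.of_forall fun y => ?_)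
    ((hn.const_mul _).mul_const _) (Eventually.of_forall fun y => ?_)
  · exact (integrable_conj_mul _ _).1
  · rw [norm_mul, RCLike.norm_conj, norm_phasePoint_apply, sliceSchw_apply, sliceSchw_apply]
    exact mul_le_mul (hdec x y) (norm_le_seminorm _ _) (norm_nonneg _)
      ((norm_nonneg _).trans (hdec x y))
  · simp_rw [phasePoint_apply, sliceSchw_apply]
    refine (Complex.continuous_conj.comp (hcont.comp (by fun_prop : Continuous fun x : ℝ =>
      (x, y)))).mul (continuous_const.mul ?_)
    exact hcont.comp (by fun_prop : Continuous fun x : ℝ => (a - x, shift α - y))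

/-- The point `(q + i p)/√2` of phase space. -/
def phaseCoord (q p : ℝ) : ℂ := ((q / Real.sqrt 2 : ℝ) : ℂ) + ((p / Real.sqrt 2 : ℝ) : ℂ) * Complex.I

theorem phaseCoord_re (q p : ℝ) : (phaseCoord q p).re = q / Real.sqrt 2 := by simp [phaseCoord]

theorem phaseCoord_im (q p : ℝ) : (phaseCoord q p).im = p / Real.sqrt 2 := by simp [phaseCoord]

theorem continuous_phaseCoord : Continuous fun z : ℝ × ℝ => phaseCoord z.1 z.2 := by
  unfold phaseCoord; fun_prop

theorem integrable_phaseElem_momentum {m : ℕ} (j : Fin (m + 1)) (ψ : Schw (m + 1)) (q : ℝ)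
    (α : Fin m → ℂ) :
    Integrable fun p : ℝ => phaseElem ψ ψ (j.insertNth (phaseCoord q p) α) := by
  obtain ⟨C, hC0, hC⟩ := phaseElem_decay 2 ψ ψ
  have hcont : Continuous fun p : ℝ => phaseElem ψ ψ (j.insertNth (phaseCoord q p) α) :=
    (continuous_phaseElem ψ ψ).comp (Continuous.finInsertNth j (continuous_phaseCoord.comp
      (by fun_prop : Continuous fun p : ℝ => (q, p))) continuous_const)
  refine (integrable_inv_one_add_sq.const_mul (‖ψ.vec‖ * ‖ψ.vec‖ + 2 * C)).mono'
    hcont.aestronglyMeasurable (Eventually.of_forall fun p => ?_)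
  rw [← div_eq_mul_inv, le_div_iff₀ (by positivity)]
  have h1 := norm_phaseElem_le ψ ψ (j.insertNth (phaseCoord q p) α)
  have h2 := hC (j.insertNth (phaseCoord q p) α)
  have h3 : p ^ 2 ≤ 2 * ‖(j.insertNth (phaseCoord q p) α : Fin (m + 1) → ℂ)‖ ^ 2 := by
    have h4 := norm_le_pi_norm (j.insertNth (phaseCoord q p) α : Fin (m + 1) → ℂ) j
    rw [Fin.insertNth_apply_same] at h4
    have h5 := (Complex.abs_im_le_norm (phaseCoord q p)).trans h4
    rw [phaseCoord_im] at h5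
    have h6 : (p / Real.sqrt 2) ^ 2 ≤ ‖(j.insertNth (phaseCoord q p) α : Fin (m + 1) → ℂ)‖ ^ 2 := by
      rw [← sq_abs]; gcongr
    rw [div_pow, Real.sq_sqrt (by norm_num)] at h6
    linarith
  nlinarith [norm_nonneg (phaseElem ψ ψ (j.insertNth (phaseCoord q p) α))]

/-- The momentum marginal is the position density. As a function of `p` the matrix element is a
Fourier transform evaluated at `-p/π`, so its integral is `π` times the original function at the
origin. -/
theorem integral_phaseElem_momentum {m : ℕ} (j : Fin (m + 1)) (ψ : Schw (m + 1)) (q : ℝ)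
    (α : Fin m → ℂ) : ∫ p : ℝ, phaseElem ψ ψ (j.insertNth (phaseCoord q p) α) =
      Real.pi * phaseElem (sliceSchw j ψ q) (sliceSchw j ψ q) α := by
  -- Slices symmetric about `q`: the reflection exchanges `q + x` and `q - x`, and at `x = 0` both
  -- slices are at `q`.
  set k : ℝ → ℂ := fun x => phaseElem (sliceSchw j ψ (x + q)) (sliceSchw j ψ (q - x)) α with hk
  have hs : Real.sqrt 2 * (Real.sqrt 2) = 2 := Real.mul_self_sqrt (by norm_num)
  have hs0 : Real.sqrt 2 ≠ 0 := by positivity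
  have hq : ∀ p, Real.sqrt 2 * (2 * phaseCoord q p).re = 2 * q := fun p => by
    have : (2 * phaseCoord q p).re = 2 * (phaseCoord q p).re := by simp
    rw [this, phaseCoord_re]; field_simp
  have hph : ∀ p x, phaseAngle (fun _ : Fin 1 => phaseCoord q p) (fun _ => x) = 2 * p * (x - q) := by
    intro p x
    have h1 : (2 * phaseCoord q p).re = 2 * (phaseCoord q p).re := by simp
    have h2 : (2 * phaseCoord q p).im = 2 * (phaseCoord q p).im := by simp
    simp only [phaseAngle, Finset.univ_unique, Finset.sum_singleton, h1, h2, phaseCoord_re,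
      phaseCoord_im]
    field_simp
    rw [sq, hs]; ring
  have hF : ∀ p, phaseElem ψ ψ (j.insertNth (phaseCoord q p) α) =
      FourierTransform.fourier k (-p / Real.pi) := by
    intro p
    rw [phaseElem_insertNth, Real.fourier_eq']
    simp only [hq, hph]
    rw [← integral_add_right_eq_self _ q]
    congr 1; ext x
    rw [hk, smul_eq_mul]
    congr 2
    · simp only [add_sub_cancel_right, RCLike.inner_apply, conj_trivial]
      rw [mul_comm]
      congr 2
      field_simp
    · congr 1; ring
  have hkc : Continuous k := by
    have := (continuous_phaseElem_slice j ψ (2 * q) α).comp (continuous_add_const q)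
    refine this.congr fun x => ?_
    simp only [hk, Function.comp_apply]
    congr 2; ring
  have hki : Integrable k := by
    have := (integrable_phaseElem_slice j ψ (phaseCoord q 0) α).comp_add_right q
    refine this.congr (Eventually.of_forall fun x => ?_)
    simp only [hq, hph, hk]
    simp
    congr 2; ring
  have hi := integrable_phaseElem_momentum j ψ q α
  simp only [hF] at hi ⊢
  have hpi : -(Real.pi⁻¹) ≠ 0 := neg_ne_zero.2 (inv_ne_zero Real.pi_ne_zero)
  have hscale : ∀ p : ℝ, -p / Real.pi = -(Real.pi⁻¹) * p := fun p => by field_simp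
  simp only [hscale] at hi ⊢
  have hFi := (integrable_comp_mul_left_iff _ hpi).1 hi
  rw [Measure.integral_comp_mul_left]
  have hinv := hki.fourierInv_fourier_eq hFi (v := 0) hkc.continuousAt
  rw [Real.fourierInv_eq'] at hinv
  simp only [inner_zero_right, mul_zero, Complex.ofReal_zero, zero_mul, Complex.exp_zero,
    one_smul] at hinv
  rw [hinv, hk]
  simp [abs_of_pos Real.pi_pos]

theorem phaseGauss_insertNth {m : ℕ} (j : Fin (m + 1)) (q p : ℝ) (α : Fin m → ℂ)
    (β : Fin (m + 1) → ℂ) : phaseGauss (j.insertNth (phaseCoord q p) α) β =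
      Real.exp (-(q - Real.sqrt 2 * (β j).re) ^ 2) * phaseGauss α (j.removeNth β) *
        Real.exp (-(p - Real.sqrt 2 * (β j).im) ^ 2) := by
  have h1 : ‖phaseCoord q p - β j‖ ^ 2 =
      (q / Real.sqrt 2 - (β j).re) ^ 2 + (p / Real.sqrt 2 - (β j).im) ^ 2 := by
    rw [← Complex.normSq_eq_norm_sq, Complex.normSq_apply, Complex.sub_re, Complex.sub_im,
      phaseCoord_re, phaseCoord_im]
    ring
  have h2 : ∀ a b : ℝ, 2 * (a / Real.sqrt 2 - b) ^ 2 = (a - Real.sqrt 2 * b) ^ 2 := fun a b => by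
    have hs : Real.sqrt 2 ^ 2 = 2 := Real.sq_sqrt (by norm_num)
    have hs0 : Real.sqrt 2 ≠ 0 := by positivity
    have : a / Real.sqrt 2 - b = (a - Real.sqrt 2 * b) / Real.sqrt 2 := by field_simp
    rw [this, div_pow, hs]; ring
  rw [phaseGauss, phaseGauss, Fin.sum_univ_succAbove _ j, ← Real.exp_add, ← Real.exp_add]
  simp only [Fin.insertNth_apply_same, Fin.insertNth_apply_succAbove, h1, Fin.removeNth]
  congr 1
  linear_combination -h2 q (β j).re - h2 p (β j).im

theorem lintegral_gauss_sub (a : ℝ) :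
    ∫⁻ x : ℝ, ENNReal.ofReal (Real.exp (-(x - a) ^ 2)) =
      ∫⁻ x : ℝ, ENNReal.ofReal (Real.exp (-x ^ 2)) :=
  lintegral_sub_right_eq_self (fun x : ℝ => ENNReal.ofReal (Real.exp (-x ^ 2))) a

theorem lintegral_gauss_ne_top : ∫⁻ x : ℝ, ENNReal.ofReal (Real.exp (-x ^ 2)) ≠ ∞ := by
  have h : Integrable fun x : ℝ => Real.exp (-x ^ 2) := by
    simpa using integrable_exp_neg_mul_sq one_pos
  have := h.2
  rw [hasFiniteIntegral_iff_ofReal (Eventually.of_forall fun x => (Real.exp_pos _).le)] at this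
  exact this.ne

/-- A position measurement is uniform in momentum, so the Wigner measure is `dq ⊗ μ_q ⊗ dp` up to a
constant. Integrating out `p` reduces the matrix element to the slice at `q`. -/
theorem hasNonnegWigner_homodyne {m : ℕ} (j : Fin (m + 1)) {G : ℝ → L2 m →L[ℂ] L2 m}
    {μ : ℝ → Measure (Fin m → ℂ)} (h : WignerFamily G μ) {E : L2 (m + 1) →L[ℂ] L2 (m + 1)}
    (hE : ∀ ψ : Schw (m + 1), ⟪ψ.vec, E ψ.vec⟫_ℂ =
      ∫ x, ⟪(sliceSchw j ψ x).vec, G x (sliceSchw j ψ x).vec⟫_ℂ) : HasNonnegWigner E := by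
  set ν : Measure (ℝ × (Fin m → ℂ)) := (volume : Measure ℝ).compProd h.kernel with hν
  set T : (ℝ × (Fin m → ℂ)) × ℝ → Fin (m + 1) → ℂ :=
    fun z => j.insertNth (phaseCoord z.1.1 z.2) z.1.2 with hT
  have hTc : Continuous T := Continuous.finInsertNth (A := fun _ => ℂ) j
    (continuous_phaseCoord.comp (by fun_prop : Continuous fun z : (ℝ × (Fin m → ℂ)) × ℝ =>
      (z.1.1, z.2))) (by fun_prop)
  set M := (ν.prod (volume : Measure ℝ)).map T with hM
  -- Compensates the `π` from the momentum integral and the passage from `2ᵐ` to `2ᵐ⁺¹` for the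
  -- extra mode.
  set c : ℝ≥0∞ := ENNReal.ofReal (1 / (2 * Real.pi)) with hc
  set K := ∫⁻ x : ℝ, ENNReal.ofReal (Real.exp (-x ^ 2)) with hK
  -- The Gaussian factorises: `q` and `p` contribute `K` each, and the other modes at most `1` by
  -- `lintegral_phaseGauss_le`.
  have hbound : ∀ β, ∫⁻ α, ENNReal.ofReal (phaseGauss α β) ∂M ≤ K * K := by
    intro β
    have hm : Measurable fun α => ENNReal.ofReal (phaseGauss α β) :=
      ((continuous_phaseGauss (m + 1)).comp
        (Continuous.prodMk continuous_id continuous_const)).measurable.ennreal_ofReal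
    have hm' : Measurable fun z => ENNReal.ofReal (phaseGauss (T z) β) := hm.comp hTc.measurable
    rw [hM, lintegral_map hm hTc.measurable, lintegral_prod _ hm'.aemeasurable, hν,
      Measure.lintegral_compProd hm'.lintegral_prod_right']
    have h1 : ∀ (q : ℝ) (α : Fin m → ℂ), ∫⁻ p : ℝ, ENNReal.ofReal (phaseGauss (T ((q, α), p)) β) =
        ENNReal.ofReal (Real.exp (-(q - Real.sqrt 2 * (β j).re) ^ 2)) * K *
          ENNReal.ofReal (phaseGauss α (j.removeNth β)) := by
      intro q α
      have : ∀ p : ℝ, ENNReal.ofReal (phaseGauss (T ((q, α), p)) β) =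
          ENNReal.ofReal (Real.exp (-(q - Real.sqrt 2 * (β j).re) ^ 2)) *
            ENNReal.ofReal (phaseGauss α (j.removeNth β)) *
            ENNReal.ofReal (Real.exp (-(p - Real.sqrt 2 * (β j).im) ^ 2)) := fun p => by
        rw [hT, phaseGauss_insertNth, ENNReal.ofReal_mul
          (mul_nonneg (Real.exp_pos _).le (phaseGauss_pos _ _).le),
          ENNReal.ofReal_mul (Real.exp_pos _).le]
      simp_rw [this]
      rw [lintegral_const_mul' _ _ (ENNReal.mul_ne_top ENNReal.ofReal_ne_top
        ENNReal.ofReal_ne_top), lintegral_gauss_sub]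
      ring
    simp_rw [h1]
    calc _ ≤ ∫⁻ q : ℝ, ENNReal.ofReal (Real.exp (-(q - Real.sqrt 2 * (β j).re) ^ 2)) * K := by
          refine lintegral_mono fun q => ?_
          have := h.temperate q
          rw [lintegral_const_mul' _ _ (ENNReal.mul_ne_top ENNReal.ofReal_ne_top
            lintegral_gauss_ne_top), h.kernel_apply]
          exact mul_le_of_le_one_right' (lintegral_phaseGauss_le (h.bound q) (h.eq q) _)
      _ = K * K := by
          rw [lintegral_mul_const' _ _ lintegral_gauss_ne_top, lintegral_gauss_sub]
  have hKK : K * K ≠ ∞ := ENNReal.mul_ne_top lintegral_gauss_ne_top lintegral_gauss_ne_top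
  have hMt : M.HasTemperateGrowth := hasTemperateGrowth_of_lintegral_phaseGauss M hKK hbound
  have hcMt : (c • M).HasTemperateGrowth := by
    obtain ⟨n, hn⟩ := hMt.exists_integrable
    exact ⟨n, hn.smul_measure ENNReal.ofReal_ne_top⟩
  refine ⟨c • M, hcMt, fun ψ => ?_⟩
  have hi := integrable_phaseElem ψ ψ M
  have hi2 : Integrable (fun z => phaseElem ψ ψ (T z)) (ν.prod (volume : Measure ℝ)) :=
    (integrable_map_measure (continuous_phaseElem ψ ψ).aestronglyMeasurable
      hTc.measurable.aemeasurable).1 hi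
  have hmom : ∀ z : ℝ × (Fin m → ℂ), ∫ p : ℝ, phaseElem ψ ψ (T (z, p)) =
      Real.pi * phaseElem (sliceSchw j ψ z.1) (sliceSchw j ψ z.1) z.2 :=
    fun z => integral_phaseElem_momentum j ψ z.1 z.2
  have hi3 := hi2.integral_prod_left
  simp_rw [hmom] at hi3
  rw [integral_wigner, integral_smul_measure, hE, hM,
    integral_map hTc.measurable.aemeasurable (continuous_phaseElem ψ ψ).aestronglyMeasurable,
    integral_prod _ hi2]
  simp_rw [hmom]
  rw [hν, Measure.integral_compProd hi3, hc, ENNReal.toReal_ofReal (by positivity)]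
  simp_rw [integral_const_mul, h.kernel_apply, h.eq]
  rw [integral_const_mul, Complex.real_smul]
  have hpi : (Real.pi : ℂ) ≠ 0 := by exact_mod_cast Real.pi_ne_zero
  push_cast
  rw [pow_succ]
  field_simp

theorem integral_sliceSchw {m : ℕ} (j : Fin (m + 1)) (ψ : Schw (m + 1)) :
    ⟪ψ.vec, ψ.vec⟫_ℂ = ∫ x, ⟪(sliceSchw j ψ x).vec, (sliceSchw j ψ x).vec⟫_ℂ := by
  simp_rw [inner_vec]
  exact integral_insertNth j (integrable_conj_mul ψ ψ)

/-- Induction on the modes: homodyning one mode and ignoring all outcomes is the identity effect.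
With no modes, phase space is a point and the measure is a Dirac mass. -/
theorem hasNonnegWigner_one (m : ℕ) : HasNonnegWigner (1 : L2 m →L[ℂ] L2 m) := by
  induction m with
  | zero =>
    refine ⟨Measure.dirac 0, inferInstance, fun ψ => ?_⟩
    change ⟪ψ.vec, ψ.vec⟫_ℂ = _
    rw [integral_wigner, integral_dirac, phaseElem, inner_vec, inner_vec]
    simp only [pow_zero, one_mul]
    congr 1; ext x
    rw [phasePoint_apply]
    simp [phaseAngle]
    left
    congr 1
    exact Subsingleton.elim _ _
  | succ m ih =>
    obtain ⟨μ, hμ, h⟩ := ih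
    have hW : WignerFamily (fun _ : ℝ => (1 : L2 m →L[ℂ] L2 m)) fun _ => μ :=
      { temperate := fun _ => hμ
        bound := fun x φ => by
          change ‖⟪φ, φ⟫_ℂ‖ ≤ _
          rw [inner_self_eq_norm_sq_to_K]; simp
        measurable := fun φ => measurable_const
        eq := fun x ψ => by rw [h, integral_wigner] }
    exact hasNonnegWigner_homodyne 0 hW fun ψ => integral_sliceSchw 0 ψ

/-! ## GOCC measurements are Wigner-positive -/

section POVM

variable {H X : Type} [NormedAddCommGroup H] [InnerProductSpace ℂ H] [CompleteSpace H]
  [MeasurableSpace X]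

theorem POVM.inner_empty (E : POVM H X) (ψ : H) : ⟪ψ, E.toFun ∅ ψ⟫_ℂ = 0 := by
  have h := E.sigma_additive (fun _ => ∅) (fun _ => MeasurableSet.empty)
    (fun i j _ => disjoint_bot_left) ψ
  have h2 : Tendsto (fun _ : ℕ => ⟪ψ, E.toFun ∅ ψ⟫_ℂ) atTop (𝓝 0) := h.summable.tendsto_atTop_zero
  exact tendsto_nhds_unique tendsto_const_nhds h2

theorem POVM.inner_union (E : POVM H X) {A B : Set X} (hA : MeasurableSet A)
    (hB : MeasurableSet B) (hd : Disjoint A B) (ψ : H) :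
    ⟪ψ, E.toFun (A ∪ B) ψ⟫_ℂ = ⟪ψ, E.toFun A ψ⟫_ℂ + ⟪ψ, E.toFun B ψ⟫_ℂ := by
  let S : ℕ → Set X := fun n => if n = 0 then A else if n = 1 then B else ∅
  have hS : ∀ n, MeasurableSet (S n) := fun n => by
    simp only [S]; split_ifs <;> simp [hA, hB]
  have hSd : Pairwise fun i j => Disjoint (S i) (S j) := fun i j hij => by
    simp only [S]; split_ifs <;> simp_all [hd.symm]
  have hU : ⋃ n, S n = A ∪ B := by
    ext x
    simp only [Set.mem_iUnion, S, Set.mem_union]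
    constructor
    · rintro ⟨n, hn⟩
      split_ifs at hn <;> simp_all
    · rintro (h | h)
      · exact ⟨0, by simpa⟩
      · exact ⟨1, by simpa⟩
  have h1 := E.sigma_additive S hS hSd ψ
  rw [hU] at h1
  have h2 : HasSum (fun n => ⟪ψ, E.toFun (S n) ψ⟫_ℂ)
      (∑ n ∈ {0, 1}, ⟪ψ, E.toFun (S n) ψ⟫_ℂ) :=
    hasSum_sum_of_ne_finset_zero fun n hn => by
      have : S n = ∅ := by simp_all [S]
      rw [this, E.inner_empty]
  rw [h1.unique h2]
  simp [S]

theorem POVM.inner_compl (E : POVM H X) {A : Set X} (hA : MeasurableSet A) (ψ : H) :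
    ⟪ψ, E.toFun Aᶜ ψ⟫_ℂ = ⟪ψ, ψ⟫_ℂ - ⟪ψ, E.toFun A ψ⟫_ℂ := by
  have h := E.inner_union hA hA.compl disjoint_compl_right ψ
  rw [Set.union_compl_self, E.univ] at h
  rw [eq_sub_iff_add_eq, add_comm, ← h]
  rfl

open ComplexOrder in
theorem POVM.norm_inner_le (E : POVM H X) {A : Set X} (hA : MeasurableSet A) (ψ : H) :
    ‖⟪ψ, E.toFun A ψ⟫_ℂ‖ ≤ ‖ψ‖ ^ 2 := by
  have h1 := (E.pos A hA).inner_nonneg_right ψ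
  have h2 := (E.pos Aᶜ hA.compl).inner_nonneg_right ψ
  rw [E.inner_compl hA, inner_self_eq_norm_sq_to_K, sub_nonneg] at h2
  have h3 : ((‖⟪ψ, E.toFun A ψ⟫_ℂ‖ : ℝ) : ℂ) ≤ ((‖ψ‖ ^ 2 : ℝ) : ℂ) := by
    rw [Complex.norm_of_nonneg' h1]
    simpa using h2
  exact_mod_cast h3

end POVM

/-- The homodyne rule supplies measurability only for fixed events, while the sections of `B` move
with `x`; a π-λ argument from rectangles bridges the gap. -/
theorem measurable_inner_section {m : ℕ} {X : Type} [MeasurableSpace X] (F : ℝ → POVM (L2 m) X)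
    (hF : ∀ A, MeasurableSet A → ∀ φ, Measurable fun x => ⟪φ, (F x).toFun A φ⟫_ℂ)
    {B : Set (ℝ × X)} (hB : MeasurableSet B) (φ : L2 m) :
    Measurable fun x => ⟪φ, (F x).toFun {y | (x, y) ∈ B} φ⟫_ℂ := by
  induction B, hB using MeasurableSpace.induction_on_inter generateFrom_prod.symm
    isPiSystem_prod with
  | empty => simp [POVM.inner_empty]
  | basic B hB =>
    obtain ⟨s, hs, t, ht, rfl⟩ := hB
    have h : (fun x => ⟪φ, (F x).toFun {y | (x, y) ∈ s ×ˢ t} φ⟫_ℂ) =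
        s.indicator fun x => ⟪φ, (F x).toFun t φ⟫_ℂ := by
      ext x
      by_cases hx : x ∈ s <;> simp [hx, POVM.inner_empty]
    rw [h]
    exact (hF t ht φ).indicator hs
  | compl B hB ih =>
    have h : ∀ x, ⟪φ, (F x).toFun {y | (x, y) ∈ Bᶜ} φ⟫_ℂ =
        ⟪φ, φ⟫_ℂ - ⟪φ, (F x).toFun {y | (x, y) ∈ B} φ⟫_ℂ := fun x =>
      (F x).inner_compl (measurable_prodMk_left hB) φ
    simp_rw [h]
    exact measurable_const.sub ih
  | iUnion B hd hB ih =>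
    refine measurable_of_tendsto_metrizable
      (f := fun n x => ∑ i ∈ Finset.range n, ⟪φ, (F x).toFun {y | (x, y) ∈ B i} φ⟫_ℂ)
      (fun n => Finset.measurable_fun_sum _ fun i _ => ih i) ?_
    refine tendsto_pi_nhds.2 fun x => ?_
    have h := (F x).sigma_additive (fun i => {y | (x, y) ∈ B i})
      (fun i => measurable_prodMk_left (hB i))
      (fun i k hik => (hd hik).preimage (Prod.mk x)) φ
    have hU : {y | (x, y) ∈ ⋃ i, B i} = ⋃ i, {y | (x, y) ∈ B i} := by
      ext y; simp
    rw [hU]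
    exact h.tendsto_sum_nat

theorem hasNonnegWigner_zero (m : ℕ) : HasNonnegWigner (0 : L2 m →L[ℂ] L2 m) :=
  ⟨0, ⟨0, by simp⟩, fun ψ => by simp⟩

/-- Each building block of a protocol preserves Wigner positivity of its effects. -/
theorem IsGOCC.hasNonnegWigner {m : ℕ} {X : Type} [MeasurableSpace X] {E : POVM (L2 m) X}
    (h : IsGOCC E) : ∀ A, MeasurableSet A → HasNonnegWigner (E.toFun A) := by
  induction h with
  | discard m =>
    intro A _
    by_cases hA : () ∈ A
    · simpa [POVM.trivial, hA] using hasNonnegWigner_one m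
    · simpa [POVM.trivial, hA] using hasNonnegWigner_zero m
  | postprocess E f hf _ ih => exact fun A hA => ih _ (hf hA)
  | unitary E U hU _ ih =>
    refine fun A hA => hasNonnegWigner_pullback_gaussian hU (ih A hA) fun ψ => ?_
    simp [POVM.pullback, ContinuousLinearMap.adjoint_inner_right]
  | ancilla j E _ ih =>
    refine fun A hA => hasNonnegWigner_ancilla j (ih A hA) fun ψ => ?_
    simp [POVM.pullback, ContinuousLinearMap.adjoint_inner_right]
  | homodyne j F E _ hF hE ih =>
    intro B hB
    have hBx : ∀ x, MeasurableSet {y | (x, y) ∈ B} := fun x => measurable_prodMk_left hB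
    -- An arbitrary choice for each outcome `x`; `measurable_damped` makes any such choice
    -- measurable.
    choose μ hμ h using fun x => ih x _ (hBx x)
    refine hasNonnegWigner_homodyne j (G := fun x => (F x).toFun {y | (x, y) ∈ B}) (μ := μ)
      { temperate := hμ
        bound := fun x φ => (F x).norm_inner_le (hBx x) φ
        measurable := measurable_inner_section F hF hB
        eq := fun x ψ => by rw [h, integral_wigner] } fun ψ => ?_
    rw [hE B hB]
    refine integral_congr_ae ?_
    filter_upwards [slice_vec j ψ] with x hx
    rw [hx]

theorem distNorm_GOCC_le {m : ℕ} (Z : L2 m →L[ℂ] L2 m) :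
    distNorm (GOCC m) Z ≤ distNorm (WignerPos m) Z :=
  iSup_mono fun _ => iSup_mono fun _ => iSup_mono fun _ =>
    iSup_mono' fun h => ⟨IsGOCC.hasNonnegWigner h, le_rfl⟩

/-! ## Diagonal operators -/

theorem summable_mul_of_summable {c d : ℕ → ℝ} (hc : Summable c) (hd : Summable d) :
    Summable (c * d) := by
  refine Summable.of_norm_bounded_eventually_nat (g := fun n => ‖c n‖) hc.norm ?_
  filter_upwards [hd.norm.tendsto_atTop_zero.eventually (gt_mem_nhds one_pos)] with n hn
  rw [Pi.mul_apply, norm_mul]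
  exact mul_le_of_le_one_right (norm_nonneg _) hn.le

section HilbertBasis

variable {H : Type*} [NormedAddCommGroup H] [InnerProductSpace ℂ H]

theorem hasSum_norm_inner_sq {ι : Type*} (b : HilbertBasis ι ℂ H) (x : H) :
    HasSum (fun i => ‖⟪b i, x⟫_ℂ‖ ^ 2) (‖x‖ ^ 2) := by
  have h1 := (b.hasSum_inner_mul_inner x x).mapL (RCLike.reCLM (K := ℂ))
  have h2 : ∀ i, (RCLike.reCLM (K := ℂ)) (⟪x, b i⟫_ℂ * ⟪b i, x⟫_ℂ) = ‖⟪b i, x⟫_ℂ‖ ^ 2 := fun i => by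
    rw [← inner_conj_symm x (b i), Complex.conj_mul', ← Complex.ofReal_pow]
    exact Complex.ofReal_re _
  simpa only [h2, RCLike.reCLM_apply, inner_self_eq_norm_sq] using h1

/-- Parseval after exchanging the sums: a trace taken in the unspecified basis `b` becomes a sum
over the vectors that diagonalise the operator. -/
theorem tsum_tsum_inner_mul_inner {ι : Type*} (b : HilbertBasis ι ℂ H) {v w : ℕ → H} {K : ℝ}
    (hv : ∀ n, ‖v n‖ ≤ 1) (hw : ∀ n, ‖w n‖ ≤ K) {c : ℕ → ℝ} (hc : Summable c) :
    ∑' i, ∑' n, (c n : ℂ) * (⟪w n, b i⟫_ℂ * ⟪b i, v n⟫_ℂ) = ∑' n, (c n : ℂ) * ⟪w n, v n⟫_ℂ := by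
  have hb := hasSum_norm_inner_sq b
  have hsum : Summable (Function.uncurry fun n i =>
      (c n : ℂ) * (⟪w n, b i⟫_ℂ * ⟪b i, v n⟫_ℂ)) := by
    -- The product of two coefficients is bounded by the sum of their squares, and those are
    -- summable over the basis by Parseval.
    have hg : Summable (fun p : ℕ × ι =>
        ‖c p.1‖ * (‖⟪b p.2, v p.1⟫_ℂ‖ ^ 2 + ‖⟪b p.2, w p.1⟫_ℂ‖ ^ 2)) := by
      refine (summable_prod_of_nonneg fun p => by positivity).2 ⟨fun n => ?_, ?_⟩
      · exact ((hb (v n)).add (hb (w n))).summable.mul_left ‖c n‖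
      · simp_rw [tsum_mul_left, ((hb _).add (hb _)).tsum_eq]
        refine Summable.of_nonneg_of_le (fun n => by positivity) (fun n => ?_)
          (hc.norm.mul_right (1 ^ 2 + K ^ 2))
        gcongr
        · exact hv n
        · exact hw n
    refine Summable.of_norm_bounded hg ?_
    rintro ⟨n, i⟩
    simp only [Function.uncurry_apply_pair, norm_mul, Complex.norm_real]
    rw [norm_inner_symm (w n) (b i)]
    refine mul_le_mul_of_nonneg_left ?_ (norm_nonneg _)
    nlinarith [sq_nonneg (‖⟪b i, v n⟫_ℂ‖ - ‖⟪b i, w n⟫_ℂ‖), sq_nonneg ‖⟪b i, v n⟫_ℂ‖,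
      sq_nonneg ‖⟪b i, w n⟫_ℂ‖]
  rw [hsum.tsum_comm']
  · refine tsum_congr fun n => ?_
    rw [tsum_mul_left, b.tsum_inner_mul_inner]
  · exact fun n => (b.summable_inner_mul_inner _ _).mul_left _
  · intro i
    exact hsum.prod_symm.prod_factor i

end HilbertBasis

section Diagonal

variable {H : Type} [NormedAddCommGroup H] [InnerProductSpace ℂ H] [CompleteSpace H]

/-- The operator `∑ c_n |v_n⟩⟨v_n|`. -/
def diagOp (v : ℕ → H) (c : ℕ → ℝ) : H →L[ℂ] H :=
  ∑' n, (c n : ℂ) • InnerProductSpace.rankOne ℂ (v n) (v n)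

variable {v : ℕ → H} (hv : Orthonormal ℂ v) {c d : ℕ → ℝ} (hc : Summable c) (hd : Summable d)

include hv hc

theorem hasSum_diagOp : HasSum (fun n => (c n : ℂ) • InnerProductSpace.rankOne ℂ (v n) (v n))
    (diagOp v c) := by
  refine Summable.hasSum (Summable.of_norm ?_)
  simpa [norm_smul, hv.1] using hc.norm

theorem hasSum_diagOp_apply (ψ : H) :
    HasSum (fun n => ((c n : ℂ) * ⟪v n, ψ⟫_ℂ) • v n) (diagOp v c ψ) := by
  simpa [mul_smul] using (hasSum_diagOp hv hc).mapL (ContinuousLinearMap.apply ℂ H ψ)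

theorem hasSum_inner_diagOp (φ ψ : H) :
    HasSum (fun n => (c n : ℂ) * (⟪φ, v n⟫_ℂ * ⟪v n, ψ⟫_ℂ)) ⟪φ, diagOp v c ψ⟫_ℂ := by
  have h := (hasSum_diagOp_apply hv hc ψ).mapL (innerSL ℂ φ)
  have h2 : ∀ n, innerSL ℂ φ (((c n : ℂ) * ⟪v n, ψ⟫_ℂ) • v n) =
      (c n : ℂ) * (⟪φ, v n⟫_ℂ * ⟪v n, ψ⟫_ℂ) := fun n => by
    rw [innerSL_apply_apply, inner_smul_right]; ring
  simpa only [h2, innerSL_apply_apply] using h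

theorem inner_diagOp (n : ℕ) (ψ : H) : ⟪v n, diagOp v c ψ⟫_ℂ = c n * ⟪v n, ψ⟫_ℂ := by
  have h := hasSum_inner_diagOp hv hc (v n) ψ
  refine h.unique ?_
  convert hasSum_single n fun k hk => ?_ using 1
  · simp [hv.1]
  · simp [hv.2 hk.symm]

include hd in
theorem diagOp_mul : diagOp v c * diagOp v d = diagOp v (c * d) := by
  have hcd : Summable (c * d) := summable_mul_of_summable hc hd
  ext ψ
  have h1 := hasSum_diagOp_apply hv hc (diagOp v d ψ)
  have h2 := hasSum_diagOp_apply hv hcd ψ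
  refine h1.unique ?_
  convert h2 using 2 with n
  rw [inner_diagOp hv hd]
  simp [mul_assoc]

theorem re_inner_diagOp (ψ : H) :
    HasSum (fun n => c n * ‖⟪v n, ψ⟫_ℂ‖ ^ 2) (RCLike.re ⟪ψ, diagOp v c ψ⟫_ℂ) := by
  have h := (hasSum_inner_diagOp hv hc ψ ψ).mapL (RCLike.reCLM (K := ℂ))
  have h2 : ∀ n, (RCLike.reCLM (K := ℂ)) ((c n : ℂ) * (⟪ψ, v n⟫_ℂ * ⟪v n, ψ⟫_ℂ)) =
      c n * ‖⟪v n, ψ⟫_ℂ‖ ^ 2 := fun n => by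
    rw [← inner_conj_symm ψ (v n), Complex.conj_mul', ← Complex.ofReal_pow, ← Complex.ofReal_mul]
    exact Complex.ofReal_re _
  simpa only [h2, RCLike.reCLM_apply] using h

theorem isSelfAdjoint_diagOp : IsSelfAdjoint (diagOp v c) := by
  rw [ContinuousLinearMap.isSelfAdjoint_iff_isSymmetric]
  intro φ ψ
  have h1 := hasSum_inner_diagOp hv hc φ ψ
  have h2 := (hasSum_inner_diagOp hv hc ψ φ).mapL ((Complex.conjCLE : ℂ ≃L[ℝ] ℂ) : ℂ →L[ℝ] ℂ)
  have h3 : ∀ n, ((Complex.conjCLE : ℂ ≃L[ℝ] ℂ) : ℂ →L[ℝ] ℂ)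
      ((c n : ℂ) * (⟪ψ, v n⟫_ℂ * ⟪v n, φ⟫_ℂ)) = (c n : ℂ) * (⟪φ, v n⟫_ℂ * ⟪v n, ψ⟫_ℂ) := fun n => by
    simp only [ContinuousLinearEquiv.coe_coe, Complex.conjCLE_apply, map_mul, Complex.conj_ofReal]
    rw [inner_conj_symm, inner_conj_symm]
    ring
  simp only [h3] at h2
  change ⟪diagOp v c φ, ψ⟫_ℂ = ⟪φ, diagOp v c ψ⟫_ℂ
  rw [← inner_conj_symm]
  exact h2.unique h1

theorem isPositive_diagOp (h : ∀ n, 0 ≤ c n) : (diagOp v c).IsPositive := by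
  refine ContinuousLinearMap.isPositive_def'.2 ⟨isSelfAdjoint_diagOp hv hc, fun ψ => ?_⟩
  rw [ContinuousLinearMap.reApplyInnerSelf_apply, inner_re_symm]
  exact (re_inner_diagOp hv hc ψ).nonneg fun n => mul_nonneg (h n) (sq_nonneg _)

/-- Uniqueness of the positive square root: the candidate is positive and has the right square. -/
theorem abs_diagOp : CFC.abs (diagOp v c) = diagOp v fun n => |c n| := by
  have ha : Summable fun n => |c n| := hc.abs
  have hpos : 0 ≤ diagOp v fun n => |c n| :=
    (ContinuousLinearMap.nonneg_iff_isPositive _).2 (isPositive_diagOp hv ha fun n => abs_nonneg _)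
  refine CFC.sqrt_unique ?_ hpos
  rw [(isSelfAdjoint_diagOp hv hc).star_eq, diagOp_mul hv ha ha, diagOp_mul hv hc hc]
  congr 1; ext n
  simp

theorem traceNorm_diagOp : traceNorm (diagOp v c) = ENNReal.ofReal (∑' n, |c n|) := by
  have ha : Summable fun n => |c n| := hc.abs
  have h1 : ∀ i, ENNReal.ofReal (RCLike.re ⟪stdBasis H i, CFC.abs (diagOp v c) (stdBasis H i)⟫_ℂ) =
      ∑' n, ENNReal.ofReal |c n| * ENNReal.ofReal (‖⟪v n, stdBasis H i⟫_ℂ‖ ^ 2) := fun i => by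
    have h2 := re_inner_diagOp hv ha (stdBasis H i)
    rw [abs_diagOp hv hc, ← h2.tsum_eq, ENNReal.ofReal_tsum_of_nonneg
      (fun n => mul_nonneg (abs_nonneg _) (sq_nonneg _)) h2.summable]
    exact tsum_congr fun n => ENNReal.ofReal_mul (abs_nonneg _)
  have h3 : ∀ n, ∑' i, ENNReal.ofReal (‖⟪v n, stdBasis H i⟫_ℂ‖ ^ 2) = 1 := fun n => by
    simp_rw [norm_inner_symm (v n)]
    have h4 := hasSum_norm_inner_sq (stdBasis H) (v n)
    rw [← ENNReal.ofReal_tsum_of_nonneg (fun i => sq_nonneg _) h4.summable, h4.tsum_eq, hv.1]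
    simp
  rw [traceNorm, tsum_congr h1, ENNReal.tsum_comm]
  simp_rw [ENNReal.tsum_mul_left, h3, mul_one]
  rw [ENNReal.ofReal_tsum_of_nonneg (fun n => abs_nonneg _) ha]

/-- Moving `T` onto the left vector as its adjoint gives the shape required by
`tsum_tsum_inner_mul_inner`; no self-adjointness of `T` is needed. -/
theorem opTrace_diagOp_mul (T : H →L[ℂ] H) :
    opTrace (diagOp v c * T) = ∑' n, (c n : ℂ) * ⟪v n, T (v n)⟫_ℂ := by
  have h1 : ∀ φ, ⟪φ, (diagOp v c * T) φ⟫_ℂ =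
      ∑' n, (c n : ℂ) * (⟪ContinuousLinearMap.adjoint T (v n), φ⟫_ℂ * ⟪φ, v n⟫_ℂ) := fun φ => by
    refine ((hasSum_inner_diagOp hv hc φ (T φ)).tsum_eq.symm).trans (tsum_congr fun n => ?_)
    rw [ContinuousLinearMap.adjoint_inner_left, mul_comm ⟪φ, v n⟫_ℂ]
  simp_rw [opTrace, h1]
  rw [tsum_tsum_inner_mul_inner (stdBasis H) (fun n => (hv.1 n).le)
    (fun n => by simpa [hv.1] using (ContinuousLinearMap.adjoint T).le_opNorm (v n)) hc]
  simp_rw [ContinuousLinearMap.adjoint_inner_left]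

end Diagonal

/-! ## Fock states -/

theorem partialDeriv_position {m : ℕ} (j : Fin m) (f : Schw m) :
    partialDeriv j (position j f) = f + position j (partialDeriv j f) := by
  ext x
  rw [add_apply, position_apply, partialDeriv_apply, partialDeriv_apply]
  have h1 : HasFDerivAt (fun x : Fin m → ℝ => (x j : ℂ))
      (Complex.ofRealCLM.comp (ContinuousLinearMap.proj (R := ℝ) (φ := fun _ : Fin m => ℝ) j)) x :=
    (Complex.ofRealCLM.comp (ContinuousLinearMap.proj (R := ℝ) (φ := fun _ : Fin m => ℝ)
      j)).hasFDerivAt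
  have h2 := h1.mul (f.differentiableAt (x := x)).hasFDerivAt
  have h3 : (position j f : (Fin m → ℝ) → ℂ) = fun x => (x j : ℂ) * f x :=
    funext (position_apply j f)
  rw [h3]
  erw [h2.fderiv]
  simp
  ring

theorem annihilation_creation {m : ℕ} (j : Fin m) (f : Schw m) :
    annihilation j (creation j f) = creation j (annihilation j f) + f := by
  have hs : ((1 / Real.sqrt 2 : ℝ) : ℂ) * ((1 / Real.sqrt 2 : ℝ) : ℂ) = 1 / 2 := by
    rw [← Complex.ofReal_mul, div_mul_div_comm, Real.mul_self_sqrt (by norm_num)]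
    push_cast; ring
  simp only [annihilation, creation, smul_apply, add_apply, sub_apply, map_smul, map_add, map_sub,
    partialDeriv_position]
  simp only [smul_smul, hs, smul_add, smul_sub]
  module

theorem fock_zero : fock 0 = vacuum 1 := by simp [fock]

theorem creation_fock (n : ℕ) :
    creation 0 (fock n) = ((Real.sqrt (n + 1) : ℝ) : ℂ) • fock (n + 1) := by
  rw [fock, fock, map_smul, smul_smul, pow_succ', mul_apply_eq_comp]
  congr 1
  rw [← Complex.ofReal_mul]
  congr 1
  have h1 : Real.sqrt ((n + 1).factorial : ℝ) = Real.sqrt (n + 1) * Real.sqrt n.factorial := by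
    rw [← Real.sqrt_mul (by positivity), Nat.factorial_succ]; push_cast; rfl
  rw [h1]
  have : Real.sqrt ((n : ℝ) + 1) ≠ 0 := by positivity
  have : Real.sqrt (n.factorial : ℝ) ≠ 0 := by positivity
  field_simp

theorem annihilation_fock_zero : annihilation 0 (fock 0) = 0 := by
  rw [fock_zero, annihilation_vacuum]

theorem annihilation_fock_succ (n : ℕ) :
    annihilation 0 (fock (n + 1)) = ((Real.sqrt (n + 1) : ℝ) : ℂ) • fock n := by
  have hs : ∀ n : ℕ, ((Real.sqrt (n + 1) : ℝ) : ℂ) ≠ 0 := fun n =>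
    Complex.ofReal_ne_zero.2 (by positivity)
  have hm : ∀ n : ℕ, ((Real.sqrt (n + 1) : ℝ) : ℂ) * ((Real.sqrt (n + 1) : ℝ) : ℂ) = n + 1 :=
    fun n => by rw [← Complex.ofReal_mul, Real.mul_self_sqrt (by positivity)]; push_cast; rfl
  have hc : ∀ n : ℕ, annihilation 0 (fock (n + 1)) =
      (((Real.sqrt (n + 1) : ℝ) : ℂ))⁻¹ • (creation 0 (annihilation 0 (fock n)) + fock n) :=
    fun n => by
      rw [← annihilation_creation, creation_fock, map_smul, smul_smul, inv_mul_cancel₀ (hs n),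
        one_smul]
  induction n with
  | zero =>
    rw [hc, annihilation_fock_zero]
    simp
  | succ n ih =>
    have h1 : ∀ (c : ℂ) (f : Schw 1), c • f + f = (c + 1) • f := fun c f => by
      rw [add_smul, one_smul]
    rw [hc, ih, map_smul, creation_fock, smul_smul, hm, h1, smul_smul]
    congr 1
    rw [inv_mul_eq_iff_eq_mul₀ (hs _), hm]
    push_cast; ring

theorem inner_fock (n k : ℕ) : ⟪(fock n).vec, (fock k).vec⟫_ℂ = if n = k then 1 else 0 := by
  have hs : ∀ n : ℕ, ((Real.sqrt (n + 1) : ℝ) : ℂ) ≠ 0 := fun n =>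
    Complex.ofReal_ne_zero.2 (by positivity)
  induction n generalizing k with
  | zero =>
    cases k with
    | zero => rw [fock_zero, inner_vacuum_vacuum]; simp
    | succ k =>
      have h := inner_annihilation 0 (fock 0) (fock k)
      rw [annihilation_fock_zero, creation_fock, vec_zero, inner_zero_left, vec_smul,
        inner_smul_right] at h
      simpa [hs k] using h.symm
  | succ n ih =>
    have h := inner_creation 0 (fock n) (fock k)
    rw [creation_fock, vec_smul, inner_smul_left, Complex.conj_ofReal] at h
    cases k with
    | zero =>
      rw [annihilation_fock_zero, vec_zero, inner_zero_right] at h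
      simpa [hs n] using h
    | succ k =>
      rw [annihilation_fock_succ, vec_smul, inner_smul_right, ih] at h
      by_cases hnk : n = k
      · subst hnk
        simpa [hs n] using h
      · simpa [hs n, hnk] using h

theorem orthonormal_fock : Orthonormal ℂ fun n => (fock n).vec := by
  rw [orthonormal_iff_ite]
  exact inner_fock

theorem norm_fock (n : ℕ) : ‖(fock n).vec‖ = 1 := orthonormal_fock.1 n

/-! ## Even and odd thermal states -/

/-- The coefficients of `evenThermal` in the Fock basis. -/
def evenCoeff (l : ℝ) (n : ℕ) : ℝ := if Even n then (1 - l ^ 2) * l ^ n else 0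

/-- The coefficients of `oddThermal` in the Fock basis. -/
def oddCoeff (l : ℝ) (n : ℕ) : ℝ := if Even n then 0 else (1 - l ^ 2) * l ^ (n - 1)

theorem hasSum_geometric_even {l : ℝ} (h0 : 0 ≤ l) (h1 : l < 1) :
    HasSum (fun n : ℕ => (1 - l ^ 2) * l ^ (2 * n)) 1 := by
  have h2 : l ^ 2 < 1 := by nlinarith
  have h := (hasSum_geometric_of_lt_one (sq_nonneg l) h2).mul_left (1 - l ^ 2)
  rw [mul_inv_cancel₀ (by linarith)] at h
  simpa [pow_mul] using h

theorem hasSum_evenCoeff {l : ℝ} (h0 : 0 ≤ l) (h1 : l < 1) : HasSum (evenCoeff l) 1 := by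
  have h2 : HasSum (fun n => evenCoeff l (2 * n)) 1 := by
    simpa [evenCoeff] using hasSum_geometric_even h0 h1
  have h3 : HasSum (fun n => evenCoeff l (2 * n + 1)) 0 := by
    simp [evenCoeff, parity_simps]
  simpa using h2.even_add_odd h3

theorem hasSum_oddCoeff {l : ℝ} (h0 : 0 ≤ l) (h1 : l < 1) : HasSum (oddCoeff l) 1 := by
  have h2 : HasSum (fun n => oddCoeff l (2 * n + 1)) 1 := by
    simpa [oddCoeff, parity_simps] using hasSum_geometric_even h0 h1
  have h3 : HasSum (fun n => oddCoeff l (2 * n)) 0 := by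
    simp [oddCoeff]
  simpa using h3.even_add_odd h2

theorem summable_smul_fockProj {c : ℕ → ℝ} (hc : Summable c) (k : ℕ → ℕ) :
    Summable fun n => (c n : ℂ) • fockProj (k n) := by
  refine Summable.of_norm ?_
  have h : ∀ n, ‖(c n : ℂ) • fockProj (k n)‖ = ‖c n‖ := fun n => by
    rw [norm_smul, fockProj, InnerProductSpace.norm_rankOne, norm_fock, Complex.norm_real]
    ring
  simpa only [h] using hc.norm

theorem summable_geometric_even {l : ℝ} (h0 : 0 ≤ l) (h1 : l < 1) :
    Summable fun n : ℕ => l ^ (2 * n) := by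
  have h2 : l ^ 2 < 1 := by nlinarith
  simpa [pow_mul] using summable_geometric_of_lt_one (sq_nonneg l) h2

theorem hasSum_fockProj {c : ℕ → ℝ} (hc : Summable c) :
    HasSum (fun n => (c n : ℂ) • fockProj n) (diagOp (fun n => (fock n).vec) c) :=
  hasSum_diagOp orthonormal_fock hc

theorem evenThermal_eq {l : ℝ} (h0 : 0 ≤ l) (h1 : l < 1) :
    evenThermal l = diagOp (fun n => (fock n).vec) (evenCoeff l) := by
  have h2 : HasSum (fun n => (evenCoeff l (2 * n) : ℂ) • fockProj (2 * n)) (evenThermal l) := by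
    have h := (summable_smul_fockProj (summable_geometric_even h0 h1) (2 * ·)).hasSum.const_smul
      ((1 - l ^ 2 : ℝ) : ℂ)
    refine h.congr_fun fun n => ?_
    rw [smul_smul, ← Complex.ofReal_mul, evenCoeff, if_pos (even_two_mul n)]
  have h3 : HasSum (fun n => (evenCoeff l (2 * n + 1) : ℂ) • fockProj (2 * n + 1)) 0 := by
    refine hasSum_zero.congr_fun fun n => ?_
    rw [evenCoeff, if_neg (by simp [parity_simps]), Complex.ofReal_zero, zero_smul]
  have h4 := h2.even_add_odd (f := fun n => (evenCoeff l n : ℂ) • fockProj n) h3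
  rw [add_zero] at h4
  exact h4.unique (hasSum_fockProj (hasSum_evenCoeff h0 h1).summable)

theorem oddThermal_eq {l : ℝ} (h0 : 0 ≤ l) (h1 : l < 1) :
    oddThermal l = diagOp (fun n => (fock n).vec) (oddCoeff l) := by
  have h2 : HasSum (fun n => (oddCoeff l (2 * n + 1) : ℂ) • fockProj (2 * n + 1))
      (oddThermal l) := by
    have h := (summable_smul_fockProj (summable_geometric_even h0 h1)
      (2 * · + 1)).hasSum.const_smul ((1 - l ^ 2 : ℝ) : ℂ)
    refine h.congr_fun fun n => ?_
    rw [smul_smul, ← Complex.ofReal_mul, oddCoeff, if_neg (by simp [parity_simps]),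
      Nat.add_sub_cancel]
  have h3 : HasSum (fun n => (oddCoeff l (2 * n) : ℂ) • fockProj (2 * n)) 0 := by
    refine hasSum_zero.congr_fun fun n => ?_
    rw [oddCoeff, if_pos (even_two_mul n), Complex.ofReal_zero, zero_smul]
  have h4 := h3.even_add_odd (f := fun n => (oddCoeff l n : ℂ) • fockProj n) h2
  rw [zero_add] at h4
  exact h4.unique (hasSum_fockProj (hasSum_oddCoeff h0 h1).summable)

theorem diagOp_sub {c d : ℕ → ℝ} (hc : Summable c) (hd : Summable d) :
    diagOp (fun n => (fock n).vec) c - diagOp (fun n => (fock n).vec) d =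
      diagOp (fun n => (fock n).vec) (c - d) := by
  refine ((hasSum_fockProj hc).sub (hasSum_fockProj hd)).unique
    ((hasSum_fockProj (hc.sub hd)).congr_fun fun n => ?_)
  rw [← sub_smul, ← Complex.ofReal_sub]

theorem evenCoeff_nonneg {l : ℝ} (h0 : 0 ≤ l) (h1 : l < 1) (n : ℕ) : 0 ≤ evenCoeff l n := by
  have h2 : 0 ≤ 1 - l ^ 2 := by nlinarith
  unfold evenCoeff; split_ifs <;> positivity

theorem oddCoeff_nonneg {l : ℝ} (h0 : 0 ≤ l) (h1 : l < 1) (n : ℕ) : 0 ≤ oddCoeff l n := by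
  have h2 : 0 ≤ 1 - l ^ 2 := by nlinarith
  unfold oddCoeff; split_ifs <;> positivity

theorem isDensityOperator_diagOp {c : ℕ → ℝ} (hc : HasSum c 1) (h : ∀ n, 0 ≤ c n) :
    IsDensityOperator (diagOp (fun n => (fock n).vec) c) := by
  refine ⟨isPositive_diagOp orthonormal_fock hc.summable h, ?_⟩
  rw [traceNorm_diagOp orthonormal_fock hc.summable, tsum_congr fun n => abs_of_nonneg (h n),
    hc.tsum_eq, ENNReal.ofReal_one]

theorem isDensityOperator_evenThermal {l : ℝ} (h0 : 0 ≤ l) (h1 : l < 1) :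
    IsDensityOperator (evenThermal l) := by
  rw [evenThermal_eq h0 h1]
  exact isDensityOperator_diagOp (hasSum_evenCoeff h0 h1) (evenCoeff_nonneg h0 h1)

theorem isDensityOperator_oddThermal {l : ℝ} (h0 : 0 ≤ l) (h1 : l < 1) :
    IsDensityOperator (oddThermal l) := by
  rw [oddThermal_eq h0 h1]
  exact isDensityOperator_diagOp (hasSum_oddCoeff h0 h1) (oddCoeff_nonneg h0 h1)

theorem evenThermal_mul_oddThermal {l : ℝ} (h0 : 0 ≤ l) (h1 : l < 1) :
    evenThermal l * oddThermal l = 0 := by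
  rw [evenThermal_eq h0 h1, oddThermal_eq h0 h1, diagOp_mul orthonormal_fock
    (hasSum_evenCoeff h0 h1).summable (hasSum_oddCoeff h0 h1).summable]
  have : evenCoeff l * oddCoeff l = 0 := by
    ext n
    by_cases hn : Even n <;> simp [evenCoeff, oddCoeff, hn]
  rw [this]
  simp [diagOp]

theorem evenThermal_sub_oddThermal {l : ℝ} (h0 : 0 ≤ l) (h1 : l < 1) :
    evenThermal l - oddThermal l =
      diagOp (fun n => (fock n).vec) (evenCoeff l - oddCoeff l) := by
  rw [evenThermal_eq h0 h1, oddThermal_eq h0 h1, diagOp_sub (hasSum_evenCoeff h0 h1).summable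
    (hasSum_oddCoeff h0 h1).summable]

theorem summable_thermalCoeff {l : ℝ} (h0 : 0 ≤ l) (h1 : l < 1) :
    Summable (evenCoeff l - oddCoeff l) :=
  (hasSum_evenCoeff h0 h1).summable.sub (hasSum_oddCoeff h0 h1).summable

theorem traceNorm_evenThermal_sub_oddThermal {l : ℝ} (h0 : 0 ≤ l) (h1 : l < 1) :
    traceNorm (evenThermal l - oddThermal l) = 2 := by
  rw [evenThermal_sub_oddThermal h0 h1, traceNorm_diagOp orthonormal_fock
    (summable_thermalCoeff h0 h1)]
  have h : ∀ n, |(evenCoeff l - oddCoeff l) n| = evenCoeff l n + oddCoeff l n := fun n => by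
    have h2 := evenCoeff_nonneg h0 h1 n
    have h3 := oddCoeff_nonneg h0 h1 n
    by_cases hn : Even n
    · have : oddCoeff l n = 0 := by simp [oddCoeff, hn]
      simp [this, abs_of_nonneg h2]
    · have : evenCoeff l n = 0 := by simp [evenCoeff, hn]
      simp [this, abs_of_nonneg h3]
  rw [tsum_congr h, ((hasSum_evenCoeff h0 h1).add (hasSum_oddCoeff h0 h1)).tsum_eq]
  norm_num

theorem half_smul_sub (ρ σ : L2 1 →L[ℂ] L2 1) :
    ((1 / 2 : ℝ) : ℂ) • ρ - ((1 - 1 / 2 : ℝ) : ℂ) • σ = (2⁻¹ : ℂ) • (ρ - σ) := by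
  rw [smul_sub]
  norm_num

theorem traceNorm_smul_diagOp {c : ℕ → ℝ} (hc : Summable c) :
    traceNorm ((2⁻¹ : ℂ) • diagOp (fun n => (fock n).vec) c) =
      2⁻¹ * traceNorm (diagOp (fun n => (fock n).vec) c) := by
  have h1 : (2⁻¹ : ℂ) • diagOp (fun n => (fock n).vec) c =
      diagOp (fun n => (fock n).vec) fun n => 2⁻¹ * c n := by
    refine ((hasSum_fockProj hc).const_smul (2⁻¹ : ℂ)).unique
      ((hasSum_fockProj (hc.mul_left 2⁻¹)).congr_fun fun n => ?_)
    rw [smul_smul]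
    push_cast
    rfl
  rw [h1, traceNorm_diagOp orthonormal_fock hc,
    traceNorm_diagOp orthonormal_fock (hc.mul_left 2⁻¹)]
  simp_rw [abs_mul]
  rw [tsum_mul_left, ENNReal.ofReal_mul (abs_nonneg _)]
  congr 1
  rw [abs_of_pos (by norm_num), ENNReal.ofReal_inv_of_pos (by norm_num), ENNReal.ofReal_ofNat]

theorem biasAll_thermal {l : ℝ} (h0 : 0 ≤ l) (h1 : l < 1) :
    biasAll (evenThermal l) (oddThermal l) (1 / 2) = 1 := by
  rw [biasAll, half_smul_sub, evenThermal_sub_oddThermal h0 h1, traceNorm_smul_diagOp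
    (summable_thermalCoeff h0 h1),
    ← evenThermal_sub_oddThermal h0 h1, traceNorm_evenThermal_sub_oddThermal h0 h1]
  exact ENNReal.inv_mul_cancel two_ne_zero ENNReal.ofNat_ne_top

/-! ## Phase space representation of Fock states -/

/-- The function `⟨n| D(2α) (-1)^N |k⟩` on phase space. -/
def fockElem (n k : ℕ) (α : Fin 1 → ℂ) : ℂ := phaseElem (fock n) (fock k) α

theorem phaseElem_smul_left {m : ℕ} (c : ℂ) (ψ φ : Schw m) (α : Fin m → ℂ) :
    phaseElem (c • ψ) φ α = conj c * phaseElem ψ φ α := by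
  rw [phaseElem, vec_smul, inner_smul_left, phaseElem]

theorem phaseElem_smul_right {m : ℕ} (c : ℂ) (ψ φ : Schw m) (α : Fin m → ℂ) :
    phaseElem ψ (c • φ) α = c * phaseElem ψ φ α := by
  rw [phaseElem, map_smul, vec_smul, inner_smul_right, phaseElem]

/-- At `n = 0` the coefficient `√0` makes the truncated index harmless, so that later recursions
need no case split. -/
theorem annihilation_fock (n : ℕ) :
    annihilation 0 (fock n) = ((Real.sqrt n : ℝ) : ℂ) • fock (n - 1) := by
  cases n with
  | zero => simp [annihilation_fock_zero]
  | succ n => rw [annihilation_fock_succ]; simp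

theorem fockElem_ladder (n k : ℕ) (α : Fin 1 → ℂ) :
    2 * α 0 * fockElem n k α = (Real.sqrt (n + 1) : ℝ) * fockElem (n + 1) k α +
      (Real.sqrt k : ℝ) * fockElem n (k - 1) α := by
  rw [fockElem, two_mul_phaseElem, creation_fock, annihilation_fock, phaseElem_smul_left,
    phaseElem_smul_right, Complex.conj_ofReal]
  rfl

theorem fockElem_ladder_conj (n k : ℕ) (α : Fin 1 → ℂ) :
    2 * conj (α 0) * fockElem n k α = (Real.sqrt n : ℝ) * fockElem (n - 1) k α +
      (Real.sqrt (k + 1) : ℝ) * fockElem n (k + 1) α := by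
  rw [fockElem, two_mul_conj_phaseElem, creation_fock, annihilation_fock, phaseElem_smul_left,
    phaseElem_smul_right, Complex.conj_ofReal]
  rfl

theorem norm_fockElem_le (n k : ℕ) (α : Fin 1 → ℂ) : ‖fockElem n k α‖ ≤ 1 := by
  rw [fockElem]
  simpa [norm_fock] using norm_phaseElem_le (fock n) (fock k) α

/-- At the origin the phase point operator is the parity, and `|n⟩` has parity `(-1)ⁿ`. -/
theorem fockElem_self_zero (n : ℕ) : fockElem n n 0 = (-1) ^ n := by
  induction n with
  | zero => rw [fockElem, fock_zero, phaseElem_vacuum]; simp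
  | succ n ih =>
    have h := fockElem_ladder_conj (n + 1) n 0
    have hs : ((Real.sqrt (n + 1) : ℝ) : ℂ) ≠ 0 := Complex.ofReal_ne_zero.2 (by positivity)
    simp only [Pi.zero_apply, map_zero, mul_zero, zero_mul, Nat.add_sub_cancel, Nat.cast_add,
      Nat.cast_one, ih, ← mul_add] at h
    have h2 := (mul_eq_zero.1 h.symm).resolve_left hs
    rw [pow_succ]
    linear_combination h2

theorem sqrt_natCast_le (n : ℕ) : Real.sqrt n ≤ n := by
  rw [Real.sqrt_le_left (Nat.cast_nonneg n)]
  exact_mod_cast Nat.le_self_pow two_ne_zero n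

/-- A version of `phaseElem_decay` with constants polynomial in the Fock index, so that they stay
summable against `tⁿ`. -/
theorem norm_fockElem_decay (N : ℕ) : ∀ (L n k : ℕ), n ≤ L → k ≤ L → ∀ α : Fin 1 → ℂ,
    ‖α‖ ^ N * ‖fockElem n k α‖ ≤ ((L + N : ℕ) : ℝ) ^ N := by
  induction N with
  | zero => exact fun L n k _ _ α => by simpa using norm_fockElem_le n k α
  | succ N ih =>
    intro L n k hn hk α
    have hα : ‖α‖ = ‖α 0‖ := by
      refine le_antisymm ((pi_norm_le_iff_of_nonneg (norm_nonneg _)).2 fun i => ?_)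
        (norm_le_pi_norm α 0)
      rw [Subsingleton.elim i 0]
    have h1 := congrArg norm (fockElem_ladder n k α)
    rw [norm_mul, norm_mul, Complex.norm_ofNat, ← hα] at h1
    have h2 := h1.le.trans (norm_add_le _ _)
    rw [norm_mul, norm_mul, Complex.norm_real, Complex.norm_real,
      Real.norm_of_nonneg (Real.sqrt_nonneg _), Real.norm_of_nonneg (Real.sqrt_nonneg _)] at h2
    have h3 := ih (L + 1) (n + 1) k (by omega) (by omega) α
    have h4 := ih (L + 1) n (k - 1) (by omega) (by omega) α
    have h5 : Real.sqrt (n + 1) ≤ (L + (N + 1) : ℕ) := by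
      have := sqrt_natCast_le (n + 1)
      push_cast at this ⊢
      have hn' : (n : ℝ) ≤ L := by exact_mod_cast hn
      linarith [Nat.cast_nonneg (α := ℝ) N]
    have h6 : Real.sqrt k ≤ (L + (N + 1) : ℕ) := by
      have := sqrt_natCast_le k
      push_cast
      have hk' : (k : ℝ) ≤ L := by exact_mod_cast hk
      linarith [Nat.cast_nonneg (α := ℝ) N]
    -- The recursion raises an index by at most one while using up one power, so `L + N` is
    -- invariant.
    rw [show L + 1 + N = L + (N + 1) by ring] at h3 h4
    have h7 : 0 ≤ ‖α‖ ^ N := by positivity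
    have h8 : 2 * (‖α‖ ^ (N + 1) * ‖fockElem n k α‖) ≤
        2 * ((L + (N + 1) : ℕ) : ℝ) ^ (N + 1) := by
      calc 2 * (‖α‖ ^ (N + 1) * ‖fockElem n k α‖)
          = ‖α‖ ^ N * (2 * ‖α‖ * ‖fockElem n k α‖) := by ring
        _ ≤ ‖α‖ ^ N * (Real.sqrt (n + 1) * ‖fockElem (n + 1) k α‖ +
              Real.sqrt k * ‖fockElem n (k - 1) α‖) := by gcongr
        _ = Real.sqrt (n + 1) * (‖α‖ ^ N * ‖fockElem (n + 1) k α‖) +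
              Real.sqrt k * (‖α‖ ^ N * ‖fockElem n (k - 1) α‖) := by ring
        _ ≤ ((L + (N + 1) : ℕ) : ℝ) * ((L + (N + 1) : ℕ) : ℝ) ^ N +
              ((L + (N + 1) : ℕ) : ℝ) * ((L + (N + 1) : ℕ) : ℝ) ^ N := by gcongr
        _ = _ := by ring
    linarith

theorem hasDerivAt_fockElem (n : ℕ) (α : Fin 1 → ℂ) (τ : ℝ) :
    HasDerivAt (fun τ : ℝ => fockElem n n (τ • α))
      (2 * conj (α 0) * ((Real.sqrt n : ℝ) * fockElem n (n - 1) (τ • α)) -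
        2 * α 0 * ((Real.sqrt (n + 1) : ℝ) * fockElem n (n + 1) (τ • α))) τ := by
  have h1 : ∀ t : ℝ, HasDerivAt (fun t : ℝ => t • α) α t := fun t => by
    simpa using (hasDerivAt_id t).smul_const α
  have h : HasDerivAt (fun τ : ℝ => fockElem n n (τ • α)) _ τ :=
    hasDerivAt_phaseElem h1 continuous_const (fock n) (fock n) τ
  refine h.congr_deriv ?_
  simp only [phaseDeriv, Fin.sum_univ_one, creation_fock, annihilation_fock]
  simp only [map_smul, vec_sub, vec_smul, inner_sub_right, inner_smul_right]
  change α 0 * (_ * fockElem n n (τ • α) - 2 * (_ * fockElem n (n + 1) (τ • α))) -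
    conj (α 0) * (_ * fockElem n n (τ • α) - 2 * (_ * fockElem n (n - 1) (τ • α))) = _
  simp only [Pi.smul_apply, Complex.real_smul, map_mul, Complex.conj_ofReal]
  ring

theorem summable_pow_mul_fockElem {t : ℝ} (ht : |t| < 1) (e : ℕ → ℂ) (he : ∀ n, ‖e n‖ ≤ n + 1) :
    Summable fun n : ℕ => (t : ℂ) ^ n * e n := by
  have h1 : Summable fun n : ℕ => ((n : ℝ) + 1) * |t| ^ n := by
    have h2 := summable_pow_mul_geometric_of_norm_lt_one 1 (r := |t|) (by simpa using ht)
    have h3 := summable_geometric_of_lt_one (abs_nonneg t) ht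
    refine (h2.add h3).congr fun n => by ring
  refine Summable.of_norm_bounded h1 fun n => ?_
  rw [norm_mul, norm_pow, Complex.norm_real, Real.norm_eq_abs, mul_comm]
  gcongr
  exact he n

theorem norm_sqrt_mul_fockElem_le (n a b : ℕ) (α : Fin 1 → ℂ) :
    ‖((Real.sqrt (n + 1) : ℝ) : ℂ) * fockElem a b α‖ ≤ n + 1 := by
  rw [norm_mul, Complex.norm_real, Real.norm_of_nonneg (Real.sqrt_nonneg _)]
  have h := sqrt_natCast_le (n + 1)
  push_cast at h
  calc _ ≤ ((n : ℝ) + 1) * 1 := mul_le_mul h (norm_fockElem_le _ _ _) (norm_nonneg _) (by positivity)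
    _ = _ := mul_one _

/-- The ladder relations, summed: `tr(t^N A a†) (1 + t) = 2 ᾱ tr(t^N A)`. -/
theorem tsum_fockElem_ladder {t : ℝ} (ht : |t| < 1) {c : ℂ} {d g h : ℕ → ℂ}
    (hd : ∀ n, ‖d n‖ ≤ n + 1) (hg : ∀ n, ‖g n‖ ≤ n + 1) (h0 : h 0 = 0)
    (h1 : ∀ n, h (n + 1) = g n) (hrec : ∀ n, c * d n = h n + g n) :
    c * ∑' n, (t : ℂ) ^ n * d n = (1 + t) * ∑' n, (t : ℂ) ^ n * g n ∧
      HasSum (fun n => (t : ℂ) ^ n * h n) (t * ∑' n, (t : ℂ) ^ n * g n) := by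
  have hgs := summable_pow_mul_fockElem ht g hg
  have hh : HasSum (fun n => (t : ℂ) ^ n * h n) (t * ∑' n, (t : ℂ) ^ n * g n) := by
    rw [← hasSum_nat_add_iff' 1]
    simp only [Finset.sum_range_one, h0, mul_zero, sub_zero, h1, pow_succ']
    simpa only [mul_assoc] using hgs.hasSum.mul_left (t : ℂ)
  refine ⟨?_, hh⟩
  have h2 := hh.add hgs.hasSum
  simp only [← mul_add, ← hrec] at h2
  have h3 := (summable_pow_mul_fockElem ht d hd).hasSum.mul_left c
  rw [add_mul, one_mul, add_comm]
  refine h3.unique (h2.congr_fun fun n => by ring)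

/-- Termwise differentiation along a ray produces two shifted series; the summed ladder relations
express both through the original one, leaving a scalar linear equation. -/
theorem hasDerivAt_tsum_fockElem {t : ℝ} (ht : |t| < 1) (α : Fin 1 → ℂ) (τ : ℝ) :
    HasDerivAt (fun τ : ℝ => ∑' n, (t : ℂ) ^ n * fockElem n n (τ • α))
      (-(4 * τ * ((1 - t) / (1 + t) * ‖α 0‖ ^ 2) : ℝ) *
        ∑' n, (t : ℂ) ^ n * fockElem n n (τ • α)) τ := by
  have hF : ∀ n (β : Fin 1 → ℂ), ‖fockElem n n β‖ ≤ n + 1 := fun n β =>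
    (norm_fockElem_le n n β).trans (by simp)
  have hu : Summable fun n : ℕ => |t| ^ n * (4 * ‖α 0‖ * (n + 1)) := by
    have h2 := summable_pow_mul_geometric_of_norm_lt_one 1 (r := |t|) (by simpa using ht)
    have h3 := summable_geometric_of_lt_one (abs_nonneg t) ht
    refine ((h2.add h3).mul_left (4 * ‖α 0‖)).congr fun n => by ring
  have hs1 : ∀ n : ℕ, Real.sqrt n ≤ n + 1 := fun n => (sqrt_natCast_le n).trans (by simp)
  have hs2 : ∀ n : ℕ, Real.sqrt (n + 1) ≤ n + 1 := fun n => by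
    exact_mod_cast sqrt_natCast_le (n + 1)
  have hbound : ∀ (n : ℕ) (τ : ℝ), ‖(t : ℂ) ^ n * (2 * conj (α 0) * ((Real.sqrt n : ℝ) *
      fockElem n (n - 1) (τ • α)) - 2 * α 0 * ((Real.sqrt (n + 1) : ℝ) *
        fockElem n (n + 1) (τ • α)))‖ ≤ |t| ^ n * (4 * ‖α 0‖ * (n + 1)) := fun n τ => by
    rw [norm_mul, norm_pow, Complex.norm_real, Real.norm_eq_abs]
    gcongr
    refine (norm_sub_le _ _).trans ?_
    simp only [norm_mul, Complex.norm_ofNat, RCLike.norm_conj, Complex.norm_real]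
    rw [Real.norm_of_nonneg (Real.sqrt_nonneg _), Real.norm_of_nonneg (Real.sqrt_nonneg _)]
    calc _ ≤ 2 * ‖α 0‖ * (((n : ℝ) + 1) * 1) + 2 * ‖α 0‖ * (((n : ℝ) + 1) * 1) := by
          gcongr
          · exact hs1 n
          · exact norm_fockElem_le _ _ _
          · exact hs2 n
          · exact norm_fockElem_le _ _ _
      _ = _ := by ring
  have hder := hasDerivAt_tsum hu (fun n τ => (hasDerivAt_fockElem n α τ).const_mul ((t : ℂ) ^ n))
    hbound (y₀ := τ) (summable_pow_mul_fockElem ht _ fun n => hF n _) τ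
  refine hder.congr_deriv ?_
  set β := τ • α with hβ
  obtain ⟨e1, f1⟩ := tsum_fockElem_ladder ht (c := 2 * conj (β 0)) (d := fun n => fockElem n n β)
    (g := fun n => (Real.sqrt (n + 1) : ℝ) * fockElem n (n + 1) β)
    (h := fun n => (Real.sqrt n : ℝ) * fockElem (n - 1) n β) (fun n => hF n β)
    (fun n => norm_sqrt_mul_fockElem_le n _ _ β) (by simp) (fun n => by simp)
    (fun n => fockElem_ladder_conj n n β)
  obtain ⟨e2, f2⟩ := tsum_fockElem_ladder ht (c := 2 * β 0) (d := fun n => fockElem n n β)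
    (g := fun n => (Real.sqrt (n + 1) : ℝ) * fockElem (n + 1) n β)
    (h := fun n => (Real.sqrt n : ℝ) * fockElem n (n - 1) β) (fun n => hF n β)
    (fun n => norm_sqrt_mul_fockElem_le n _ _ β) (by simp) (fun n => by simp)
    (fun n => by rw [fockElem_ladder, add_comm])
  have hg1 := (summable_pow_mul_fockElem ht _
    fun n => norm_sqrt_mul_fockElem_le n n (n + 1) β).hasSum
  have hsum := ((f2.mul_left (2 * conj (α 0))).sub (hg1.mul_left (2 * α 0))).congr_fun
    (g := fun n : ℕ => (t : ℂ) ^ n * (2 * conj (α 0) * ((Real.sqrt n : ℝ) *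
      fockElem n (n - 1) β) - 2 * α 0 * ((Real.sqrt (n + 1) : ℝ) *
        fockElem n (n + 1) β))) (fun n => by ring)
  rw [hsum.tsum_eq]
  have hβ0 : β 0 = τ * α 0 := by simp [hβ]
  rw [hβ0] at e1 e2
  simp only [map_mul, Complex.conj_ofReal] at e1
  have ht1 : (1 + t : ℂ) ≠ 0 := by
    have : (1 + t : ℝ) ≠ 0 := by linarith [neg_lt_of_abs_lt ht]
    exact_mod_cast this
  have hn : (‖α 0‖ : ℂ) ^ 2 = α 0 * conj (α 0) := (Complex.mul_conj' _).symm
  push_cast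
  rw [hn]
  generalize ∑' n : ℕ, (t : ℂ) ^ n * fockElem n n β = S at *
  generalize ∑' n : ℕ, (t : ℂ) ^ n * ((Real.sqrt (n + 1) : ℝ) * fockElem n (n + 1) β) = X at *
  generalize ∑' n : ℕ, (t : ℂ) ^ n * ((Real.sqrt (n + 1) : ℝ) * fockElem (n + 1) n β) = Y at *
  field_simp
  linear_combination (-(2 * α 0)) * (-e1) + 2 * t * conj (α 0) * (-e2)

theorem tsum_fockElem_zero {t : ℝ} (ht : |t| < 1) :
    ∑' n, (t : ℂ) ^ n * fockElem n n 0 = (((1 + t)⁻¹ : ℝ) : ℂ) := by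
  have h1 : ∀ n, (t : ℂ) ^ n * fockElem n n 0 = (-t : ℂ) ^ n := fun n => by
    rw [fockElem_self_zero, ← mul_pow]; ring
  rw [tsum_congr h1, tsum_geometric_of_norm_lt_one (by simpa using ht)]
  push_cast
  ring

/-- The Laguerre generating function, obtained without Laguerre polynomials: the equation in
`hasDerivAt_tsum_fockElem` is solved along the ray from the alternating geometric series at the
origin. -/
theorem hasSum_fockElem {t : ℝ} (ht : |t| < 1) (α : Fin 1 → ℂ) :
    HasSum (fun n => (t : ℂ) ^ n * fockElem n n α)
      (((1 + t)⁻¹ * Real.exp (-2 * ((1 - t) / (1 + t)) * ‖α 0‖ ^ 2) : ℝ) : ℂ) := by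
  have hs := (summable_pow_mul_fockElem ht (fun n => fockElem n n α)
    fun n => (norm_fockElem_le n n α).trans (by simp)).hasSum
  convert hs using 1
  set s : ℝ := (1 - t) / (1 + t) * ‖α 0‖ ^ 2 with hs
  have hd2 : ∀ τ : ℝ, HasDerivAt (fun τ : ℝ => ((Real.exp (2 * s * τ ^ 2) : ℝ) : ℂ) *
      ∑' n, (t : ℂ) ^ n * fockElem n n (τ • α)) 0 τ := by
    intro τ
    have h1 : HasDerivAt (fun τ : ℝ => Real.exp (2 * s * τ ^ 2))
        (Real.exp (2 * s * τ ^ 2) * (2 * s * (2 * τ))) τ := by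
      have := ((hasDerivAt_pow 2 τ).const_mul (2 * s)).exp
      simpa using this
    refine (h1.ofReal_comp.mul (hasDerivAt_tsum_fockElem ht α τ)).congr_deriv ?_
    rw [← hs]
    push_cast
    ring
  have := is_const_of_deriv_eq_zero (fun t => (hd2 t).differentiableAt)
    (fun t => (hd2 t).deriv) 1 0
  simp only [one_pow, mul_one, one_smul, zero_smul, ne_eq, OfNat.ofNat_ne_zero,
    not_false_eq_true, zero_pow, mul_zero, Real.exp_zero, Complex.ofReal_one, one_mul,
    tsum_fockElem_zero ht] at this
  have h3 : Real.exp (-2 * s) * Real.exp (2 * s) = 1 := by rw [← Real.exp_add]; simp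
  have h4 : ((Real.exp (-2 * s) : ℝ) : ℂ) * ((Real.exp (2 * s) : ℝ) : ℂ) = 1 := by
    rw [← Complex.ofReal_mul, h3, Complex.ofReal_one]
  rw [mul_assoc (-2 : ℝ), ← hs, mul_comm, Complex.ofReal_mul]
  linear_combination -((Real.exp (-2 * s) : ℝ) : ℂ) * this +
    (∑' n, (t : ℂ) ^ n * fockElem n n α) * h4

/-! ## Uniqueness of the Laplace transform -/

/-- The complex moment generating functions are analytic on `Re z < 1` and agree on real points near
`0`, hence on the imaginary axis, where they are the characteristic functions. -/
theorem measure_eq_of_complexMGF {M N : Measure ℝ} [IsFiniteMeasure M] [IsFiniteMeasure N]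
    (hM : ∀ t < 1, Integrable (fun s => Real.exp (t * s)) M)
    (hN : ∀ t < 1, Integrable (fun s => Real.exp (t * s)) N)
    (h : ∀ t < 1, ∫ s, Real.exp (t * s) ∂M = ∫ s, Real.exp (t * s) ∂N) : M = N := by
  have hsub : ∀ {M : Measure ℝ}, (∀ t < 1, Integrable (fun s => Real.exp (t * s)) M) →
      {z : ℂ | z.re < 1} ⊆ {z | z.re ∈ interior (ProbabilityTheory.integrableExpSet id M)} := by
    intro M hM z hz
    exact interior_maximal (s := ProbabilityTheory.integrableExpSet id M) (t := Set.Iio 1)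
      (fun t ht => hM t ht) isOpen_Iio hz
  have hM' : AnalyticOnNhd ℂ (ProbabilityTheory.complexMGF id M) {z : ℂ | z.re < 1} :=
    ProbabilityTheory.analyticOnNhd_complexMGF.mono (hsub hM)
  have hN' : AnalyticOnNhd ℂ (ProbabilityTheory.complexMGF id N) {z : ℂ | z.re < 1} :=
    ProbabilityTheory.analyticOnNhd_complexMGF.mono (hsub hN)
  have htend : Tendsto (fun t : ℝ => (t : ℂ)) (𝓝[≠] 0) (𝓝[≠] 0) := by
    refine tendsto_nhdsWithin_iff.2 ⟨?_, ?_⟩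
    · exact (Complex.continuous_ofReal.tendsto' 0 0 Complex.ofReal_zero).mono_left
        nhdsWithin_le_nhds
    · filter_upwards [self_mem_nhdsWithin] with t ht
      simpa using ht
  have hfreq : ∃ᶠ t : ℝ in 𝓝[≠] 0, ProbabilityTheory.complexMGF id M t =
      ProbabilityTheory.complexMGF id N t := by
    refine Eventually.frequently ?_
    filter_upwards [nhdsWithin_le_nhds (Iio_mem_nhds (zero_lt_one (α := ℝ)))] with t ht
    rw [ProbabilityTheory.complexMGF_ofReal, ProbabilityTheory.complexMGF_ofReal]
    congr 1
    exact h t ht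
  have heq := AnalyticOnNhd.eqOn_of_preconnected_of_frequently_eq hM' hN'
    (convex_halfSpace_re_lt 1).isPreconnected (z₀ := 0) (by simp) (htend.frequently hfreq)
  refine Measure.ext_of_charFun (funext fun t => ?_)
  rw [← ProbabilityTheory.complexMGF_id_mul_I, ← ProbabilityTheory.complexMGF_id_mul_I]
  exact heq (by simp)

/-- Tilting by `exp(-s)` makes the measures finite and turns `u > 0` into `t = 1 - u < 1`; the tilt
is then inverted. -/
theorem measure_eq_of_laplace {M N : Measure ℝ}
    (hM : ∀ u, 0 < u → Integrable (fun s => Real.exp (-u * s)) M)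
    (hN : ∀ u, 0 < u → Integrable (fun s => Real.exp (-u * s)) N)
    (h : ∀ u, 0 < u → ∫ s, Real.exp (-u * s) ∂M = ∫ s, Real.exp (-u * s) ∂N) : M = N := by
  set w : ℝ → ℝ≥0∞ := fun s => ENNReal.ofReal (Real.exp (-s)) with hw
  have hwm : Measurable w := (Real.measurable_exp.comp measurable_neg).ennreal_ofReal
  have hwt : ∀ s, w s < ∞ := fun s => ENNReal.ofReal_lt_top
  have hwr : ∀ s, (w s).toReal = Real.exp (-s) := fun s =>
    ENNReal.toReal_ofReal (Real.exp_pos _).le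
  have hfin : ∀ {M : Measure ℝ}, (∀ u, 0 < u → Integrable (fun s => Real.exp (-u * s)) M) →
      IsFiniteMeasure (M.withDensity w) := fun hM => by
    refine isFiniteMeasure_withDensity ?_
    have := (hM 1 one_pos).2
    rw [hasFiniteIntegral_iff_ofReal (Eventually.of_forall fun s => (Real.exp_pos _).le)] at this
    simpa [hw] using this.ne
  have hexp : ∀ t s : ℝ, Real.exp (-s) * Real.exp (t * s) = Real.exp (-(1 - t) * s) :=
    fun t s => by rw [← Real.exp_add]; congr 1; ring
  have hint : ∀ {M : Measure ℝ}, (∀ u, 0 < u → Integrable (fun s => Real.exp (-u * s)) M) →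
      ∀ t < 1, Integrable (fun s => Real.exp (t * s)) (M.withDensity w) := by
    intro M hM t ht
    rw [integrable_withDensity_iff_integrable_smul' hwm (Eventually.of_forall hwt)]
    simp only [hwr, smul_eq_mul, hexp]
    exact hM _ (by linarith)
  have hval : ∀ (M : Measure ℝ) (t : ℝ), ∫ s, Real.exp (t * s) ∂(M.withDensity w) =
      ∫ s, Real.exp (-(1 - t) * s) ∂M := by
    intro M t
    rw [integral_withDensity_eq_integral_toReal_smul hwm (Eventually.of_forall hwt)]
    simp only [hwr, smul_eq_mul, hexp]
  have := hfin hM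
  have := hfin hN
  have heq : M.withDensity w = N.withDensity w :=
    measure_eq_of_complexMGF (hint hM) (hint hN) fun t ht => by
      rw [hval, hval, h _ (by linarith)]
  have hinv : ∀ M : Measure ℝ, (M.withDensity w).withDensity w⁻¹ = M := fun M =>
    withDensity_inv_same hwm (Eventually.of_forall fun s => by
      simp [hw, Real.exp_pos]) (Eventually.of_forall fun s => (hwt s).ne)
  rw [← hinv M, heq, hinv N]

theorem measure_eq_volume_of_laplace {N : Measure ℝ}
    (hN : ∀ u, 0 < u → Integrable (fun s => Real.exp (-u * s)) N)
    (h : ∀ u, 0 < u → ∫ s, Real.exp (-u * s) ∂N = u⁻¹) : N = volume.restrict (Set.Ioi 0) := by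
  refine measure_eq_of_laplace hN (fun u hu => ?_) fun u hu => ?_
  · exact integrableOn_exp_mul_Ioi (neg_lt_zero.2 hu) 0
  · rw [h u hu, integral_exp_mul_Ioi (neg_lt_zero.2 hu)]
    simp

/-! ## Radial measures of Wigner-positive operators -/

/-- Fock diagonals see only `|α|²`, so the Wigner measure is pushed forward to the line. Integrating
the Fock generating function against it gives a Laplace transform at `u = 2(1-t)/(1+t)`. -/
theorem exists_radial_measure {T : L2 1 →L[ℂ] L2 1} (hT : HasNonnegWigner T) :
    ∃ ν : Measure ℝ, (∀ u, 0 < u → Integrable (fun s => Real.exp (-u * s)) ν) ∧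
      ∀ t : ℝ, |t| < 1 → HasSum (fun n => (t : ℂ) ^ n * ⟪(fock n).vec, T (fock n).vec⟫_ℂ)
        ((2 * ((1 + t)⁻¹ * ∫ s, Real.exp (-(2 * ((1 - t) / (1 + t))) * s) ∂ν) : ℝ) : ℂ) := by
  obtain ⟨μ, hμ, h⟩ := hT
  obtain ⟨N, hN⟩ := hμ.exists_integrable
  set w : (Fin 1 → ℂ) → ℝ := fun α => (1 + ‖α‖) ^ (-(N : ℝ)) with hw
  have hρ : Continuous fun α : Fin 1 → ℂ => ‖α 0‖ ^ 2 := by fun_prop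
  set B : ℕ → ℝ := fun n => 2 ^ N * (1 + ((n + N : ℕ) : ℝ) ^ N) with hB
  have hb : ∀ n α, ‖fockElem n n α‖ ≤ B n * w α := fun n α => by
    have := pow_mul_le_of_le_of_pow_mul_le (k := 0) (l := N) (norm_nonneg α)
      (norm_nonneg (fockElem n n α)) (norm_fockElem_le n n α)
      (by simpa using norm_fockElem_decay N n n n le_rfl le_rfl α)
    rw [pow_zero, one_mul] at this
    refine this.trans_eq ?_
    simp only [hB, hw, Nat.cast_add]
  have hBs : ∀ t : ℝ, |t| < 1 → Summable fun n => |t| ^ n * B n := by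
    intro t ht
    -- A strictly positive base is needed, since the index shift by `N` divides by `r ^ N` and `t`
    -- may vanish.
    obtain ⟨r, hr, hr1⟩ := exists_between ht
    have hr0 : 0 < r := (abs_nonneg t).trans_lt hr
    have h1 := (summable_nat_add_iff N).2 (summable_pow_mul_geometric_of_norm_lt_one N (r := r)
      (by rwa [Real.norm_of_nonneg hr0.le]))
    have h2 := summable_geometric_of_lt_one hr0.le hr1
    have h3 := (h2.add (h1.mul_right ((r ^ N)⁻¹))).mul_left (2 ^ N)
    refine Summable.of_nonneg_of_le (fun n => by positivity) (fun n => ?_) h3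
    calc |t| ^ n * B n ≤ r ^ n * B n := by gcongr
      _ = _ := by
        rw [hB, pow_add]
        field_simp
  have hdom : ∀ t : ℝ, |t| < 1 → ∀ α, ‖(((1 + t)⁻¹ * Real.exp (-2 * ((1 - t) / (1 + t)) *
      ‖α 0‖ ^ 2) : ℝ) : ℂ)‖ ≤ (∑' n, |t| ^ n * B n) * w α := by
    intro t ht α
    rw [← (hasSum_fockElem ht α).tsum_eq]
    refine tsum_of_norm_bounded ((hBs t ht).hasSum.mul_right _) fun n => ?_
    rw [norm_mul, norm_pow, Complex.norm_real, Real.norm_eq_abs, mul_assoc]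
    gcongr
    exact hb n α
  have hint : ∀ t : ℝ, |t| < 1 → Integrable (fun α : Fin 1 → ℂ =>
      Real.exp (-(2 * ((1 - t) / (1 + t))) * ‖α 0‖ ^ 2)) μ := by
    intro t ht
    have ht1 : 0 < 1 + t := by linarith [neg_lt_of_abs_lt ht]
    refine (hN.const_mul ((1 + t) * ∑' n, |t| ^ n * B n)).mono'
      (Continuous.aestronglyMeasurable (by fun_prop)) (Eventually.of_forall fun α => ?_)
    have h1 := hdom t ht α
    rw [Complex.norm_real, norm_mul, norm_inv, Real.norm_of_nonneg ht1.le,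
      inv_mul_le_iff₀ ht1, ← mul_assoc, neg_mul] at h1
    exact h1
  refine ⟨μ.map fun α => ‖α 0‖ ^ 2, fun u hu => ?_, fun t ht => ?_⟩
  · rw [integrable_map_measure (Continuous.aestronglyMeasurable (by fun_prop))
      hρ.measurable.aemeasurable]
    -- The inverse of `t ↦ 2(1-t)/(1+t)`, a bijection from `(-1, 1)` onto `(0, ∞)`.
    have h1 : |(2 - u) / (2 + u)| < 1 := by
      rw [abs_div, abs_of_pos (by linarith : 0 < 2 + u), div_lt_one (by linarith), abs_lt]
      constructor <;> linarith
    refine (hint _ h1).congr (Eventually.of_forall fun α => ?_)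
    simp only [Function.comp_apply]
    congr 2
    field_simp
    ring
  · have h1 : ∀ n, ⟪(fock n).vec, T (fock n).vec⟫_ℂ = 2 * ∫ α, fockElem n n α ∂μ := fun n => by
      rw [h, integral_wigner, pow_one]; rfl
    have h2 := hasSum_integral_of_dominated_convergence (μ := μ)
      (F := fun n α => (t : ℂ) ^ n * fockElem n n α)
      (fun n α => |t| ^ n * B n * w α)
      (fun n => (continuous_const.mul (continuous_phaseElem _ _)).aestronglyMeasurable)
      (fun n => Eventually.of_forall fun α => by
        rw [norm_mul, norm_pow, Complex.norm_real, Real.norm_eq_abs, mul_assoc]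
        gcongr
        exact hb n α)
      (Eventually.of_forall fun α => (hBs t ht).mul_right _)
      (by simp_rw [tsum_mul_right]; exact hN.const_mul _)
      (Eventually.of_forall fun α => hasSum_fockElem ht α)
    have h3 := h2.mul_left 2
    rw [integral_complex_ofReal, integral_const_mul] at h3
    rw [integral_map hρ.measurable.aemeasurable
      (Continuous.aestronglyMeasurable (by fun_prop))]
    simp only [integral_const_mul] at h3
    simp only [h1]
    have h4 : (2 : ℂ) * ((((1 + t)⁻¹ * ∫ α : Fin 1 → ℂ,
        Real.exp (-2 * ((1 - t) / (1 + t)) * ‖α 0‖ ^ 2) ∂μ) : ℝ) : ℂ) =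
        ((2 * ((1 + t)⁻¹ * ∫ α : Fin 1 → ℂ,
          Real.exp (-(2 * ((1 - t) / (1 + t))) * ‖α 0‖ ^ 2) ∂μ) : ℝ) : ℂ) := by
      rw [Complex.ofReal_mul 2, Complex.ofReal_ofNat]
      simp only [neg_mul]
    rw [h4] at h3
    exact h3.congr_fun fun n => by ring

/-! ## Distinguishability under Wigner-positive measurements -/

theorem POVM.inner_biUnion {H X : Type} [NormedAddCommGroup H] [InnerProductSpace ℂ H]
    [CompleteSpace H] [MeasurableSpace X] (E : POVM H X) (P : Finset (Set X))
    (hP : ∀ A ∈ P, MeasurableSet A) (hd : (P : Set (Set X)).PairwiseDisjoint id) (ψ : H) :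
    ⟪ψ, E.toFun (⋃ A ∈ P, A) ψ⟫_ℂ = ∑ A ∈ P, ⟪ψ, E.toFun A ψ⟫_ℂ := by
  classical
  induction P using Finset.induction_on with
  | empty => simp [E.inner_empty]
  | insert A P hA ih =>
    have hP' : ∀ B ∈ P, MeasurableSet B := fun B hB => hP B (Finset.mem_insert_of_mem hB)
    have hd' : (P : Set (Set X)).PairwiseDisjoint id :=
      hd.subset (by simp)
    rw [Finset.set_biUnion_insert, Finset.sum_insert hA, E.inner_union (hP A (by simp))
      (P.measurableSet_biUnion hP'), ih hP' hd']
    refine Set.disjoint_iUnion₂_right.2 fun B hB => ?_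
    exact hd (by simp) (by simp [hB]) fun h => hA (h ▸ hB)

/-! ### The radial profile of the difference of the states -/

/-- The Wigner function of `ω_l⁺ - ω_l⁻`, up to a constant factor, as a function of `|α|²`. -/
def thermalWigner (l s : ℝ) : ℝ :=
  1 / (2 * l) * ((1 + l) ^ 2 * Real.exp (-(2 * ((1 + l) / (1 - l))) * s) -
    (1 - l) ^ 2 * Real.exp (-(2 * ((1 - l) / (1 + l))) * s))

/-- Combining `lⁿ` and `(-l)ⁿ` selects the parity and lets the generating function be used at `t =
±l`. The division by `l` is why `l = 0` is treated apart. -/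
theorem thermalCoeff_eq {l : ℝ} (h0 : 0 < l) (n : ℕ) :
    (evenCoeff l - oddCoeff l) n =
      (1 - l ^ 2) / (2 * l) * ((l - 1) * l ^ n + (l + 1) * (-l) ^ n) := by
  rw [Pi.sub_apply, evenCoeff, oddCoeff]
  split_ifs with hn
  · rw [hn.neg_pow]
    field_simp
    ring
  · have hn' : Odd n := Nat.not_even_iff_odd.1 hn
    obtain ⟨k, rfl⟩ := hn'
    rw [Odd.neg_pow ⟨k, rfl⟩, Nat.add_sub_cancel]
    field_simp
    ring

theorem integrable_thermalWigner {l : ℝ} (h0 : 0 < l) (h1 : l < 1) {ν : Measure ℝ}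
    (hν : ∀ u, 0 < u → Integrable (fun s => Real.exp (-u * s)) ν) :
    Integrable (thermalWigner l) ν := by
  have ha : 0 < 2 * ((1 + l) / (1 - l)) := by
    have : 0 < 1 - l := by linarith
    positivity
  have hb : 0 < 2 * ((1 - l) / (1 + l)) := by
    have : 0 < 1 - l := by linarith
    positivity
  exact (((hν _ ha).const_mul _).sub ((hν _ hb).const_mul _)).const_mul _

theorem hasSum_thermalCoeff {l : ℝ} (h0 : 0 < l) (h1 : l < 1) {ν : Measure ℝ} {e : ℕ → ℂ}
    (hν : ∀ u, 0 < u → Integrable (fun s => Real.exp (-u * s)) ν)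
    (he : ∀ t : ℝ, |t| < 1 → HasSum (fun n => (t : ℂ) ^ n * e n)
        ((2 * ((1 + t)⁻¹ * ∫ s, Real.exp (-(2 * ((1 - t) / (1 + t))) * s) ∂ν) : ℝ) : ℂ)) :
    HasSum (fun n => ((evenCoeff l - oddCoeff l) n : ℂ) * e n)
      ((2 * ∫ s, thermalWigner l s ∂ν : ℝ) : ℂ) := by
  have hl : 0 < 1 - l := by linarith
  have ha : 0 < 2 * ((1 + l) / (1 - l)) := by positivity
  have hb : 0 < 2 * ((1 - l) / (1 + l)) := by positivity
  have e1 := (he l (by rwa [abs_of_pos h0])).mul_left (((1 - l ^ 2) / (2 * l) * (l - 1) : ℝ) : ℂ)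
  have e2 := (he (-l) (by rwa [abs_neg, abs_of_pos h0])).mul_left
    (((1 - l ^ 2) / (2 * l) * (l + 1) : ℝ) : ℂ)
  have h3 : (2 * ∫ s, thermalWigner l s ∂ν : ℝ) =
      (1 - l ^ 2) / (2 * l) * (l - 1) *
        (2 * ((1 + l)⁻¹ * ∫ s, Real.exp (-(2 * ((1 - l) / (1 + l))) * s) ∂ν)) +
      (1 - l ^ 2) / (2 * l) * (l + 1) *
        (2 * ((1 + -l)⁻¹ * ∫ s, Real.exp (-(2 * ((1 - -l) / (1 + -l))) * s) ∂ν)) := by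
    simp only [thermalWigner, sub_neg_eq_add, ← sub_eq_add_neg]
    rw [integral_const_mul, integral_sub ((hν _ ha).const_mul _) ((hν _ hb).const_mul _),
      integral_const_mul, integral_const_mul]
    field_simp
    ring
  rw [h3, Complex.ofReal_add, Complex.ofReal_mul, Complex.ofReal_mul _ (2 * ((1 + -l)⁻¹ * _))]
  refine (e1.add e2).congr_fun fun n => ?_
  rw [thermalCoeff_eq h0]
  push_cast
  ring

theorem integral_Ioi_thermalWigner {l : ℝ} (h0 : 0 < l) (h1 : l < 1) (c : ℝ) :
    ∫ s in Set.Ioi c, thermalWigner l s = (1 - l ^ 2) / (4 * l) *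
      (Real.exp (-(2 * ((1 + l) / (1 - l))) * c) - Real.exp (-(2 * ((1 - l) / (1 + l))) * c)) := by
  have hl : 0 < 1 - l := by linarith
  have ha : 0 < 2 * ((1 + l) / (1 - l)) := by positivity
  have hb : 0 < 2 * ((1 - l) / (1 + l)) := by positivity
  simp only [thermalWigner]
  rw [integral_const_mul, integral_sub ((integrableOn_exp_mul_Ioi (neg_lt_zero.2 ha) c).const_mul _)
    ((integrableOn_exp_mul_Ioi (neg_lt_zero.2 hb) c).const_mul _), integral_const_mul,
    integral_const_mul, integral_exp_mul_Ioi (neg_lt_zero.2 ha),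
    integral_exp_mul_Ioi (neg_lt_zero.2 hb)]
  field_simp
  ring

/-- The profile integrates to zero and changes sign once, from positive to negative, so the integral
of its modulus is minus twice the tail beyond the zero. -/
theorem integral_abs_thermalWigner {l : ℝ} (h0 : 0 < l) (h1 : l < 1) :
    ∫ s in Set.Ioi 0, |thermalWigner l s| =
      2 * ((1 - l) / (1 + l)) ^ ((1 + l ^ 2) / (2 * l)) := by
  have hl : 0 < 1 - l := by linarith
  set q : ℝ := (1 - l) / (1 + l) with hq
  have hq0 : 0 < q := by positivity
  have hq1 : q < 1 := by rw [hq, div_lt_one (by linarith)]; linarith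
  have hqi : (1 + l) / (1 - l) = q⁻¹ := by rw [hq, inv_div]
  have hlog : Real.log q < 0 := Real.log_neg hq0 hq1
  have hab : 0 < 2 * q⁻¹ - 2 * q := by
    have : 1 < q⁻¹ := (one_lt_inv₀ hq0).2 hq1
    linarith
  -- The zero of the profile: the ratio of its exponentials must equal `q²`, the ratio of the
  -- coefficients.
  set s0 : ℝ := -2 * Real.log q / (2 * q⁻¹ - 2 * q) with hs0
  have hs1 : (2 * q⁻¹ - 2 * q) * s0 = -2 * Real.log q := by
    rw [hs0]; exact mul_div_cancel₀ _ hab.ne'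
  have hs0pos : 0 ≤ s0 := div_nonneg (by linarith) hab.le
  have hfac : ∀ s, thermalWigner l s = 1 / (2 * l) * ((1 + l) ^ 2 * Real.exp (-(2 * q) * s)) *
      (Real.exp (-(2 * q⁻¹ - 2 * q) * s) - Real.exp (-(2 * q⁻¹ - 2 * q) * s0)) := by
    intro s
    have h2 : Real.exp (-(2 * q⁻¹ - 2 * q) * s0) = q ^ 2 := by
      have : -(2 * q⁻¹ - 2 * q) * s0 = Real.log q + Real.log q := by
        linear_combination -hs1
      rw [this, Real.exp_add, Real.exp_log hq0]; ring
    have h3 : Real.exp (-(2 * q⁻¹) * s) =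
        Real.exp (-(2 * q) * s) * Real.exp (-(2 * q⁻¹ - 2 * q) * s) := by
      rw [← Real.exp_add]; congr 1; ring
    have h4 : (1 - l) ^ 2 = (1 + l) ^ 2 * q ^ 2 := by
      rw [hq, div_pow]; field_simp
    rw [h2, thermalWigner, hqi, h3, h4]
    ring
  have hint : IntegrableOn (thermalWigner l) (Set.Ioi 0) :=
    integrable_thermalWigner h0 h1 fun u hu => integrableOn_exp_mul_Ioi (neg_lt_zero.2 hu) 0
  have hpos : ∀ s ∈ Set.Ioc 0 s0, |thermalWigner l s| = thermalWigner l s := fun s hs => by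
    refine abs_of_nonneg ?_
    rw [hfac]
    refine mul_nonneg (by positivity) (sub_nonneg.2 (Real.exp_le_exp.2 ?_))
    exact mul_le_mul_of_nonpos_left hs.2 (by linarith)
  have hneg : ∀ s ∈ Set.Ioi s0, |thermalWigner l s| = -thermalWigner l s := fun s hs => by
    refine abs_of_nonpos ?_
    rw [hfac]
    refine mul_nonpos_of_nonneg_of_nonpos (by positivity) (sub_nonpos.2 (Real.exp_le_exp.2 ?_))
    exact mul_le_mul_of_nonpos_left (le_of_lt hs) (by linarith)
  have hU : Set.Ioc 0 s0 ∪ Set.Ioi s0 = Set.Ioi 0 := Set.Ioc_union_Ioi_eq_Ioi hs0pos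
  have hi1 : IntegrableOn (thermalWigner l) (Set.Ioc 0 s0) := hint.mono_set Set.Ioc_subset_Ioi_self
  have hi2 : IntegrableOn (thermalWigner l) (Set.Ioi s0) := hint.mono_set (Set.Ioi_subset_Ioi hs0pos)
  have hsplit := setIntegral_union (Set.Ioc_disjoint_Ioi_same) measurableSet_Ioi hi1 hi2
  have hsplit2 := setIntegral_union (Set.Ioc_disjoint_Ioi_same) measurableSet_Ioi hi1.abs hi2.abs
  rw [hU] at hsplit hsplit2
  rw [setIntegral_congr_fun measurableSet_Ioc hpos, setIntegral_congr_fun measurableSet_Ioi hneg,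
    integral_neg] at hsplit2
  rw [integral_Ioi_thermalWigner h0 h1, integral_Ioi_thermalWigner h0 h1] at hsplit
  rw [integral_Ioi_thermalWigner h0 h1] at hsplit2
  have hval : ∫ s in Set.Ioi 0, |thermalWigner l s| = (1 - l ^ 2) / (2 * l) *
      (Real.exp (-(2 * q) * s0) - Real.exp (-(2 * q⁻¹) * s0)) := by
    rw [hqi] at hsplit hsplit2
    refine hsplit2.trans ?_
    simp only [mul_zero, sub_self] at hsplit
    have h5 : (1 - l ^ 2) / (2 * l) = 2 * ((1 - l ^ 2) / (4 * l)) := by field_simp; ring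
    rw [h5]
    linear_combination -hsplit
  have he1 : Real.exp (-(2 * q) * s0) = Real.exp (Real.log q * ((1 - l) ^ 2 / (2 * l))) := by
    congr 1
    have h6 : 2 * q⁻¹ - 2 * q = 8 * l / ((1 - l) * (1 + l)) := by
      rw [hq]; field_simp; ring
    rw [hs0, h6, hq]
    field_simp
    ring
  have he2 : Real.exp (-(2 * q⁻¹) * s0) = q ^ 2 * Real.exp (-(2 * q) * s0) := by
    have : -(2 * q⁻¹) * s0 = Real.log q + Real.log q + -(2 * q) * s0 := by
      linear_combination -hs1
    rw [this, Real.exp_add, Real.exp_add, Real.exp_log hq0]; ring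
  have he3 : q ^ ((1 + l ^ 2) / (2 * l)) = q * Real.exp (Real.log q * ((1 - l) ^ 2 / (2 * l))) := by
    rw [Real.rpow_def_of_pos hq0]
    nth_rewrite 2 [← Real.exp_log hq0]
    rw [← Real.exp_add]
    congr 1
    field_simp
    ring
  rw [hval, he2, he1, he3]
  have h7 : (1 - l ^ 2) / (2 * l) * (1 - q ^ 2) = 2 * q := by
    rw [hq]; field_simp; ring
  linear_combination Real.exp (Real.log q * ((1 - l) ^ 2 / (2 * l))) * h7

/-- The radial measures of the outcomes are positive and, once the partition is completed, add up to
Lebesgue measure on the half-line. Hence the triangle inequality under each integral gives a bound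
free of the measurement. -/
theorem sum_norm_thermal_le {l : ℝ} (h0 : 0 < l) (h1 : l < 1) {X : Type} [MeasurableSpace X]
    (E : POVM (L2 1) X) (hE : WignerPos 1 X E) (P : Finset (Set X))
    (hP : ∀ A ∈ P, MeasurableSet A) (hd : (P : Set (Set X)).PairwiseDisjoint id) :
    ∑ A ∈ P, ‖∑' n, ((evenCoeff l - oddCoeff l) n : ℂ) *
      ⟪(fock n).vec, E.toFun A (fock n).vec⟫_ℂ‖ ≤
      4 * ((1 - l) / (1 + l)) ^ ((1 + l ^ 2) / (2 * l)) := by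
  choose! ν hν1 hν2 using fun A (hA : MeasurableSet A) => exists_radial_measure (hE A hA)
  have hU : MeasurableSet (⋃ A ∈ P, A) := P.measurableSet_biUnion hP
  -- The family `P` need not cover `X`; the missing event is added so that the effects sum to the
  -- identity, and its contribution is dropped at the end.
  set B : Set X := (⋃ A ∈ P, A)ᶜ with hB
  have hBm : MeasurableSet B := hU.compl
  set N : Measure ℝ := ∑ A ∈ P, ν A + ν B with hN
  have hNi : ∀ u, 0 < u → Integrable (fun s => Real.exp (-u * s)) N := fun u hu =>
    (integrable_finsetSum_measure.2 fun A hA => hν1 A (hP A hA) u hu).add_measure (hν1 B hBm u hu)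
  have hNsum : ∀ f : ℝ → ℝ, (∀ A, MeasurableSet A → Integrable f (ν A)) →
      ∫ s, f s ∂N = ∑ A ∈ P, ∫ s, f s ∂(ν A) + ∫ s, f s ∂(ν B) := fun f hf => by
    rw [hN, integral_add_measure (integrable_finsetSum_measure.2 fun A hA => hf A (hP A hA))
      (hf B hBm), integral_finsetSum_measure fun A hA => hf A (hP A hA)]
  have hone : ∀ n, ∑ A ∈ P, ⟪(fock n).vec, E.toFun A (fock n).vec⟫_ℂ +
      ⟪(fock n).vec, E.toFun B (fock n).vec⟫_ℂ = 1 := fun n => by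
    rw [E.inner_compl hU, E.inner_biUnion P hP hd, inner_self_eq_norm_sq_to_K, norm_fock]
    simp
  have hNu : ∀ u, 0 < u → ∫ s, Real.exp (-u * s) ∂N = u⁻¹ := fun u hu => by
    -- At this `t` the radial formula has Laplace parameter exactly `u`; equating it with the
    -- geometric series `(1 - t)⁻¹` yields `u⁻¹`.
    set t : ℝ := (2 - u) / (2 + u) with ht
    have ht1 : 1 + t = 4 / (2 + u) := by rw [ht]; field_simp; ring
    have ht2 : 1 - t = 2 * u / (2 + u) := by rw [ht]; field_simp; ring
    have htl : |t| < 1 := by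
      have h3 : 0 < 1 + t := by rw [ht1]; positivity
      have h4 : 0 < 1 - t := by rw [ht2]; positivity
      exact abs_lt.2 ⟨by linarith, by linarith⟩
    have hut : 2 * ((1 - t) / (1 + t)) = u := by rw [ht1, ht2]; field_simp; ring
    have hs := (hasSum_sum fun A hA => hν2 A (hP A hA) t htl).add (hν2 B hBm t htl)
    have hs' : HasSum (fun n => (t : ℂ) ^ n) _ := hs.congr_fun fun n => by
      rw [← Finset.mul_sum, ← mul_add, hone, mul_one]
    have hg := hasSum_geometric_of_norm_lt_one (ξ := (t : ℂ)) (by simpa using htl)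
    have hq := hs'.unique hg
    rw [hut] at hq
    rw [hNsum _ fun A hA => hν1 A hA u hu]
    have hq2 : ∑ A ∈ P, 2 * ((1 + t)⁻¹ * ∫ s, Real.exp (-u * s) ∂(ν A)) +
        2 * ((1 + t)⁻¹ * ∫ s, Real.exp (-u * s) ∂(ν B)) = (1 - t)⁻¹ := by
      exact_mod_cast hq
    rw [← Finset.mul_sum, ← Finset.mul_sum, ht1, ht2] at hq2
    field_simp at hq2 ⊢
    linarith
  have hvol : N = volume.restrict (Set.Ioi 0) := measure_eq_volume_of_laplace hNi hNu
  have hi : ∀ A, MeasurableSet A → Integrable (thermalWigner l) (ν A) := fun A hA =>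
    integrable_thermalWigner h0 h1 (hν1 A hA)
  calc _ ≤ ∑ A ∈ P, 2 * ∫ s, |thermalWigner l s| ∂(ν A) := by
        refine Finset.sum_le_sum fun A hA => ?_
        rw [(hasSum_thermalCoeff h0 h1 (hν1 A (hP A hA)) (hν2 A (hP A hA))).tsum_eq,
          Complex.norm_real, Real.norm_eq_abs, abs_mul, abs_two]
        gcongr
        exact abs_integral_le_integral_abs
    _ ≤ 2 * ∫ s, |thermalWigner l s| ∂N := by
        rw [hNsum _ fun A hA => (hi A hA).abs, ← Finset.mul_sum]
        have : 0 ≤ ∫ s, |thermalWigner l s| ∂(ν B) := integral_nonneg fun s => abs_nonneg _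
        linarith
    _ = _ := by rw [hvol, integral_abs_thermalWigner h0 h1]; ring

/-! ### The boundary case `l = 0` as a limit -/

/-- The logarithm is `(1 + l²)/2` times the difference quotient at `0` of `log(1-l) - log(1+l)`,
whose derivative there is `-2`. -/
theorem tendsto_thermal_exponent :
    Tendsto (fun l : ℝ => ((1 - l) / (1 + l)) ^ ((1 + l ^ 2) / (2 * l))) (𝓝[>] 0)
      (𝓝 (Real.exp (-1))) := by
  have hd : HasDerivAt (fun l : ℝ => Real.log (1 - l) - Real.log (1 + l)) (-2) 0 := by
    have h1 := ((hasDerivAt_id (0 : ℝ)).const_sub 1).log (by norm_num)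
    have h2 := ((hasDerivAt_id (0 : ℝ)).const_add 1).log (by norm_num)
    refine (h1.sub h2).congr_deriv ?_
    norm_num
  have ht := (hasDerivAt_iff_tendsto_slope_zero.1 hd).mono_left (nhdsGT_le_nhdsNE (0 : ℝ))
  have hc : Tendsto (fun l : ℝ => (1 + l ^ 2) / 2) (𝓝[>] 0) (𝓝 ((1 + 0 ^ 2) / 2)) :=
    Tendsto.mono_left (Continuous.tendsto (by fun_prop) 0) nhdsWithin_le_nhds
  have he := (Real.continuous_exp.tendsto _).comp (ht.mul hc)
  norm_num at he
  refine he.congr' ?_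
  filter_upwards [Ioo_mem_nhdsGT (zero_lt_one' ℝ)] with l hl
  have hl1 : 0 < 1 - l := by linarith [hl.2]
  have hl2 : 0 < 1 + l := by linarith [hl.1]
  rw [Real.rpow_def_of_pos (by positivity), Real.log_div hl1.ne' hl2.ne']
  simp only [Function.comp_apply]
  congr 1
  have := hl.1.ne'
  field_simp

/-- A majorant uniform in small `l`; the factor `2` accounts for the exponent `n - 1` at odd
indices. -/
theorem abs_thermalCoeff_le {l : ℝ} (h0 : 0 ≤ l) (h1 : l ≤ 1 / 2) (n : ℕ) :
    |(evenCoeff l - oddCoeff l) n| ≤ 2 * (1 / 2) ^ n := by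
  have h2 : |1 - l ^ 2| ≤ 1 := abs_le.2 ⟨by nlinarith, by nlinarith⟩
  rw [Pi.sub_apply, evenCoeff, oddCoeff]
  split_ifs with hn
  · rw [sub_zero, abs_mul, abs_pow, abs_of_nonneg h0]
    calc |1 - l ^ 2| * l ^ n ≤ 1 * (1 / 2) ^ n := by gcongr
      _ ≤ 2 * (1 / 2) ^ n := by gcongr; norm_num
  · obtain ⟨k, rfl⟩ := Nat.not_even_iff_odd.1 hn
    rw [zero_sub, abs_neg, abs_mul, abs_pow, abs_of_nonneg h0, Nat.add_sub_cancel]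
    calc |1 - l ^ 2| * l ^ (2 * k) ≤ 1 * (1 / 2) ^ (2 * k) := by gcongr
      _ = 2 * (1 / 2) ^ (2 * k + 1) := by ring

theorem continuous_thermalCoeff (n : ℕ) :
    Continuous fun l : ℝ => (evenCoeff l - oddCoeff l) n := by
  simp only [Pi.sub_apply, evenCoeff, oddCoeff]
  split_ifs <;> fun_prop

/-- For a fixed measurement and a fixed finite family the sum is continuous at `l = 0` from the
right, by dominated convergence, so the bound for positive `l` passes to the limit. -/
theorem sum_norm_thermal_zero_le {X : Type} [MeasurableSpace X]
    (E : POVM (L2 1) X) (hE : WignerPos 1 X E) (P : Finset (Set X))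
    (hP : ∀ A ∈ P, MeasurableSet A) (hd : (P : Set (Set X)).PairwiseDisjoint id) :
    ∑ A ∈ P, ‖∑' n, ((evenCoeff 0 - oddCoeff 0) n : ℂ) *
      ⟪(fock n).vec, E.toFun A (fock n).vec⟫_ℂ‖ ≤ 4 * Real.exp (-1) := by
  refine le_of_tendsto_of_tendsto (b := 𝓝[>] (0 : ℝ)) (f := fun l : ℝ => ∑ A ∈ P,
    ‖∑' n, ((evenCoeff l - oddCoeff l) n : ℂ) *
      ⟪(fock n).vec, E.toFun A (fock n).vec⟫_ℂ‖) ?_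
    (tendsto_thermal_exponent.const_mul 4) ?_
  · refine tendsto_finsetSum _ fun A hA => Tendsto.norm ?_
    refine tendsto_tsum_of_dominated_convergence (bound := fun n : ℕ => 2 * (1 / 2 : ℝ) ^ n)
      (summable_geometric_two.mul_left 2) (fun n => ?_) ?_
    · exact (((Complex.continuous_ofReal.comp (continuous_thermalCoeff n)).tendsto 0).mono_left
        nhdsWithin_le_nhds).mul_const _
    · filter_upwards [Ioo_mem_nhdsGT (one_half_pos (α := ℝ))] with l hl n
      have h1 := E.norm_inner_le (hP A hA) (fock n).vec
      rw [norm_fock, one_pow] at h1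
      rw [norm_mul, Complex.norm_real, Real.norm_eq_abs]
      calc _ ≤ 2 * (1 / 2 : ℝ) ^ n * 1 := by
            gcongr
            exact abs_thermalCoeff_le hl.1.le hl.2.le n
        _ = _ := mul_one _
  · filter_upwards [Ioo_mem_nhdsGT (zero_lt_one' ℝ)] with l hl
    exact sum_norm_thermal_le hl.1 hl.2 E hE P hP hd

theorem half_distNorm_thermal_le {l C : ℝ} (h0 : 0 ≤ l) (h1 : l < 1)
    (h : ∀ (X : Type) [MeasurableSpace X] (E : POVM (L2 1) X), WignerPos 1 X E →
      ∀ P : Finset (Set X), (∀ A ∈ P, MeasurableSet A) → (P : Set (Set X)).PairwiseDisjoint id →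
      ∑ A ∈ P, ‖∑' n, ((evenCoeff l - oddCoeff l) n : ℂ) *
        ⟪(fock n).vec, E.toFun A (fock n).vec⟫_ℂ‖ ≤ 2 * C) :
    2⁻¹ * distNorm (WignerPos 1) (evenThermal l - oddThermal l) ≤ ENNReal.ofReal C := by
  have h2 : distNorm (WignerPos 1) (evenThermal l - oddThermal l) ≤ 2 * ENNReal.ofReal C := by
    refine iSup_le fun X => iSup_le fun _ => iSup_le fun E => iSup_le fun hE => ?_
    refine iSup_le fun P => iSup_le fun hP => iSup_le fun hd => ?_
    have h3 := ENNReal.ofReal_le_ofReal (h X E hE P hP hd)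
    rw [ENNReal.ofReal_sum_of_nonneg fun A _ => norm_nonneg _, ENNReal.ofReal_mul zero_le_two,
      ENNReal.ofReal_ofNat] at h3
    refine le_trans (le_of_eq (Finset.sum_congr rfl fun A _ => ?_)) h3
    rw [ofReal_norm]
    dsimp only
    rw [evenThermal_sub_oddThermal h0 h1,
      opTrace_diagOp_mul orthonormal_fock (summable_thermalCoeff h0 h1)]
  calc _ ≤ 2⁻¹ * (2 * ENNReal.ofReal C) := by gcongr
    _ = _ := by rw [← mul_assoc, ENNReal.inv_mul_cancel two_ne_zero ENNReal.ofNat_ne_top, one_mul]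

theorem half_distNorm_WignerPos_le {l : ℝ} (h0 : 0 < l) (h1 : l < 1) :
    2⁻¹ * distNorm (WignerPos 1) (evenThermal l - oddThermal l) ≤
      ENNReal.ofReal (2 * ((1 - l) / (1 + l)) ^ ((1 + l ^ 2) / (2 * l))) :=
  half_distNorm_thermal_le h0.le h1 fun X _ E hE P hP hd => by
    rw [← mul_assoc]
    exact (sum_norm_thermal_le h0 h1 E hE P hP hd).trans_eq (by norm_num)

theorem half_distNorm_WignerPos_zero_le :
    2⁻¹ * distNorm (WignerPos 1) (evenThermal 0 - oddThermal 0) ≤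
      ENNReal.ofReal (2 * Real.exp (-1)) :=
  half_distNorm_thermal_le le_rfl one_pos fun X _ E hE P hP hd => by
    rw [← mul_assoc]
    exact (sum_norm_thermal_zero_le E hE P hP hd).trans_eq (by norm_num)

/-! ## Asymptotics and data hiding -/

/-- With `q = (1-l)/(1+l)` the power is `q · q^d`, where `d = (1-l)²/(2l)`. Here `2q` differs from
`1 - l` by `(1-l)²/(1+l)`, and `1 - d/q ≤ q^d ≤ 1` makes the error of the second factor at most `2d`
after multiplication by `2q`. -/
theorem isBigO_thermal_bound :
    (fun l : ℝ => 2 * ((1 - l) / (1 + l)) ^ ((1 + l ^ 2) / (2 * l)) - (1 - l))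
      =O[𝓝[<] 1] (fun l : ℝ => (1 - l) ^ 2) := by
  refine IsBigO.of_bound 3 ?_
  filter_upwards [Ioo_mem_nhdsLT (show (1 / 2 : ℝ) < 1 by norm_num)] with l hl
  obtain ⟨hl1, hl2⟩ := hl
  have hx : 0 < 1 - l := by linarith
  set q : ℝ := (1 - l) / (1 + l) with hq
  have hq0 : 0 < q := by positivity
  have hq1 : q ≤ 1 := by rw [hq, div_le_one (by linarith)]; linarith
  set d : ℝ := (1 - l) ^ 2 / (2 * l) with hd
  have hd0 : 0 ≤ d := by positivity
  have hexp : (1 + l ^ 2) / (2 * l) = 1 + d := by rw [hd]; field_simp; ring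
  have hlog : -(Real.log q * d) ≤ q⁻¹ * d := by
    have h := Real.log_le_sub_one_of_pos (inv_pos.2 hq0)
    rw [Real.log_inv] at h
    nlinarith
  have hlow : 1 - q⁻¹ * d ≤ q ^ d := by
    rw [Real.rpow_def_of_pos hq0]
    linarith [Real.add_one_le_exp (Real.log q * d)]
  have hup : q ^ d ≤ 1 := Real.rpow_le_one hq0.le hq1 hd0
  have hqx : 2 * q - (1 - l) = (1 - l) ^ 2 / (1 + l) := by rw [hq]; field_simp; ring
  have hqx1 : 0 ≤ (1 - l) ^ 2 / (1 + l) := by positivity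
  have hqx2 : (1 - l) ^ 2 / (1 + l) ≤ (1 - l) ^ 2 :=
    div_le_self (sq_nonneg _) (by linarith)
  have hd2 : d ≤ (1 - l) ^ 2 := div_le_self (sq_nonneg _) (by linarith)
  have hqd : q * (q⁻¹ * d) = d := mul_inv_cancel_left₀ hq0.ne' d
  rw [hexp, Real.rpow_add hq0, Real.rpow_one, Real.norm_eq_abs, Real.norm_eq_abs,
    abs_of_nonneg (sq_nonneg (1 - l)), abs_le]
  have h1 := mul_le_mul_of_nonneg_left hlow hq0.le
  have h2 := mul_le_mul_of_nonneg_left hup hq0.le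
  constructor <;> nlinarith

theorem opTrace_smul {H : Type} [NormedAddCommGroup H] [InnerProductSpace ℂ H] [CompleteSpace H]
    (c : ℂ) (T : H →L[ℂ] H) : opTrace (c • T) = c * opTrace T := by
  simp only [opTrace, smul_apply, inner_smul_right]
  exact tsum_mul_left

theorem distNorm_smul_le {m : ℕ} (M : Measurements m) (c : ℂ) (Z : L2 m →L[ℂ] L2 m) :
    distNorm M (c • Z) ≤ ‖c‖ₑ * distNorm M Z := by
  refine iSup_le fun X => iSup_le fun _ => iSup_le fun E => iSup_le fun hE => ?_
  refine iSup_le fun P => iSup_le fun hP => iSup_le fun hd => ?_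
  simp only [smul_mul_assoc, opTrace_smul, enorm_mul]
  rw [← Finset.mul_sum]
  gcongr
  refine le_trans ?_ (le_iSup_of_le X <| le_iSup_of_le _ <| le_iSup_of_le E <|
    le_iSup_of_le hE le_rfl)
  exact le_iSup_of_le P <| le_iSup_of_le hP <| le_iSup_of_le hd le_rfl

theorem tendsto_thermal_bound :
    Tendsto (fun l : ℝ => 2 * ((1 - l) / (1 + l)) ^ ((1 + l ^ 2) / (2 * l))) (𝓝[<] 1) (𝓝 0) := by
  have h1 : Tendsto (fun l : ℝ => 1 - l) (𝓝[<] 1) (𝓝 (1 - 1)) :=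
    (Continuous.tendsto (by fun_prop) _).mono_left nhdsWithin_le_nhds
  have h2 : Tendsto (fun l : ℝ => (1 - l) ^ 2) (𝓝[<] 1) (𝓝 ((1 - 1) ^ 2)) := h1.pow 2
  rw [sub_self] at h1 h2
  rw [zero_pow two_ne_zero] at h2
  simpa using (isBigO_thermal_bound.trans_tendsto h2).add h1

theorem tendsto_bias_GOCC_thermal :
    Tendsto (fun l : ℝ => bias (GOCC 1) (evenThermal l) (oddThermal l) (1 / 2))
      (𝓝[<] 1) (𝓝 0) := by
  have h1 := ENNReal.tendsto_ofReal tendsto_thermal_bound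
  rw [ENNReal.ofReal_zero] at h1
  refine tendsto_of_tendsto_of_tendsto_of_le_of_le' tendsto_const_nhds h1
    (Eventually.of_forall fun _ => zero_le) ?_
  filter_upwards [Ioo_mem_nhdsLT (zero_lt_one' ℝ)] with l hl
  have h2 : ‖(2⁻¹ : ℂ)‖ₑ = 2⁻¹ := by
    rw [← ofReal_norm, norm_inv, Complex.norm_ofNat, ENNReal.ofReal_inv_of_pos two_pos,
      ENNReal.ofReal_ofNat]
  calc bias (GOCC 1) (evenThermal l) (oddThermal l) (1 / 2)
      ≤ 2⁻¹ * distNorm (GOCC 1) (evenThermal l - oddThermal l) := by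
        rw [bias, half_smul_sub, ← h2]
        exact distNorm_smul_le _ _ _
    _ ≤ 2⁻¹ * distNorm (WignerPos 1) (evenThermal l - oddThermal l) := by
        gcongr
        exact distNorm_GOCC_le _
    _ ≤ _ := half_distNorm_WignerPos_le hl.1 hl.2

end CV

end

theorem mainTheorem4 :
    (∀ l : ℝ, 0 ≤ l → l < 1 →
      CV.IsDensityOperator (CV.evenThermal l) ∧ CV.IsDensityOperator (CV.oddThermal l) ∧
      CV.evenThermal l * CV.oddThermal l = 0 ∧
      2⁻¹ * CV.traceNorm (CV.evenThermal l - CV.oddThermal l) = 1 ∧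
      2⁻¹ * CV.distNorm (CV.GOCC 1) (CV.evenThermal l - CV.oddThermal l) ≤
        2⁻¹ * CV.distNorm (CV.WignerPos 1) (CV.evenThermal l - CV.oddThermal l) ∧
      (0 < l → 2⁻¹ * CV.distNorm (CV.WignerPos 1) (CV.evenThermal l - CV.oddThermal l) ≤
        ENNReal.ofReal (2 * ((1 - l) / (1 + l)) ^ ((1 + l ^ 2) / (2 * l)))) ∧
      (l = 0 → 2⁻¹ * CV.distNorm (CV.WignerPos 1) (CV.evenThermal l - CV.oddThermal l) ≤
        ENNReal.ofReal (2 * Real.exp (-1)))) ∧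
    (fun l : ℝ => 2 * ((1 - l) / (1 + l)) ^ ((1 + l ^ 2) / (2 * l)) - (1 - l))
      =O[𝓝[<] 1] (fun l : ℝ => (1 - l) ^ 2) ∧
    (∀ l : ℝ, 0 ≤ l → l < 1 → CV.biasAll (CV.evenThermal l) (CV.oddThermal l) (1 / 2) = 1) ∧
    Tendsto (fun l : ℝ => CV.bias (CV.GOCC 1) (CV.evenThermal l) (CV.oddThermal l) (1 / 2))
      (𝓝[<] 1) (𝓝 0) := by
  refine ⟨fun l h0 h1 => ⟨CV.isDensityOperator_evenThermal h0 h1,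
    CV.isDensityOperator_oddThermal h0 h1, CV.evenThermal_mul_oddThermal h0 h1, ?_, ?_,
    fun h => CV.half_distNorm_WignerPos_le h h1, ?_⟩, CV.isBigO_thermal_bound,
    fun l h0 h1 => CV.biasAll_thermal h0 h1, CV.tendsto_bias_GOCC_thermal⟩
  · rw [CV.traceNorm_evenThermal_sub_oddThermal h0 h1,
      ENNReal.inv_mul_cancel two_ne_zero ENNReal.ofNat_ne_top]
  · gcongr
    exact CV.distNorm_GOCC_le _
  · rintro rfl
    exact CV.half_distNorm_WignerPos_zero_le
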